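/- Let $r\ge 1$ be an integer, $m>1$ real, $N\ge rm+1$ an integer, $p^*=\frac{mN}{N-rm}$, and let $\gamma$ be a real number with $1<m\gamma<p^*$. Let $\Omega\subset\mathbb R^N$ be a nonempty bounded open set (for instance a smooth bounded domain), and let $E=W_0^{r,m}(\Omega)$, the closure of $C_c^\infty(\Omega)$ in $W^{r,m}(\Omega)$. Put $D_ru=\Delta^{j}u$ if $r=2j$ and $D_ru=\nabla\Delta^{j-1}u$ if $r=2j-1$, and $\|u\|^m=\int_\Omega|D_ru|^m\,dx$ for $u\in E$. For $M:[0,\infty)\to\mathbb R$ put $\widehat M(\tau)=\int_0^\tau M(z)\,dz$ and $$\lambda_M=\inf_{u\in E,\ u\ne0}\frac{\widehat M(\|u\|^m)}{\int_\Omega|u|^{m\gamma}\,dx}\in[-\infty,\infty).$$ (i) If $M$ is continuous on $[0,\infty)$, then $\lambda_M>0$ if and only if there is a constant $C>0$ such that $\widehat M(\tau)\ge C\tau^\gamma$ for all $\tau\ge0$. (ii) If $M(\tau)=C\tau^{\gamma-1}$ for all $\tau>0$, with a constant $C>0$, then $\lambda_M$ is a real number and is attained at some $u\in E\setminus\{0\}$.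 Moreover every $u\in E\setminus\{0\}$ at which $\lambda_M$ is attained is a weak solution of the eigenvalue problem $$M(\|u\|^m)\,\Delta^r_mu=\gamma\lambda_M|u|^{m\gamma-2}u\ \text{ in }\Omega,\qquad u=\left(\tfrac{\partial}{\partial\nu}\right)^ku=0\ \text{ on }\partial\Omega,\quad 1\le k\le r-1,$$ that is, $$M(\|u\|^m)\int_\Omega|D_ru|^{m-2}D_ru\cdot D_rv\,dx=\gamma\lambda_M\int_\Omega|u|^{m\gamma-2}uv\,dx\qquad\text{for all }v\in E.$$ -/

import Mathlib

open MeasureTheory Filter Topology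
open scoped ContDiff ENNReal

noncomputable section

namespace Kirchhoff

/-- `ℝ^N` with its Euclidean norm. -/
abbrev Space (N : ℕ) : Type := EuclideanSpace ℝ (Fin N)

/-- Test functions: `φ ∈ C_c^∞(Ω)`. -/
def IsTestFunction {N : ℕ} (Ω : Set (Space N)) (φ : Space N → ℝ) : Prop :=
  ContDiff ℝ ∞ φ ∧ HasCompactSupport φ ∧ tsupport φ ⊆ Ω

/-- The classical partial derivative `∂_{i₁} ⋯ ∂_{i_k} φ` for a list `I = [i₁, …, i_k]`;
its order is `I.length`. -/
def classicalDeriv {N : ℕ} : List (Fin N) → (Space N → ℝ) → Space N → ℝ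
  | [], φ => φ
  | i :: I, φ => fun x => fderiv ℝ (classicalDeriv I φ) x (EuclideanSpace.single i 1)

/-- `g` is the weak derivative `∂_I u` on `Ω`. -/
def IsWeakDeriv {N : ℕ} (Ω : Set (Space N)) (I : List (Fin N)) (u g : Space N → ℝ) : Prop :=
  LocallyIntegrableOn u Ω ∧ LocallyIntegrableOn g Ω ∧
    ∀ φ : Space N → ℝ, IsTestFunction Ω φ →
      ∫ x in Ω, u x * classicalDeriv I φ x = (-1 : ℝ) ^ I.length * ∫ x in Ω, g x * φ x

open Classical in
/-- The weak derivative `∂_I u` on `Ω` (unique almost everywhere on `Ω` when it exists;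
`0` when it does not exist). -/
def weakDeriv {N : ℕ} (Ω : Set (Space N)) (I : List (Fin N)) (u : Space N → ℝ) : Space N → ℝ :=
  if h : ∃ g, IsWeakDeriv Ω I u g then h.choose else 0

/-- `L^m(Ω)`. -/
abbrev LmSpace {N : ℕ} (Ω : Set (Space N)) (m : ℝ) : Type :=
  Lp ℝ (ENNReal.ofReal m) (volume.restrict Ω)

/-- The Sobolev space `W^{r,m}(Ω)`: all weak derivatives of order at most `r` exist and
belong to `L^m(Ω)`. -/
def sobolev {N : ℕ} (Ω : Set (Space N)) (r : ℕ) (m : ℝ) : Set (LmSpace Ω m) :=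
  {u | ∀ I : List (Fin N), I.length ≤ r →
    ∃ g, IsWeakDeriv Ω I u g ∧ MemLp g (ENNReal.ofReal m) (volume.restrict Ω)}

/-- `W_0^{r,m}(Ω)`: the closure of `C_c^∞(Ω)` in `W^{r,m}(Ω)` for the full Sobolev norm, that is,
for convergence in `L^m(Ω)` of all derivatives of order at most `r`. -/
def sobolevZero {N : ℕ} (Ω : Set (Space N)) (r : ℕ) (m : ℝ) : Set (LmSpace Ω m) :=
  {u | u ∈ sobolev Ω r m ∧ ∃ φ : ℕ → Space N → ℝ, (∀ n, IsTestFunction Ω (φ n)) ∧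
    ∀ I : List (Fin N), I.length ≤ r →
      Tendsto (fun n => eLpNorm (fun x => weakDeriv Ω I u x - classicalDeriv I (φ n) x)
        (ENNReal.ofReal m) (volume.restrict Ω)) atTop (𝓝 0)}

/-- The weak gradient on `Ω`. -/
def weakGrad {N : ℕ} (Ω : Set (Space N)) (u : Space N → ℝ) (x : Space N) : Space N :=
  WithLp.toLp 2 fun i => weakDeriv Ω [i] u x

/-- The weak Laplacian on `Ω`. -/
def weakLaplacian {N : ℕ} (Ω : Set (Space N)) (u : Space N → ℝ) (x : Space N) : ℝ :=
  ∑ i, weakDeriv Ω [i, i] u x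

/-- The pointwise product `D_r u · D_r v`, where `D_r = Δ^j` (a scalar) if `r = 2j` and
`D_r = ∇ Δ^(j-1)` (a vector) if `r = 2j - 1`. -/
def DrInner {N : ℕ} (Ω : Set (Space N)) (r : ℕ) (u v : Space N → ℝ) (x : Space N) : ℝ :=
  if Even r then
    (weakLaplacian Ω)^[r / 2] u x * (weakLaplacian Ω)^[r / 2] v x
  else
    inner ℝ (weakGrad Ω ((weakLaplacian Ω)^[r / 2] u) x)
      (weakGrad Ω ((weakLaplacian Ω)^[r / 2] v) x)

/-- The pointwise length `|D_r u|`. -/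
def DrAbs {N : ℕ} (Ω : Set (Space N)) (r : ℕ) (u : Space N → ℝ) (x : Space N) : ℝ :=
  if Even r then |(weakLaplacian Ω)^[r / 2] u x|
  else ‖weakGrad Ω ((weakLaplacian Ω)^[r / 2] u) x‖

/-- `‖u‖^m = ∫_Ω |D_r u|^m`. -/
def energy {N : ℕ} (Ω : Set (Space N)) (r : ℕ) (m : ℝ) (u : Space N → ℝ) : ℝ :=
  ∫ x in Ω, DrAbs Ω r u x ^ m

/-- The primitive `M̂(τ) = ∫_0^τ M(z) dz`. -/
def primitive (M : ℝ → ℝ) (τ : ℝ) : ℝ := ∫ z in (0 : ℝ)..τ, M z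

/-- The critical Sobolev exponent `p^* = mN / (N - rm)`. -/
def criticalExponent (N r : ℕ) (m : ℝ) : ℝ := m * N / (N - r * m)

/-- The quotient `M̂(‖u‖^m) / ∫_Ω |u|^{mγ}`. -/
def quotient {N : ℕ} (Ω : Set (Space N)) (r : ℕ) (m γ : ℝ) (M : ℝ → ℝ) (u : Space N → ℝ) : ℝ :=
  primitive M (energy Ω r m u) / ∫ x in Ω, |u x| ^ (m * γ)

/-- `λ_M`, the infimum of the quotient over the nonzero elements of `W_0^{r,m}(Ω)`. -/
def lambdaM {N : ℕ} (Ω : Set (Space N)) (r : ℕ) (m γ : ℝ) (M : ℝ → ℝ) : EReal :=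
  ⨅ (u : LmSpace Ω m) (_ : u ∈ sobolevZero Ω r m ∧ u ≠ 0), ((quotient Ω r m γ M u : ℝ) : EReal)

/-- The coercivity condition: `C τ^γ ≤ M̂(τ)` for all `τ ≥ 0`, for some `C > 0`. -/
def Coercive (γ : ℝ) (M : ℝ → ℝ) : Prop :=
  ∃ C : ℝ, 0 < C ∧ ∀ τ : ℝ, 0 ≤ τ → C * τ ^ γ ≤ primitive M τ

/-- `u ∈ W_0^{r,m}(Ω)` is a nonzero element at which the infimum `λ_M` is attained. -/
def IsMinimizer {N : ℕ} (Ω : Set (Space N)) (r : ℕ) (m γ : ℝ) (M : ℝ → ℝ)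
    (u : LmSpace Ω m) : Prop :=
  u ∈ sobolevZero Ω r m ∧ u ≠ 0 ∧ ((quotient Ω r m γ M u : ℝ) : EReal) = lambdaM Ω r m γ M

/-- `u` is a weak solution of `M(‖u‖^m) Δ^r_m u = μ |u|^{mγ-2} u` in `Ω` with the Dirichlet
conditions `u = ∂_ν^k u = 0` on `∂Ω`, `1 ≤ k ≤ r - 1`. -/
def IsWeakSolution {N : ℕ} (Ω : Set (Space N)) (r : ℕ) (m γ : ℝ) (M : ℝ → ℝ) (μ : ℝ)
    (u : LmSpace Ω m) : Prop :=
  u ∈ sobolevZero Ω r m ∧ ∀ v ∈ sobolevZero Ω r m,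
    M (energy Ω r m u) * ∫ x in Ω, DrAbs Ω r u x ^ (m - 2) * DrInner Ω r u v x =
      μ * ∫ x in Ω, |u x| ^ (m * γ - 2) * u x * v x

end Kirchhoff

end

noncomputable section

namespace Kirchhoff

/-! Everything rests on one fact: the best constant in the embedding of `W_0^{r,m}(Ω)` into
`L^{mγ}(Ω)` is positive and attained (`exists_optimal_constant`). It yields `κ > 0` with `κ ∫
|u|^{mγ} ≤ E(u)^γ`, where `E` is the energy, and equality for some nonzero `u₀`. Multiples of `u₀`
realise every energy `τ > 0`, so a positive lower bound for the quotient is the same as `M̂(τ) ≥ C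
τ^γ`. For a pure power the quotient is `(C/γ) E(u)^γ / ∫ |u|^{mγ}`, hence `λ_M = Cκ/γ` and the
minimizers are the equality cases. At such a `u` the nonnegative function `E^γ - κ ∫ |·|^{mγ}`
vanishes, and differentiating it along lines gives the equation (`euler_lagrange`).

Attainment is proved with strong convergence only. A minimizing sequence of normalised test
functions is Cauchy in `L^{mγ}` after passing to a subsequence (`exists_subseq_cauchy`). The
midpoints of its terms then have `L^{mγ}` norm close to one, so their energies cannot drop below the
infimum, and uniform convexity makes the sequence Cauchy in energy (`exists_minimizing_sequence`).

Completeness of `E` and the embedding both require `D_r` alone to control every derivative of order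
at most `r` (`exists_apriori`). For `r ≥ 2` this is a Calderón–Zygmund inequality: second
derivatives are bounded by the Laplacian in `L^p`, `1 < p < ∞`. It is obtained by a Bellman function
argument. Let `A` average over translates by `± v k` and let `δ` be a central difference. A function
`B` with both `B + xy` and `B - xy` convex loses at least a multiple of `∫ |δ f| |δ g|` when `A` is
applied to `(f, g)`. Telescoping over the powers of `A` gives `exists_bilinearSum_le`, with a
constant independent of the vectors `v`. As `A` is self-adjoint, `∫ δf δg` is the sum over `k` of `∫
δ(A^k (f - A² f)) δ(A^k g)`, so it is controlled by `f - A f` and `g`. Letting the step tend to zero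
turns `f - A f` into a multiple of the Laplacian and `δδf` into a second derivative. -/

/-! ### A Bellman function -/

/-- The domain of the Bellman function. -/
def bellmanDomain (s : ℝ) : Set (ℝ × ℝ) := {z | 0 ≤ z.1 ∧ 0 ≤ z.2 ∧ z.1 ≤ z.2 ^ s}

/-- The Bellman function. -/
def bellman (s : ℝ) (z : ℝ × ℝ) : ℝ := z.1 ^ 2 * z.2 ^ (1 - s) + 10 / s * z.2 ^ (1 + s)

lemma convex_bellmanDomain {s : ℝ} (hs : 0 < s) (hs1 : s ≤ 1) : Convex ℝ (bellmanDomain s) := by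
  rintro ⟨a, b⟩ ⟨ha, hb, hab⟩ ⟨c, d⟩ ⟨hc, hd, hcd⟩ x y hx hy hxy
  simp only at ha hb hab hc hd hcd
  refine ⟨?_, ?_, ?_⟩
  · simp only [Prod.smul_mk, Prod.mk_add_mk, smul_eq_mul]; positivity
  · simp only [Prod.smul_mk, Prod.mk_add_mk, smul_eq_mul]; positivity
  · simp only [Prod.smul_mk, Prod.mk_add_mk, smul_eq_mul]
    have := (Real.concaveOn_rpow hs.le hs1).2 (Set.mem_Ici.2 hb) (Set.mem_Ici.2 hd) hx hy hxy
    simp only [smul_eq_mul] at this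
    refine le_trans ?_ this
    gcongr

lemma bellman_nonneg {s : ℝ} (hs : 0 < s) {z : ℝ × ℝ} (hz : z ∈ bellmanDomain s) :
    0 ≤ bellman s z := by
  have := hz.2.1
  unfold bellman
  positivity

lemma bellman_le {s : ℝ} (hs : 0 < s) {z : ℝ × ℝ} (hz : z ∈ bellmanDomain s) :
    bellman s z ≤ (1 + 10 / s) * z.2 ^ (1 + s) := by
  obtain ⟨h1, h2, h3⟩ := hz
  have : z.1 ^ 2 * z.2 ^ (1 - s) ≤ z.2 ^ (1 + s) := by
    rcases h2.eq_or_lt with h | h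
    · rw [← h, Real.zero_rpow hs.ne'] at h3
      have : z.1 = 0 := le_antisymm h3 h1
      rw [this]; simp only [ne_eq, OfNat.ofNat_ne_zero, not_false_eq_true, zero_pow, zero_mul]
      positivity
    · calc z.1 ^ 2 * z.2 ^ (1 - s) ≤ (z.2 ^ s) ^ 2 * z.2 ^ (1 - s) := by gcongr
        _ = z.2 ^ (1 + s) := by
          rw [← Real.rpow_natCast, ← Real.rpow_mul h2, ← Real.rpow_add h]; congr 1; push_cast; ring
  unfold bellman; linarith

lemma hasDerivAt_bellman_line {s : ℝ} (σ a b c d t : ℝ) (hy : 0 < b + t * d) :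
    HasDerivAt (fun t => (a + t * c) ^ 2 * (b + t * d) ^ (1 - s) + 10 / s * (b + t * d) ^ (1 + s)
        + σ * (a + t * c) * (b + t * d))
      (2 * c * (a + t * c) * (b + t * d) ^ (1 - s)
        + (1 - s) * d * (a + t * c) ^ 2 * (b + t * d) ^ (-s)
        + 10 / s * (1 + s) * d * (b + t * d) ^ s + σ * c * (b + t * d) + σ * (a + t * c) * d) t := by
  have h1 : HasDerivAt (fun t : ℝ => a + t * c) c t := by
    simpa using ((hasDerivAt_id t).mul_const c).const_add a
  have h2 : HasDerivAt (fun t : ℝ => b + t * d) d t := by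
    simpa using ((hasDerivAt_id t).mul_const d).const_add b
  have h3 := h2.rpow_const (p := 1 - s) (Or.inl hy.ne')
  have h4 := h2.rpow_const (p := 1 + s) (Or.inl hy.ne')
  have := (((h1.pow 2).mul h3).add (h4.const_mul (10 / s))).add ((h1.const_mul σ).mul h2)
  refine HasDerivAt.congr_deriv this ?_
  rw [show 1 - s - 1 = -s by ring, show 1 + s - 1 = s by ring]
  simp only [Pi.pow_apply]
  push_cast
  ring

lemma hasDerivAt_bellman_line_deriv {s : ℝ} (σ a b c d t : ℝ) (hy : 0 < b + t * d) :
    HasDerivAt (fun t => 2 * c * (a + t * c) * (b + t * d) ^ (1 - s)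
        + (1 - s) * d * (a + t * c) ^ 2 * (b + t * d) ^ (-s)
        + 10 / s * (1 + s) * d * (b + t * d) ^ s + σ * c * (b + t * d) + σ * (a + t * c) * d)
      (2 * c ^ 2 * (b + t * d) ^ (1 - s) + 4 * (1 - s) * c * d * (a + t * c) * (b + t * d) ^ (-s)
        - s * (1 - s) * d ^ 2 * (a + t * c) ^ 2 * (b + t * d) ^ (-s - 1)
        + 10 / s * (1 + s) * s * d ^ 2 * (b + t * d) ^ (s - 1) + 2 * σ * c * d) t := by
  have h1 : HasDerivAt (fun t : ℝ => a + t * c) c t := by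
    simpa using ((hasDerivAt_id t).mul_const c).const_add a
  have h2 : HasDerivAt (fun t : ℝ => b + t * d) d t := by
    simpa using ((hasDerivAt_id t).mul_const d).const_add b
  have h3 := h2.rpow_const (p := 1 - s) (Or.inl hy.ne')
  have h4 := h2.rpow_const (p := -s) (Or.inl hy.ne')
  have h5 := h2.rpow_const (p := s) (Or.inl hy.ne')
  have := (((((h1.const_mul (2 * c)).mul h3).add
    (((h1.pow 2).const_mul ((1 - s) * d)).mul h4)).add (h5.const_mul (10 / s * (1 + s) * d))).add
      (h2.const_mul (σ * c))).add ((h1.const_mul σ).mul_const d)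
  refine HasDerivAt.congr_deriv this ?_
  rw [show 1 - s - 1 = -s by ring]
  simp only [Pi.pow_apply]
  push_cast
  ring

/-- With `X = c y^((1-s)/2)`, `Y = d y^(-(1-s)/2)` and `z = x y^(-s)`, which lies in `[0, 1]` on the
domain, all powers of `y` disappear. What remains is `2X² + 2BXY + DY²` with `|B| ≤ 3` and `D ≥ 9`,
so `B² ≤ 2D`. The coefficient `10 / s` is there to make `D` this large. -/
lemma bellman_hessian_nonneg {s : ℝ} (hs : 0 < s) (hs1 : s ≤ 1) {σ : ℝ} (hσ : |σ| ≤ 1)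
    {x y : ℝ} (c d : ℝ) (hx : 0 ≤ x) (hy : 0 < y) (hxy : x ≤ y ^ s) :
    0 ≤ 2 * c ^ 2 * y ^ (1 - s) + 4 * (1 - s) * c * d * x * y ^ (-s)
        - s * (1 - s) * d ^ 2 * x ^ 2 * y ^ (-s - 1)
        + 10 / s * (1 + s) * s * d ^ 2 * y ^ (s - 1) + 2 * σ * c * d := by
  set P := y ^ ((1 - s) / 2) with hP
  have hPp : 0 < P := Real.rpow_pos_of_pos hy _
  have e1 : y ^ (1 - s) = P ^ 2 := by
    rw [hP, ← Real.rpow_natCast, ← Real.rpow_mul hy.le]; congr 1; push_cast; ring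
  have e2 : y ^ (s - 1) = (P ^ 2)⁻¹ := by
    rw [← e1, ← Real.rpow_neg hy.le]; congr 1; ring
  set z := x * y ^ (-s) with hz
  have hz0 : 0 ≤ z := by positivity
  have hz1 : z ≤ 1 := by
    rw [hz, Real.rpow_neg hy.le, ← div_eq_mul_inv, div_le_one (Real.rpow_pos_of_pos hy _)]
    exact hxy
  have e3 : x ^ 2 * y ^ (-s - 1) = z ^ 2 * (P ^ 2)⁻¹ := by
    rw [← e2, hz, mul_pow, ← Real.rpow_natCast (y ^ (-s)), ← Real.rpow_mul hy.le, mul_assoc,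
      ← Real.rpow_add hy]
    congr 2; push_cast; ring
  have key : 2 * c ^ 2 * y ^ (1 - s) + 4 * (1 - s) * c * d * x * y ^ (-s)
        - s * (1 - s) * d ^ 2 * x ^ 2 * y ^ (-s - 1)
        + 10 / s * (1 + s) * s * d ^ 2 * y ^ (s - 1) + 2 * σ * c * d
      = 2 * (c * P) ^ 2 + 2 * (2 * (1 - s) * z + σ) * (c * P) * (d / P)
        + (10 * (1 + s) - s * (1 - s) * z ^ 2) * (d / P) ^ 2 := by
    have : s * (1 - s) * d ^ 2 * x ^ 2 * y ^ (-s - 1) = s * (1 - s) * d ^ 2 * (z ^ 2 * (P ^ 2)⁻¹) := by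
      rw [← e3]; ring
    rw [this, e1, e2, show 4 * (1 - s) * c * d * x * y ^ (-s) = 4 * (1 - s) * c * d * z by
      rw [hz]; ring]
    field_simp
    ring
  rw [key]
  set X := c * P
  set Y := d / P
  set B := 2 * (1 - s) * z + σ
  have hB : |B| ≤ 3 := by
    have h1 : 0 ≤ (1 - s) * z := mul_nonneg (by linarith) hz0
    have h2 : (1 - s) * z ≤ 1 := by nlinarith
    rw [abs_le] at hσ ⊢
    constructor <;> simp only [B] <;> linarith
  have hB2 : B ^ 2 ≤ 9 := by
    have := sq_le_sq' (neg_le_of_abs_le hB) (le_of_abs_le hB); linarith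
  have hC : 9 ≤ 10 * (1 + s) - s * (1 - s) * z ^ 2 := by
    have : z ^ 2 ≤ 1 := by nlinarith
    have h4 : s * (1 - s) ≤ 1 := by nlinarith
    have : s * (1 - s) * z ^ 2 ≤ 1 := by
      calc s * (1 - s) * z ^ 2 ≤ 1 * 1 := by gcongr
        _ = 1 := by norm_num
    linarith
  nlinarith [sq_nonneg (2 * X + B * Y), mul_le_mul_of_nonneg_right hB2 (sq_nonneg Y),
    mul_le_mul_of_nonneg_right hC (sq_nonneg Y), sq_nonneg Y]

/-- Convexity is tested on segments through the second derivative. The second coordinate is positive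
inside a segment unless both ends lie on `y = 0`, where the domain contains only the origin; at the
ends continuity suffices. -/
lemma convexOn_bellman_add {s : ℝ} (hs : 0 < s) (hs1 : s ≤ 1) {σ : ℝ} (hσ : |σ| ≤ 1) :
    ConvexOn ℝ (bellmanDomain s) (fun z => bellman s z + σ * z.1 * z.2) := by
  refine ⟨convex_bellmanDomain hs hs1, ?_⟩
  rintro ⟨a, b⟩ h1 ⟨a', b'⟩ h2 x y hx hy hxy
  by_cases hbb : b = 0 ∧ b' = 0
  · obtain ⟨rfl, rfl⟩ := hbb
    have e1 : a = 0 := le_antisymm (by simpa [Real.zero_rpow hs.ne'] using h1.2.2) h1.1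
    have e2 : a' = 0 := le_antisymm (by simpa [Real.zero_rpow hs.ne'] using h2.2.2) h2.1
    subst e1 e2
    simp [bellman, Real.zero_rpow (by positivity : 1 + s ≠ 0)]
  have hb : 0 ≤ b := h1.2.1
  have hb' : 0 ≤ b' := h2.2.1
  have hpos : ∀ t ∈ Set.Ioo (0 : ℝ) 1, 0 < b + t * (b' - b) := by
    intro t ht
    have : b + t * (b' - b) = (1 - t) * b + t * b' := by ring
    rw [this]
    rcases hb.eq_or_lt with h | h
    · have : 0 < b' := lt_of_le_of_ne hb' fun h' => hbb ⟨h.symm, h'.symm⟩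
      have := mul_pos ht.1 this
      have := mul_nonneg (by linarith [ht.2] : (0 : ℝ) ≤ 1 - t) hb
      linarith
    · have := mul_pos (by linarith [ht.2] : (0 : ℝ) < 1 - t) h
      have := mul_nonneg ht.1.le hb'
      linarith
  have hmem : ∀ t ∈ Set.Icc (0 : ℝ) 1, (a + t * (a' - a), b + t * (b' - b)) ∈ bellmanDomain s := by
    intro t ht
    have := convex_bellmanDomain hs hs1 h1 h2 (by linarith [ht.2] : (0 : ℝ) ≤ 1 - t) ht.1
      (by ring)
    convert this using 1
    ext <;> simp <;> ring
  have hconv := convexOn_of_hasDerivWithinAt2_nonneg (convex_Icc (0 : ℝ) 1)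
    (f := fun t => (a + t * (a' - a)) ^ 2 * (b + t * (b' - b)) ^ (1 - s)
        + 10 / s * (b + t * (b' - b)) ^ (1 + s) + σ * (a + t * (a' - a)) * (b + t * (b' - b)))
    (by
      refine Continuous.continuousOn ?_
      have hc : Continuous fun t : ℝ => b + t * (b' - b) := by fun_prop
      have := hc.rpow_const (p := 1 - s) (fun _ => Or.inr (by linarith))
      have := hc.rpow_const (p := 1 + s) (fun _ => Or.inr (by linarith))
      fun_prop)
    (fun t ht => (hasDerivAt_bellman_line σ a b (a' - a) (b' - b) t
      (hpos t (by simpa using ht))).hasDerivWithinAt)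
    (fun t ht => (hasDerivAt_bellman_line_deriv σ a b (a' - a) (b' - b) t
      (hpos t (by simpa using ht))).hasDerivWithinAt)
    (fun t ht => by
      have ht' : t ∈ Set.Ioo (0 : ℝ) 1 := by simpa using ht
      have hm := hmem t (Set.Ioo_subset_Icc_self ht')
      exact bellman_hessian_nonneg hs hs1 hσ _ _ hm.1 (hpos t ht') hm.2.2)
  have := hconv.2 (Set.left_mem_Icc.2 zero_le_one) (Set.right_mem_Icc.2 zero_le_one) hx hy hxy
  have hx' : x = 1 - y := by linarith
  subst hx'
  simp only [smul_eq_mul, mul_zero, mul_one, zero_add, zero_mul, add_zero, one_mul] at this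
  simp only [bellman, Prod.smul_mk, Prod.mk_add_mk, smul_eq_mul]
  rw [show (1 - y) * a + y * a' = a + y * (a' - a) by ring,
    show (1 - y) * b + y * b' = b + y * (b' - b) by ring]
  refine this.trans (le_of_eq ?_)
  rw [show a + (a' - a) = a' by ring, show b + (b' - b) = b' by ring]

lemma convexOn_bellman {s : ℝ} (hs : 0 < s) (hs1 : s ≤ 1) :
    ConvexOn ℝ (bellmanDomain s) (bellman s) := by
  simpa using convexOn_bellman_add hs hs1 (σ := 0) (by simp)

/-- The midpoint defect of `xy` is a quarter of the product of the increments. Convexity for `σ = 1`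
and for `σ = -1` bounds it from both sides by the defect of `bellman`. -/
lemma bellman_midpoint {s : ℝ} (hs : 0 < s) (hs1 : s ≤ 1) {a b : ℝ × ℝ}
    (ha : a ∈ bellmanDomain s) (hb : b ∈ bellmanDomain s) :
    bellman s ((2 : ℝ)⁻¹ • a + (2 : ℝ)⁻¹ • b) + |a.1 - b.1| * |a.2 - b.2| / 4 ≤
      (bellman s a + bellman s b) / 2 := by
  have h1 := (convexOn_bellman_add hs hs1 (σ := 1) (by simp)).2 ha hb
    (by norm_num : (0 : ℝ) ≤ 2⁻¹) (by norm_num : (0 : ℝ) ≤ 2⁻¹) (by norm_num)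
  have h2 := (convexOn_bellman_add hs hs1 (σ := -1) (by simp)).2 ha hb
    (by norm_num : (0 : ℝ) ≤ 2⁻¹) (by norm_num : (0 : ℝ) ≤ 2⁻¹) (by norm_num)
  simp only [Prod.fst_add, Prod.snd_add, Prod.smul_fst, Prod.smul_snd, smul_eq_mul] at h1 h2
  rw [← abs_mul]
  have : |(a.1 - b.1) * (a.2 - b.2)| ≤ 4 * ((bellman s a + bellman s b) / 2
      - bellman s ((2 : ℝ)⁻¹ • a + (2 : ℝ)⁻¹ • b)) := by
    rw [abs_le]; constructor <;> nlinarith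
  linarith

/-! ### Symmetric averages and central differences -/

/-- Continuous functions with compact support. -/
def IsCc {N : ℕ} (f : Space N → ℝ) : Prop := Continuous f ∧ HasCompactSupport f

/-- The average of `f` over the translates by `± v k`. -/
def avg {N : ℕ} {ι : Type*} [Fintype ι] (v : ι → Space N) (f : Space N → ℝ) (x : Space N) : ℝ :=
  ∑ k, (Fintype.card ι : ℝ)⁻¹ * (2⁻¹ * f (x + v k) + 2⁻¹ * f (x - v k))

/-- The central difference in direction `w`. -/
def centralDiff {N : ℕ} (w : Space N) (f : Space N → ℝ) (x : Space N) : ℝ := f (x + w) - f (x - w)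

section

variable {N : ℕ} {ι : Type*} [Fintype ι] {f g : Space N → ℝ}

lemma IsCc.integrable (hf : IsCc f) : Integrable f := hf.1.integrable_of_hasCompactSupport hf.2

lemma IsCc.add (hf : IsCc f) (hg : IsCc g) : IsCc (fun x => f x + g x) :=
  ⟨hf.1.add hg.1, hf.2.add hg.2⟩

lemma IsCc.sub (hf : IsCc f) (hg : IsCc g) : IsCc (fun x => f x - g x) :=
  ⟨hf.1.sub hg.1, hf.2.sub hg.2⟩

lemma IsCc.mul_left (hf : IsCc f) (hg : Continuous g) : IsCc (fun x => g x * f x) :=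
  ⟨hg.mul hf.1, hf.2.mul_left⟩

lemma IsCc.mul (hf : IsCc f) (hg : IsCc g) : IsCc (fun x => f x * g x) :=
  hg.mul_left hf.1

lemma IsCc.const_mul (hf : IsCc f) (c : ℝ) : IsCc (fun x => c * f x) :=
  hf.mul_left continuous_const

lemma IsCc.comp (hf : IsCc f) {F : ℝ → ℝ} (hF : Continuous F) (h0 : F 0 = 0) :
    IsCc (fun x => F (f x)) :=
  ⟨hF.comp hf.1, hf.2.comp_left h0⟩

lemma IsCc.abs (hf : IsCc f) : IsCc (fun x => |f x|) := hf.comp continuous_abs abs_zero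

lemma IsCc.abs_rpow (hf : IsCc f) {p : ℝ} (hp : 0 < p) : IsCc (fun x => |f x| ^ p) :=
  hf.abs.comp (F := fun t => t ^ p) (Real.continuous_rpow_const hp.le) (Real.zero_rpow hp.ne')

lemma IsCc.rpow (hf : IsCc f) {p : ℝ} (hp : 0 < p) : IsCc (fun x => f x ^ p) :=
  hf.comp (F := fun t => t ^ p) (Real.continuous_rpow_const hp.le) (Real.zero_rpow hp.ne')

lemma IsCc.comp_add_right (hf : IsCc f) (w : Space N) : IsCc (fun x => f (x + w)) :=
  ⟨hf.1.comp (continuous_add_const w), hf.2.comp_homeomorph (Homeomorph.addRight w)⟩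

lemma IsCc.comp_sub_right (hf : IsCc f) (w : Space N) : IsCc (fun x => f (x - w)) := by
  simpa only [sub_eq_add_neg] using hf.comp_add_right (-w)

lemma isCc_zero : IsCc (fun _ : Space N => (0 : ℝ)) :=
  ⟨continuous_const, HasCompactSupport.zero⟩

lemma IsCc.sum {κ : Type*} (s : Finset κ) {f : κ → Space N → ℝ} (hf : ∀ k ∈ s, IsCc (f k)) :
    IsCc (fun x => ∑ k ∈ s, f k x) := by
  classical
  induction s using Finset.induction_on with
  | empty => simpa using isCc_zero
  | insert a s ha ih =>
    simp only [Finset.sum_insert ha]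
    exact (hf a (by simp)).add (ih fun k hk => hf k (by simp [hk]))

lemma IsCc.avg (hf : IsCc f) (v : ι → Space N) : IsCc (avg v f) :=
  IsCc.sum _ fun k _ =>
    (((hf.comp_add_right (v k)).const_mul _).add ((hf.comp_sub_right (v k)).const_mul _)).const_mul _

lemma IsCc.centralDiff (hf : IsCc f) (w : Space N) : IsCc (centralDiff w f) :=
  (hf.comp_add_right w).sub (hf.comp_sub_right w)

lemma IsCc.iterate_avg (hf : IsCc f) (v : ι → Space N) (k : ℕ) :
    IsCc ((Kirchhoff.avg v)^[k] f) := by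
  induction k with
  | zero => exact hf
  | succ k ih => rw [Function.iterate_succ_apply']; exact ih.avg v

lemma integral_avg [Nonempty ι] (hf : IsCc f) (v : ι → Space N) : ∫ x, avg v f x = ∫ x, f x := by
  unfold avg
  rw [integral_finsetSum _ fun k _ => ((((hf.comp_add_right (v k)).const_mul _).add
    ((hf.comp_sub_right (v k)).const_mul _)).const_mul _).integrable]
  have : ∀ k, ∫ x, (Fintype.card ι : ℝ)⁻¹ * (2⁻¹ * f (x + v k) + 2⁻¹ * f (x - v k)) =
      (Fintype.card ι : ℝ)⁻¹ * ∫ x, f x := by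
    intro k
    rw [integral_const_mul, integral_add ((hf.comp_add_right (v k)).const_mul _).integrable
      ((hf.comp_sub_right (v k)).const_mul _).integrable, integral_const_mul, integral_const_mul,
      integral_add_right_eq_self f, integral_sub_right_eq_self f]
    ring
  simp only [this, Finset.sum_const, Finset.card_univ, nsmul_eq_mul]
  have : (Fintype.card ι : ℝ) ≠ 0 := by exact_mod_cast Fintype.card_ne_zero
  field_simp

lemma integral_comp_add_mul (w : Space N) :
    ∫ x, f (x + w) * g x = ∫ x, f x * g (x - w) := by
  rw [← integral_add_right_eq_self (fun x => f x * g (x - w)) w]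
  simp

lemma integral_comp_sub_mul (w : Space N) :
    ∫ x, f (x - w) * g x = ∫ x, f x * g (x + w) := by
  rw [← integral_sub_right_eq_self (fun x => f x * g (x + w)) w]
  simp

lemma integral_centralDiff_mul (hf : IsCc f) (hg : IsCc g) (w : Space N) :
    ∫ x, centralDiff w f x * g x = - ∫ x, f x * centralDiff w g x := by
  unfold centralDiff
  simp only [sub_mul, mul_sub]
  rw [integral_sub ((hf.comp_add_right w).mul hg).integrable ((hf.comp_sub_right w).mul hg).integrable,
    integral_sub (hf.mul (hg.comp_add_right w)).integrable (hf.mul (hg.comp_sub_right w)).integrable,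
    integral_comp_add_mul, integral_comp_sub_mul]
  ring

lemma integral_avg_mul (hf : IsCc f) (hg : IsCc g) (v : ι → Space N) :
    ∫ x, avg v f x * g x = ∫ x, f x * avg v g x := by
  unfold avg
  simp only [Finset.sum_mul, Finset.mul_sum]
  rw [integral_finsetSum _ fun k _ => (((((hf.comp_add_right (v k)).const_mul _).add
    ((hf.comp_sub_right (v k)).const_mul _)).const_mul _).mul hg).integrable,
    integral_finsetSum _ fun k _ => (hf.mul ((((hg.comp_add_right (v k)).const_mul _).add
    ((hg.comp_sub_right (v k)).const_mul _)).const_mul _)).integrable]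
  refine Finset.sum_congr rfl fun k _ => ?_
  have e1 : ∀ x, (Fintype.card ι : ℝ)⁻¹ * (2⁻¹ * f (x + v k) + 2⁻¹ * f (x - v k)) * g x =
    (Fintype.card ι : ℝ)⁻¹ * 2⁻¹ * (f (x + v k) * g x + f (x - v k) * g x) := fun x => by ring
  have e2 : ∀ x, f x * ((Fintype.card ι : ℝ)⁻¹ * (2⁻¹ * g (x + v k) + 2⁻¹ * g (x - v k))) =
    (Fintype.card ι : ℝ)⁻¹ * 2⁻¹ * (f x * g (x + v k) + f x * g (x - v k)) := fun x => by ring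
  simp only [e1, e2]
  rw [integral_const_mul, integral_const_mul,
    integral_add ((hf.comp_add_right _).mul hg).integrable ((hf.comp_sub_right _).mul hg).integrable,
    integral_add (hf.mul (hg.comp_add_right _)).integrable (hf.mul (hg.comp_sub_right _)).integrable,
    integral_comp_add_mul, integral_comp_sub_mul]
  ring

lemma avg_sub (v : ι → Space N) (f g : Space N → ℝ) : avg v (f - g) = avg v f - avg v g := by
  ext x
  simp only [avg, Pi.sub_apply, ← Finset.sum_sub_distrib]
  exact Finset.sum_congr rfl fun k _ => by ring

lemma iterate_avg_sub (v : ι → Space N) (f g : Space N → ℝ) (k : ℕ) :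
    (avg v)^[k] (f - g) = (avg v)^[k] f - (avg v)^[k] g := by
  induction k with
  | zero => rfl
  | succ k ih => simp only [Function.iterate_succ_apply', ih, avg_sub]

lemma centralDiff_sub (w : Space N) (f g : Space N → ℝ) :
    centralDiff w (f - g) = centralDiff w f - centralDiff w g := by
  ext x; simp only [centralDiff, Pi.sub_apply]; ring

lemma centralDiff_avg (v : ι → Space N) (w : Space N) (f : Space N → ℝ) :
    centralDiff w (avg v f) = avg v (centralDiff w f) := by
  ext x
  simp only [centralDiff, avg, ← Finset.sum_sub_distrib]
  refine Finset.sum_congr rfl fun k _ => ?_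
  rw [show x + v k + w = x + w + v k by abel, show x + v k - w = x - w + v k by abel,
    show x - v k + w = x + w - v k by abel, show x - v k - w = x - w - v k by abel]
  ring

/-! ### The bilinear estimate -/

lemma real_add_rpow_le {a b p : ℝ} (ha : 0 ≤ a) (hb : 0 ≤ b) (hp : 1 ≤ p) :
    (a + b) ^ p ≤ 2 ^ (p - 1) * (a ^ p + b ^ p) := by
  exact_mod_cast NNReal.rpow_add_le_mul_rpow_add_rpow ⟨a, ha⟩ ⟨b, hb⟩ hp

/-- Jensen's inequality handles the average over `k`, and `bellman_midpoint` handles each symmetric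
pair, which is where the gain comes from. -/
lemma avg_pair_mem_bellmanDomain [Nonempty ι] {s : ℝ} (hs : 0 < s) (hs1 : s ≤ 1)
    (h : ∀ x, (f x, g x) ∈ bellmanDomain s) (v : ι → Space N) (x : Space N) :
    (avg v f x, avg v g x) ∈ bellmanDomain s ∧
    bellman s (avg v f x, avg v g x) +
      ∑ k, (Fintype.card ι : ℝ)⁻¹ * (|centralDiff (v k) f x| * |centralDiff (v k) g x| / 4) ≤
      avg v (fun x => bellman s (f x, g x)) x := by
  set P : ι → ℝ × ℝ := fun k =>
    (2 : ℝ)⁻¹ • (f (x + v k), g (x + v k)) + (2 : ℝ)⁻¹ • (f (x - v k), g (x - v k)) with hP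
  have hPD : ∀ k ∈ (Finset.univ : Finset ι), P k ∈ bellmanDomain s := fun k _ =>
    convex_bellmanDomain hs hs1 (h _) (h _) (by norm_num) (by norm_num) (by norm_num)
  have hc : (Fintype.card ι : ℝ) ≠ 0 := by exact_mod_cast Fintype.card_ne_zero
  have hw : ∑ _k : ι, (Fintype.card ι : ℝ)⁻¹ = 1 := by simp [hc]
  have hw0 : ∀ k ∈ (Finset.univ : Finset ι), 0 ≤ (Fintype.card ι : ℝ)⁻¹ := fun _ _ => by positivity
  have heq : (avg v f x, avg v g x) = ∑ k, (Fintype.card ι : ℝ)⁻¹ • P k := by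
    ext
    · simp [avg, hP, Prod.fst_sum]
    · simp [avg, hP, Prod.snd_sum]
  rw [heq]
  refine ⟨(convex_bellmanDomain hs hs1).sum_mem hw0 hw hPD, ?_⟩
  have h1 := (convexOn_bellman hs hs1).map_sum_le hw0 hw hPD
  refine (add_le_add_left h1 _).trans ?_
  rw [← Finset.sum_add_distrib]
  refine Finset.sum_le_sum fun k _ => ?_
  have h2 := bellman_midpoint hs hs1 (h (x + v k)) (h (x - v k))
  rw [smul_eq_mul, ← mul_add]
  refine mul_le_mul_of_nonneg_left ?_ (by positivity)
  simp only [centralDiff]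
  refine h2.trans (le_of_eq ?_)
  ring

lemma isCc_bellman {s : ℝ} (hs : 0 < s) (hs1 : s ≤ 1) (hf : IsCc f) (hg : IsCc g) :
    IsCc (fun x => bellman s (f x, g x)) := by
  unfold bellman
  have h1 : Continuous fun x => g x ^ (1 - s) := hg.1.rpow_const fun _ => Or.inr (by linarith)
  have h2 := ((hf.mul hf).mul_left h1).add ((hg.rpow (p := 1 + s) (by linarith)).const_mul (10 / s))
  convert h2 using 3
  ring

/-- Averaging preserves integrals, so the pointwise gain integrates to a decrease of `∫ B`. The
factor `4 * card ι` undoes the weight `1 / card ι` and the quarter from the midpoint inequality, as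
only one direction is kept. -/
lemma integral_centralDiff_le_bellman [Nonempty ι] {s : ℝ} (hs : 0 < s) (hs1 : s ≤ 1)
    (hf : IsCc f) (hg : IsCc g)
    (h : ∀ x, (f x, g x) ∈ bellmanDomain s) (v : ι → Space N) (j : ι) :
    ∫ x, |centralDiff (v j) f x| * |centralDiff (v j) g x| ≤ 4 * Fintype.card ι *
      ((∫ x, bellman s (f x, g x)) - ∫ x, bellman s (avg v f x, avg v g x)) := by
  have hB := isCc_bellman hs hs1 hf hg
  have hB' := isCc_bellman hs hs1 (hf.avg v) (hg.avg v)
  rw [← integral_avg hB v, ← integral_sub (hB.avg v).integrable hB'.integrable,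
    ← integral_const_mul]
  refine integral_mono ((hf.centralDiff _).abs.mul (hg.centralDiff _).abs).integrable
    (((hB.avg v).sub hB').const_mul _).integrable fun x => ?_
  have h1 := (avg_pair_mem_bellmanDomain hs hs1 h v x).2
  have h2 : (Fintype.card ι : ℝ)⁻¹ * (|centralDiff (v j) f x| * |centralDiff (v j) g x| / 4) ≤
    ∑ k, (Fintype.card ι : ℝ)⁻¹ * (|centralDiff (v k) f x| * |centralDiff (v k) g x| / 4) :=
    Finset.single_le_sum (f := fun k => (Fintype.card ι : ℝ)⁻¹ *
      (|centralDiff (v k) f x| * |centralDiff (v k) g x| / 4))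
      (fun k _ => by positivity) (Finset.mem_univ j)
  have hc : (0 : ℝ) < Fintype.card ι := by exact_mod_cast Fintype.card_pos
  have h3 := h2.trans (le_sub_iff_add_le'.2 h1)
  rw [inv_mul_le_iff₀ hc] at h3
  simp only
  linarith

/-- The pair stays in the convex domain under iteration, so the decreases of `∫ B` telescope. `B ≥
0` discards the last term and `bellman_le` bounds the first. -/
lemma sum_integral_centralDiff_le_of_mem [Nonempty ι] {s : ℝ} (hs : 0 < s) (hs1 : s ≤ 1)
    (hf : IsCc f) (hg : IsCc g)
    (h : ∀ x, (f x, g x) ∈ bellmanDomain s) (v : ι → Space N) (j : ι) (K : ℕ) :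
    ∑ k ∈ Finset.range K, ∫ x, |centralDiff (v j) ((avg v)^[k] f) x| *
      |centralDiff (v j) ((avg v)^[k] g) x| ≤
      4 * Fintype.card ι * (1 + 10 / s) * ∫ x, g x ^ (1 + s) := by
  have hmem : ∀ k x, ((avg v)^[k] f x, (avg v)^[k] g x) ∈ bellmanDomain s := by
    intro k
    induction k with
    | zero => exact h
    | succ k ih =>
      intro x
      simp only [Function.iterate_succ_apply']
      exact (avg_pair_mem_bellmanDomain hs hs1 ih v x).1
  set b : ℕ → ℝ := fun k => ∫ x, bellman s ((avg v)^[k] f x, (avg v)^[k] g x) with hb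
  have hb0 : ∀ k, 0 ≤ b k := fun k => integral_nonneg fun x => bellman_nonneg hs (hmem k x)
  have h1 : ∑ k ∈ Finset.range K, ∫ x, |centralDiff (v j) ((avg v)^[k] f) x| *
      |centralDiff (v j) ((avg v)^[k] g) x| ≤
      ∑ k ∈ Finset.range K, 4 * Fintype.card ι * (b k - b (k + 1)) := by
    refine Finset.sum_le_sum fun k _ => ?_
    have := integral_centralDiff_le_bellman hs hs1 (hf.iterate_avg v k) (hg.iterate_avg v k)
      (hmem k) v j
    simpa only [hb, Function.iterate_succ_apply'] using this
  rw [← Finset.mul_sum, Finset.sum_range_sub'] at h1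
  have h2 : b 0 ≤ (1 + 10 / s) * ∫ x, g x ^ (1 + s) := by
    rw [← integral_const_mul]
    exact integral_mono (isCc_bellman hs hs1 hf hg).integrable
      ((hg.rpow (by linarith)).const_mul _).integrable fun x => bellman_le hs (h x)
  refine h1.trans ?_
  rw [mul_assoc (4 * (Fintype.card ι : ℝ))]
  refine mul_le_mul_of_nonneg_left ?_ (by positivity)
  linarith [hb0 K]

lemma integral_abs_mul_abs_le_add {a b c d : Space N → ℝ} (ha : IsCc a) (hb : IsCc b)
    (hc : IsCc c) (hd : IsCc d) (h : ∀ x, |d x| ≤ |b x| + |c x|) :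
    ∫ x, |a x| * |d x| ≤ (∫ x, |a x| * |b x|) + ∫ x, |a x| * |c x| := by
  rw [← integral_add (ha.abs.mul hb.abs).integrable (ha.abs.mul hc.abs).integrable]
  refine integral_mono (ha.abs.mul hd.abs).integrable
    ((ha.abs.mul hb.abs).add (ha.abs.mul hc.abs)).integrable fun x => ?_
  have := mul_le_mul_of_nonneg_left (h x) (abs_nonneg (a x))
  simp only
  linarith

/-- The sum in the bilinear estimate. -/
def bilinearSum (v : ι → Space N) (j : ι) (K : ℕ) (f g : Space N → ℝ) : ℝ :=
  ∑ k ∈ Finset.range K, ∫ x, |centralDiff (v j) ((avg v)^[k] f) x| *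
      |centralDiff (v j) ((avg v)^[k] g) x|

lemma bilinearSum_comm (v : ι → Space N) (j : ι) (K : ℕ) (f g : Space N → ℝ) :
    bilinearSum v j K f g = bilinearSum v j K g f := by
  simp only [bilinearSum, mul_comm]

lemma bilinearSum_sub_le (hf : IsCc f) (hg : IsCc g) {h : Space N → ℝ} (hh : IsCc h)
    (v : ι → Space N) (j : ι) (K : ℕ) :
    bilinearSum v j K f (g - h) ≤ bilinearSum v j K f g + bilinearSum v j K f h := by
  unfold bilinearSum
  rw [← Finset.sum_add_distrib]
  refine Finset.sum_le_sum fun k _ => ?_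
  have hgh : IsCc (g - h) := hg.sub hh
  refine integral_abs_mul_abs_le_add ((hf.iterate_avg v k).centralDiff _)
    ((hg.iterate_avg v k).centralDiff _) ((hh.iterate_avg v k).centralDiff _)
    ((hgh.iterate_avg v k).centralDiff _) fun x => ?_
  rw [iterate_avg_sub, centralDiff_sub]
  exact abs_sub _ _

/-- The constraint `f ≤ g^s` is removed by writing `g = (g + w) - w` with `w = f^(1/s)`: both `(f, g
+ w)` and `(f, w)` satisfy it, and `w^(1+s) = f^(1+1/s)` brings in the conjugate exponent. -/
lemma bilinearSum_le_of_nonneg [Nonempty ι] {s : ℝ} (hs : 0 < s) (hs1 : s ≤ 1)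
    (hf : IsCc f) (hg : IsCc g) (hf0 : ∀ x, 0 ≤ f x) (hg0 : ∀ x, 0 ≤ g x)
    (v : ι → Space N) (j : ι) (K : ℕ) :
    bilinearSum v j K f g ≤ 4 * Fintype.card ι * (1 + 10 / s) * (2 ^ s + 1) *
      ((∫ x, f x ^ (1 + s⁻¹)) + ∫ x, g x ^ (1 + s)) := by
  set w : Space N → ℝ := fun x => f x ^ s⁻¹ with hw
  have hwc : IsCc w := hf.rpow (by positivity)
  have hw0 : ∀ x, 0 ≤ w x := fun x => Real.rpow_nonneg (hf0 x) _
  have hws : ∀ x, w x ^ s = f x := fun x => by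
    rw [hw]; simp only; rw [← Real.rpow_mul (hf0 x), inv_mul_cancel₀ hs.ne', Real.rpow_one]
  have hwp : ∀ x, w x ^ (1 + s) = f x ^ (1 + s⁻¹) := fun x => by
    rw [hw]; simp only; rw [← Real.rpow_mul (hf0 x)]; congr 1; field_simp; ring
  have hgw : IsCc (g + w) := hg.add hwc
  have h1 := bilinearSum_sub_le hf hgw hwc v j K
  rw [add_sub_cancel_right] at h1
  have h2 := sum_integral_centralDiff_le_of_mem hs hs1 hf hgw (fun x => ⟨hf0 x,
    add_nonneg (hg0 x) (hw0 x), (hws x).symm.le.trans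
      (Real.rpow_le_rpow (hw0 x) (le_add_of_nonneg_left (hg0 x)) hs.le)⟩) v j K
  have h3 := sum_integral_centralDiff_le_of_mem hs hs1 hf hwc (fun x => ⟨hf0 x,
    hw0 x, (hws x).symm.le⟩) v j K
  have h4 : ∫ x, (g + w) x ^ (1 + s) ≤
      2 ^ s * ((∫ x, f x ^ (1 + s⁻¹)) + ∫ x, g x ^ (1 + s)) := by
    have i1 := (hf.rpow (p := 1 + s⁻¹) (by positivity)).integrable
    have i2 := (hg.rpow (p := 1 + s) (by positivity)).integrable
    rw [← integral_add i1 i2, ← integral_const_mul]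
    refine integral_mono (hgw.rpow (by positivity)).integrable ((i1.add i2).const_mul _) fun x => ?_
    have := real_add_rpow_le (hg0 x) (hw0 x) (by linarith : 1 ≤ 1 + s)
    simp only [Pi.add_apply]
    rw [hwp, show 1 + s - 1 = s by ring] at this
    linarith
  have h5 : ∫ x, w x ^ (1 + s) ≤ (∫ x, f x ^ (1 + s⁻¹)) + ∫ x, g x ^ (1 + s) := by
    simp only [hwp]
    have : 0 ≤ ∫ x, g x ^ (1 + s) := integral_nonneg fun x => Real.rpow_nonneg (hg0 x) _
    linarith
  have hA : 0 ≤ 4 * Fintype.card ι * (1 + 10 / s) := by positivity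
  have h6 := mul_le_mul_of_nonneg_left h4 hA
  have h7 := mul_le_mul_of_nonneg_left h5 hA
  unfold bilinearSum at h1 ⊢
  linarith

/-- Both functions are split into positive and negative parts; the factor 4 counts the resulting
pairs. -/
lemma bilinearSum_le_aux [Nonempty ι] {s : ℝ} (hs : 0 < s) (hs1 : s ≤ 1)
    (hf : IsCc f) (hg : IsCc g) (v : ι → Space N) (j : ι) (K : ℕ) :
    bilinearSum v j K f g ≤ 4 * (4 * Fintype.card ι * (1 + 10 / s) * (2 ^ s + 1)) *
      ((∫ x, |f x| ^ (1 + s⁻¹)) + ∫ x, |g x| ^ (1 + s)) := by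
  set C := 4 * Fintype.card ι * (1 + 10 / s) * (2 ^ s + 1) with hC
  have hC0 : 0 ≤ C := by positivity
  have hpos : ∀ {f : Space N → ℝ}, IsCc f → IsCc (fun x => max (f x) 0) := fun hf =>
    hf.comp (F := fun t => max t 0) (by fun_prop) (by simp)
  have hneg : ∀ {f : Space N → ℝ}, IsCc f → IsCc (fun x => max (-f x) 0) := fun hf =>
    hf.comp (F := fun t => max (-t) 0) (by fun_prop) (by simp)
  have hdec : ∀ f : Space N → ℝ, f = (fun x => max (f x) 0) - (fun x => max (-f x) 0) := by
    intro f; ext x; simp only [Pi.sub_apply]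
    rcases le_total 0 (f x) with h | h
    · rw [max_eq_left h, max_eq_right (by linarith)]; ring
    · rw [max_eq_right h, max_eq_left (by linarith)]; ring
  have key : ∀ {f' g' : Space N → ℝ}, IsCc f' → IsCc g' → (∀ x, 0 ≤ f' x) → (∀ x, 0 ≤ g' x) →
      (∀ x, f' x ≤ |f x|) → (∀ x, g' x ≤ |g x|) → bilinearSum v j K f' g' ≤
      C * ((∫ x, |f x| ^ (1 + s⁻¹)) + ∫ x, |g x| ^ (1 + s)) := by
    intro f' g' hf' hg' hf0 hg0 hff hgg
    refine (bilinearSum_le_of_nonneg hs hs1 hf' hg' hf0 hg0 v j K).trans ?_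
    refine mul_le_mul_of_nonneg_left (add_le_add ?_ ?_) hC0
    · exact integral_mono (hf'.rpow (by positivity)).integrable (hf.abs_rpow (by positivity)).integrable
        fun x => Real.rpow_le_rpow (hf0 x) (hff x) (by positivity)
    · exact integral_mono (hg'.rpow (by positivity)).integrable (hg.abs_rpow (by positivity)).integrable
        fun x => Real.rpow_le_rpow (hg0 x) (hgg x) (by positivity)
  have m1 : ∀ t : ℝ, max t 0 ≤ |t| := fun t => max_le (le_abs_self t) (abs_nonneg t)
  have m2 : ∀ t : ℝ, max (-t) 0 ≤ |t| := fun t => max_le (neg_le_abs t) (abs_nonneg t)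
  have k1 := key (hpos hf) (hpos hg) (fun _ => le_max_right _ _) (fun _ => le_max_right _ _)
    (fun _ => m1 _) (fun _ => m1 _)
  have k2 := key (hpos hf) (hneg hg) (fun _ => le_max_right _ _) (fun _ => le_max_right _ _)
    (fun _ => m1 _) (fun _ => m2 _)
  have k3 := key (hneg hf) (hpos hg) (fun _ => le_max_right _ _) (fun _ => le_max_right _ _)
    (fun _ => m2 _) (fun _ => m1 _)
  have k4 := key (hneg hf) (hneg hg) (fun _ => le_max_right _ _) (fun _ => le_max_right _ _)
    (fun _ => m2 _) (fun _ => m2 _)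
  have t1 := bilinearSum_sub_le hf (hpos hg) (hneg hg) v j K
  rw [← hdec g] at t1
  have t2 := bilinearSum_sub_le (hpos hg) (hpos hf) (hneg hf) v j K
  rw [← hdec f, bilinearSum_comm, bilinearSum_comm v j K _ (fun x => max (f x) 0),
    bilinearSum_comm v j K _ (fun x => max (-f x) 0)] at t2
  have t3 := bilinearSum_sub_le (hneg hg) (hpos hf) (hneg hf) v j K
  rw [← hdec f, bilinearSum_comm, bilinearSum_comm v j K _ (fun x => max (f x) 0),
    bilinearSum_comm v j K _ (fun x => max (-f x) 0)] at t3
  linarith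

/-- The bilinear estimate; the constant is independent of the translation vectors. -/
theorem exists_bilinearSum_le (N : ℕ) (ι : Type*) [Fintype ι] [Nonempty ι] {p q : ℝ}
    (hpq : p.HolderConjugate q) : ∃ C : ℝ, 0 < C ∧ ∀ (v : ι → Space N) (j : ι) (K : ℕ)
      (f g : Space N → ℝ), IsCc f → IsCc g →
      bilinearSum v j K f g ≤ C * ((∫ x, |f x| ^ p) + ∫ x, |g x| ^ q) := by
  -- The Bellman function needs `s = q - 1 ≤ 1`, that is `p ≥ 2`. Otherwise `q ≥ 2` and the roles of
  -- `f` and `g` are exchanged.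
  have main : ∀ {p q : ℝ}, p.HolderConjugate q → 2 ≤ p → ∃ C : ℝ, 0 < C ∧
      ∀ (v : ι → Space N) (j : ι) (K : ℕ)
      (f g : Space N → ℝ), IsCc f → IsCc g →
      bilinearSum v j K f g ≤ C * ((∫ x, |f x| ^ p) + ∫ x, |g x| ^ q) := by
    intro p q hpq hp
    have hq := hpq.symm.lt
    have hs : 0 < q - 1 := by linarith
    have hprod : (p - 1) * (q - 1) = 1 := by nlinarith [hpq.mul_eq_add]
    have hinv : (q - 1)⁻¹ = p - 1 := by
      rw [inv_eq_one_div, div_eq_iff hs.ne']; linarith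
    have hs1 : q - 1 ≤ 1 := by nlinarith
    refine ⟨4 * (4 * Fintype.card ι * (1 + 10 / (q - 1)) * (2 ^ (q - 1) + 1)), ?_,
      fun v j K f g hf hg => (bilinearSum_le_aux hs hs1 hf hg v j K).trans (le_of_eq ?_)⟩
    · have : (0 : ℝ) < Fintype.card ι := by exact_mod_cast Fintype.card_pos
      positivity
    · rw [hinv, add_sub_cancel, add_sub_cancel]
  rcases le_total 2 p with h | h
  · exact main hpq h
  · have hq : 2 ≤ q := by
      have := hpq.mul_eq_add
      have := hpq.lt
      nlinarith
    obtain ⟨C, hC, H⟩ := main hpq.symm hq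
    refine ⟨C, hC, fun v j K f g hf hg => ?_⟩
    rw [bilinearSum_comm, add_comm]
    exact H v j K g f hg hf

end

/-! ### A Calderón–Zygmund inequality -/

section

variable {N : ℕ} {ι : Type*} [Fintype ι] {f g : Space N → ℝ}

/-- `avg v` is self-adjoint and commutes with `centralDiff w`, so one averaging can be moved from
the second factor to the first, where it produces `avg v (avg v f)`. -/
lemma integral_centralDiff_telescope (hf : IsCc f) (hg : IsCc g) (v : ι → Space N)
    (w : Space N) (k : ℕ) :
    (∫ x, centralDiff w ((avg v)^[k] f) x * centralDiff w ((avg v)^[k] g) x) -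
      ∫ x, centralDiff w ((avg v)^[k + 1] f) x * centralDiff w ((avg v)^[k + 1] g) x =
    ∫ x, centralDiff w ((avg v)^[k] (f - avg v (avg v f))) x *
      centralDiff w ((avg v)^[k] g) x := by
  have hfk := (hf.iterate_avg v k).centralDiff w
  have hgk := (hg.iterate_avg v k).centralDiff w
  have e : ∀ f : Space N → ℝ, centralDiff w ((avg v)^[k + 1] f) =
      avg v (centralDiff w ((avg v)^[k] f)) := fun f => by
    rw [Function.iterate_succ_apply', centralDiff_avg]
  rw [e f, e g, ← integral_avg_mul (hfk.avg v) hgk,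
    ← integral_sub (hfk.mul hgk).integrable (((hfk.avg v).avg v).mul hgk).integrable]
  congr 1
  ext x
  rw [iterate_avg_sub, centralDiff_sub, ← Function.iterate_succ_apply (avg v),
    ← Function.iterate_succ_apply (avg v), Function.iterate_succ_apply' (avg v),
    Function.iterate_succ_apply' (avg v), centralDiff_avg, centralDiff_avg]
  simp only [Pi.sub_apply]
  ring

/-- The case `p = q = 2` of the bilinear estimate bounds the partial sums of a series of nonnegative
terms, so its terms tend to zero. This disposes of the remainder in the telescoping sum. -/
lemma bilinearSum_tendsto_zero [Nonempty ι] (hf : IsCc f) (hg : IsCc g) (v : ι → Space N) (j : ι) :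
    Tendsto (fun k => ∫ x, |centralDiff (v j) ((avg v)^[k] f) x| *
      |centralDiff (v j) ((avg v)^[k] g) x|) atTop (𝓝 0) := by
  obtain ⟨C, -, hC⟩ := exists_bilinearSum_le N ι (Real.HolderConjugate.two_two)
  refine (summable_of_sum_range_le (c := C * ((∫ x, |f x| ^ (2 : ℝ)) + ∫ x, |g x| ^ (2 : ℝ)))
    (fun k => integral_nonneg fun x => by positivity) fun K => ?_).tendsto_atTop_zero
  exact hC v j K f g hf hg

lemma abs_integral_le_integral_abs_mul_abs (f g : Space N → ℝ) :
    |∫ x, f x * g x| ≤ ∫ x, |f x| * |g x| := by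
  simpa only [abs_mul] using abs_integral_le_integral_abs (f := fun x => f x * g x)

/-- The telescoping identity replaces `f` by `f - avg v (avg v f)` at the price of a sum over `k`,
which is exactly a `bilinearSum`. -/
lemma abs_integral_centralDiff_le [Nonempty ι] {p q : ℝ} {C : ℝ}
    (hC : ∀ (v : ι → Space N) (j : ι) (K : ℕ) (f g : Space N → ℝ), IsCc f → IsCc g →
      bilinearSum v j K f g ≤ C * ((∫ x, |f x| ^ p) + ∫ x, |g x| ^ q))
    (hf : IsCc f) (hg : IsCc g) (v : ι → Space N) (j : ι) :
    |∫ x, centralDiff (v j) f x * centralDiff (v j) g x| ≤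
      C * ((∫ x, |(f - avg v (avg v f)) x| ^ p) + ∫ x, |g x| ^ q) := by
  set F := f - avg v (avg v f) with hF
  have hFc : IsCc F := hf.sub ((hf.avg v).avg v)
  set a : ℕ → ℝ := fun k =>
    ∫ x, centralDiff (v j) ((avg v)^[k] f) x * centralDiff (v j) ((avg v)^[k] g) x with ha
  have h1 : ∀ K, |a 0| ≤ C * ((∫ x, |F x| ^ p) + ∫ x, |g x| ^ q) + |a K| := by
    intro K
    have h2 : a 0 - a K = ∑ k ∈ Finset.range K, (a k - a (k + 1)) :=
      (Finset.sum_range_sub' a K).symm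
    have h3 : |a 0 - a K| ≤ bilinearSum v j K F g := by
      rw [h2]
      refine (Finset.abs_sum_le_sum_abs _ _).trans (Finset.sum_le_sum fun k _ => ?_)
      rw [ha]; simp only
      rw [integral_centralDiff_telescope hf hg v (v j) k]
      exact abs_integral_le_integral_abs_mul_abs _ _
    have h4 := hC v j K F g hFc hg
    have h5 := abs_add_le (a 0 - a K) (a K)
    rw [sub_add_cancel] at h5
    linarith
  have h6 : Tendsto (fun K => |a K|) atTop (𝓝 0) :=
    squeeze_zero (fun K => abs_nonneg _)
      (fun K => abs_integral_le_integral_abs_mul_abs _ _) (bilinearSum_tendsto_zero hf hg v j)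
  have h7 := h6.const_add (C * ((∫ x, |F x| ^ p) + ∫ x, |g x| ^ q))
  rw [add_zero] at h7
  exact ge_of_tendsto' h7 h1

lemma abs_avg_rpow_le [Nonempty ι] {p : ℝ} (hp : 1 ≤ p) (v : ι → Space N) (f : Space N → ℝ)
    (x : Space N) : |avg v f x| ^ p ≤ avg v (fun x => |f x| ^ p) x := by
  have hc : (Fintype.card ι : ℝ) ≠ 0 := by exact_mod_cast Fintype.card_ne_zero
  have hw : ∑ _k : ι, (Fintype.card ι : ℝ)⁻¹ = 1 := by simp [hc]
  have hconv := convexOn_rpow hp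
  have h0 : |avg v f x| ≤ ∑ k, (Fintype.card ι : ℝ)⁻¹ • (2⁻¹ * |f (x + v k)| + 2⁻¹ * |f (x - v k)|) := by
    refine (Finset.abs_sum_le_sum_abs _ _).trans (Finset.sum_le_sum fun k _ => ?_)
    rw [abs_mul, abs_of_nonneg (by positivity : 0 ≤ (Fintype.card ι : ℝ)⁻¹), smul_eq_mul]
    refine mul_le_mul_of_nonneg_left ((abs_add_le _ _).trans (le_of_eq ?_)) (by positivity)
    simp [abs_mul]
  refine (Real.rpow_le_rpow (abs_nonneg _) h0 (by linarith)).trans ?_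
  refine (hconv.map_sum_le (fun _ _ => by positivity) hw
    (fun k _ => Set.mem_Ici.2 (by positivity))).trans ?_
  refine Finset.sum_le_sum fun k _ => mul_le_mul_of_nonneg_left ?_ (by positivity)
  exact hconv.2 (Set.mem_Ici.2 (abs_nonneg (f (x + v k)))) (Set.mem_Ici.2 (abs_nonneg (f (x - v k))))
    (by norm_num : (0 : ℝ) ≤ 2⁻¹) (by norm_num : (0 : ℝ) ≤ 2⁻¹) (by norm_num)

/-- With `A = avg v` and `G = f - A f` one has `f - A² f = G + A G`, and `A` is a contraction for
the `p`-th power integral by convexity. -/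
lemma integral_abs_sub_avg_avg_le [Nonempty ι] {p : ℝ} (hp : 1 ≤ p) (hf : IsCc f)
    (v : ι → Space N) :
    ∫ x, |(f - avg v (avg v f)) x| ^ p ≤ 2 ^ p * ∫ x, |(f - avg v f) x| ^ p := by
  set G := f - avg v f with hG
  have hGc : IsCc G := hf.sub (hf.avg v)
  have e : f - avg v (avg v f) = G + avg v G := by rw [hG, avg_sub]; abel
  have hp0 : 0 < p := by linarith
  have h1 : ∫ x, |avg v G x| ^ p ≤ ∫ x, |G x| ^ p := by
    rw [← integral_avg (hGc.abs_rpow hp0) v]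
    exact integral_mono ((hGc.avg v).abs_rpow hp0).integrable ((hGc.abs_rpow hp0).avg v).integrable
      fun x => abs_avg_rpow_le hp v G x
  have h2 : ∫ x, |(G + avg v G) x| ^ p ≤
      2 ^ (p - 1) * ((∫ x, |G x| ^ p) + ∫ x, |avg v G x| ^ p) := by
    rw [← integral_add (hGc.abs_rpow hp0).integrable ((hGc.avg v).abs_rpow hp0).integrable,
      ← integral_const_mul]
    refine integral_mono (IsCc.abs_rpow (hGc.add (hGc.avg v)) hp0).integrable
      (((hGc.abs_rpow hp0).add ((hGc.avg v).abs_rpow hp0)).const_mul _).integrable fun x => ?_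
    refine (Real.rpow_le_rpow (abs_nonneg _) (abs_add_le _ _) hp0.le).trans ?_
    exact real_add_rpow_le (abs_nonneg _) (abs_nonneg _) hp
  rw [e]
  refine h2.trans ?_
  rw [show (2 : ℝ) ^ p = 2 ^ (p - 1) * 2 by
    rw [← Real.rpow_add_one (by norm_num)]; congr 1; ring, mul_assoc]
  exact mul_le_mul_of_nonneg_left (by linarith) (by positivity)

/-! ### From differences to second derivatives -/

/-- The second derivative in direction `b`. -/
def secondDeriv (φ : Space N → ℝ) (b x : Space N) : ℝ := fderiv ℝ (fderiv ℝ φ) x b b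

lemma secondDeriv_smul (φ : Space N → ℝ) (c : ℝ) (b x : Space N) :
    secondDeriv φ (c • b) x = c ^ 2 * secondDeriv φ b x := by
  simp [secondDeriv]; ring

lemma isCc_secondDeriv {φ : Space N → ℝ} (hφ : ContDiff ℝ ∞ φ) (hc : HasCompactSupport φ)
    (b : Space N) : IsCc (secondDeriv φ b) := by
  refine ⟨?_, ?_⟩
  · have h1 : ContDiff ℝ ∞ (fderiv ℝ φ) := hφ.fderiv_right (by norm_cast)
    have h2 : ContDiff ℝ ∞ (fderiv ℝ (fderiv ℝ φ)) := h1.fderiv_right (by norm_cast)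
    exact (h2.continuous.clm_apply continuous_const).clm_apply continuous_const
  · exact ((hc.fderiv ℝ).fderiv ℝ).comp_left
      (g := fun L : Space N →L[ℝ] Space N →L[ℝ] ℝ => L b b) (by simp)

/-- Cauchy's mean value theorem compares the even function `g t + g (-t)` with `t²`; the ordinary
one then applies to `g'` on the symmetric interval found. -/
lemma exists_second_difference_eq {φ : Space N → ℝ} (hφ : ContDiff ℝ ∞ φ) (b x : Space N) {h : ℝ}
    (hh : 0 < h) : ∃ ξ ∈ Set.Ioo (-h) h,
      φ (x + h • b) + φ (x - h • b) - 2 * φ x = h ^ 2 * secondDeriv φ b (x + ξ • b) := by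
  have h1 : ContDiff ℝ ∞ (fderiv ℝ φ) := hφ.fderiv_right (by norm_cast)
  set g : ℝ → ℝ := fun t => φ (x + t • b)
  set g' : ℝ → ℝ := fun t => fderiv ℝ φ (x + t • b) b
  have hline : ∀ t : ℝ, HasDerivAt (fun t : ℝ => x + t • b) b t := fun t => by
    simpa using ((hasDerivAt_id t).smul_const b).const_add x
  have hg : ∀ t, HasDerivAt g (g' t) t := fun t =>
    ((hφ.differentiable (by simp)) (x + t • b)).hasFDerivAt.comp_hasDerivAt t (hline t)
  have hg' : ∀ t, HasDerivAt g' (secondDeriv φ b (x + t • b)) t := fun t => by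
    have := ((h1.differentiable (by simp)) (x + t • b)).hasFDerivAt.comp_hasDerivAt t (hline t)
    refine HasDerivAt.congr_deriv (this.clm_apply (hasDerivAt_const t b)) ?_
    simp [secondDeriv]
  have hk : ∀ t, HasDerivAt (fun t => g t + g (-t)) (g' t - g' (-t)) t := fun t => by
    have := (hg t).add ((hg (-t)).comp t (hasDerivAt_neg t))
    refine HasDerivAt.congr_deriv this ?_
    ring
  have hsq : ∀ t : ℝ, HasDerivAt (fun t : ℝ => t ^ 2) (2 * t) t := fun t => by
    simpa using hasDerivAt_pow 2 t
  obtain ⟨η, hη, e1⟩ := exists_ratio_hasDerivAt_eq_ratio_slope (fun t => g t + g (-t))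
    (fun t => g' t - g' (-t)) hh (fun t _ => (hk t).continuousAt.continuousWithinAt)
    (fun t _ => hk t) (fun t => t ^ 2) (fun t => 2 * t)
    (fun t _ => (hsq t).continuousAt.continuousWithinAt) (fun t _ => hsq t)
  obtain ⟨ξ, hξ, e2⟩ := exists_hasDerivAt_eq_slope g' (fun t => secondDeriv φ b (x + t • b))
    (by linarith [hη.1] : -η < η) (fun t _ => (hg' t).continuousAt.continuousWithinAt)
    (fun t _ => hg' t)
  refine ⟨ξ, ⟨by linarith [hξ.1, hη.2], by linarith [hξ.2, hη.2]⟩, ?_⟩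
  have hη0 := hη.1
  rw [e2]
  have e3 : g h + g (-h) - 2 * g 0 = φ (x + h • b) + φ (x - h • b) - 2 * φ x := by
    simp [g, sub_eq_add_neg]
  rw [← e3]
  simp only [neg_zero, sub_neg_eq_add] at e1 e2 ⊢
  field_simp
  ring_nf at e1 ⊢
  linarith

lemma tendsto_integral_of_uniformly_bounded {G : ℕ → Space N → ℝ} {g : Space N → ℝ}
    (hG : ∀ n, Continuous (G n)) {M R : ℝ} (hM : ∀ n x, |G n x| ≤ M)
    (hR : ∀ n x, R < ‖x‖ → G n x = 0) (hlim : ∀ x, Tendsto (fun n => G n x) atTop (𝓝 (g x))) :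
    Tendsto (fun n => ∫ x, G n x) atTop (𝓝 (∫ x, g x)) := by
  refine tendsto_integral_of_dominated_convergence
    ((Metric.closedBall (0 : Space N) R).indicator fun _ => M)
    (fun n => (hG n).aestronglyMeasurable) ?_ (fun n => ae_of_all _ fun x => ?_)
    (ae_of_all _ hlim)
  · exact (integrable_indicator_iff measurableSet_closedBall).2
      (integrableOn_const (measure_closedBall_lt_top.ne))
  · by_cases hx : x ∈ Metric.closedBall (0 : Space N) R
    · rw [Set.indicator_of_mem hx]; exact hM n x
    · rw [Set.indicator_of_notMem hx, hR n x (by simpa using hx)]; simp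

lemma IsCc.exists_bound (hf : IsCc f) :
    ∃ M R : ℝ, 0 ≤ M ∧ (∀ x, |f x| ≤ M) ∧ ∀ x, R < ‖x‖ → f x = 0 := by
  obtain ⟨M, hM⟩ := hf.2.exists_bound_of_continuous hf.1
  obtain ⟨R, hR⟩ := hf.2.isBounded.subset_closedBall (0 : Space N)
  refine ⟨M, R, (norm_nonneg _).trans (hM 0), hM, fun x hx => ?_⟩
  by_contra h
  have := hR (subset_tsupport f h)
  simp at this
  linarith

/-- The second difference quotient with step `h`. -/
def secondQuot (φ : Space N → ℝ) (b : Space N) (h : ℝ) (x : Space N) : ℝ :=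
  (h ^ 2)⁻¹ * (φ (x + h • b) + φ (x - h • b) - 2 * φ x)

/-- Each quotient is a value of the second derivative at a point at distance at most `h n * ‖b‖`.
This gives the bound, the common support and the limit required for dominated convergence. -/
lemma secondQuot_bounds {φ : Space N → ℝ} (hφ : ContDiff ℝ ∞ φ) (hc : HasCompactSupport φ)
    (b : Space N) {h : ℕ → ℝ} (h0 : ∀ n, 0 < h n) (h1 : ∀ n, h n ≤ 1)
    (hl : Tendsto h atTop (𝓝 0)) :
    (∃ M R : ℝ, 0 ≤ M ∧ (∀ n x, |secondQuot φ b (h n) x| ≤ M) ∧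
      (∀ n x, R < ‖x‖ → secondQuot φ b (h n) x = 0)) ∧
    ∀ x, Tendsto (fun n => secondQuot φ b (h n) x) atTop (𝓝 (secondDeriv φ b x)) := by
  have hcc := isCc_secondDeriv hφ hc b
  obtain ⟨M, R, hM0, hM, hR⟩ := hcc.exists_bound
  have key : ∀ n x, ∃ ξ ∈ Set.Ioo (-(h n)) (h n),
      secondQuot φ b (h n) x = secondDeriv φ b (x + ξ • b) := by
    intro n x
    obtain ⟨ξ, hξ, e⟩ := exists_second_difference_eq hφ b x (h0 n)
    refine ⟨ξ, hξ, ?_⟩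
    rw [secondQuot, e]
    have := (h0 n).ne'
    field_simp
  choose ξ hξ e using key
  refine ⟨⟨M, R + ‖b‖, hM0, fun n x => by rw [e]; exact hM _, fun n x hx => ?_⟩, fun x => ?_⟩
  · rw [e]
    refine hR _ ?_
    have h2 : ‖ξ n x • b‖ ≤ ‖b‖ := by
      rw [norm_smul]
      have : ‖ξ n x‖ ≤ 1 := (abs_le.2 ⟨(hξ n x).1.le, (hξ n x).2.le⟩).trans (h1 n)
      calc ‖ξ n x‖ * ‖b‖ ≤ 1 * ‖b‖ := by gcongr
        _ = ‖b‖ := one_mul _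
    have := norm_sub_le (x + ξ n x • b) (ξ n x • b)
    rw [add_sub_cancel_right] at this
    linarith
  · simp only [e]
    have hx : Tendsto (fun n => ξ n x) atTop (𝓝 0) :=
      squeeze_zero_norm (fun n => abs_le.2 ⟨(hξ n x).1.le, (hξ n x).2.le⟩) hl
    have h3 : Tendsto (fun n => x + ξ n x • b) atTop (𝓝 x) := by
      simpa using (hx.smul_const b).const_add x
    exact (hcc.1.tendsto x).comp h3

/-- The discrete estimate is applied with translations `h • b k`. Because `C` does not depend on
them, `h → 0` is allowed. -/
lemma abs_integral_secondDeriv_mul_le [Nonempty ι] {p q : ℝ} (hp : 1 ≤ p) {C : ℝ}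
    (hC0 : 0 < C)
    (hC : ∀ (v : ι → Space N) (j : ι) (K : ℕ) (f g : Space N → ℝ), IsCc f → IsCc g →
      bilinearSum v j K f g ≤ C * ((∫ x, |f x| ^ p) + ∫ x, |g x| ^ q))
    {φ : Space N → ℝ} (hφ : ContDiff ℝ ∞ φ) (hc : HasCompactSupport φ) (hg : IsCc g)
    (b : ι → Space N) (j : ι) :
    |∫ x, secondDeriv φ ((2 : ℝ) • b j) x * g x| ≤
      C * (2 ^ p * (∫ x, |∑ k, (Fintype.card ι : ℝ)⁻¹ * (2⁻¹ * secondDeriv φ (b k) x)| ^ p)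
        + ∫ x, |g x| ^ q) := by
  have hp0 : 0 < p := by linarith
  set h : ℕ → ℝ := fun n => 1 / ((n : ℝ) + 1) with hh
  have h0 : ∀ n, 0 < h n := fun n => by positivity
  have h1 : ∀ n, h n ≤ 1 := fun n => by
    rw [hh]; simp only; rw [div_le_one (by positivity)]; linarith [(Nat.cast_nonneg n : (0 : ℝ) ≤ n)]
  have hl : Tendsto h atTop (𝓝 0) := tendsto_one_div_add_atTop_nhds_zero_nat
  have hφc : IsCc φ := ⟨hφ.continuous, hc⟩
  have hQc : ∀ b h, Continuous (secondQuot φ b h) := fun b h => by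
    have := hφ.continuous
    unfold secondQuot; fun_prop
  set G : ℕ → Space N → ℝ := fun n x =>
    ∑ k, (Fintype.card ι : ℝ)⁻¹ * (2⁻¹ * secondQuot φ (b k) (h n) x) with hG
  have hGc : ∀ n, Continuous (G n) := fun n => by
    refine continuous_finsetSum _ fun k _ => ?_
    have := hQc (b k) (h n)
    fun_prop
  have hcard : (Fintype.card ι : ℝ) ≠ 0 := by exact_mod_cast Fintype.card_ne_zero
  have hstep : ∀ n, |∫ x, secondQuot φ ((2 : ℝ) • b j) (h n) x * g x| ≤
      C * (2 ^ p * (∫ x, |G n x| ^ p) + ∫ x, |g x| ^ q) := by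
    intro n
    -- Dividing by `h²` turns `f - avg v f` into minus an average of second difference quotients.
    -- The doubled central difference is the quotient in direction `2 • b j`, as it uses the points
    -- `x ± 2h b j` and `x`.
    set f : Space N → ℝ := fun x => (h n ^ 2)⁻¹ * φ x with hf
    have hfc : IsCc f := hφc.const_mul _
    set v : ι → Space N := fun k => h n • b k with hv
    have e1 : ∀ x, secondQuot φ ((2 : ℝ) • b j) (h n) x =
        centralDiff (v j) (centralDiff (v j) f) x := by
      intro x
      simp only [secondQuot, centralDiff, hf, hv]
      rw [show x + h n • b j + h n • b j = x + h n • (2 : ℝ) • b j by module,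
        show x - h n • b j - h n • b j = x - h n • (2 : ℝ) • b j by module,
        show x + h n • b j - h n • b j = x by module,
        show x - h n • b j + h n • b j = x by module]
      ring
    have e2 : ∀ x, |(f - avg v f) x| = |G n x| := by
      intro x
      rw [← abs_neg]
      congr 1
      have : f x = ∑ _k : ι, (Fintype.card ι : ℝ)⁻¹ * f x := by
        rw [← Finset.sum_mul]; simp [hcard]
      simp only [Pi.sub_apply, hG, avg, neg_sub]
      rw [this, ← Finset.sum_sub_distrib]
      refine Finset.sum_congr rfl fun k _ => ?_
      simp only [secondQuot, hf, hv]
      ring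
    simp only [e1]
    rw [integral_centralDiff_mul (hfc.centralDiff _) hg, abs_neg]
    refine (abs_integral_centralDiff_le hC hfc hg v j).trans ?_
    refine mul_le_mul_of_nonneg_left (add_le_add ?_ le_rfl) hC0.le
    simpa only [e2] using integral_abs_sub_avg_avg_le hp hfc v
  have lim1 : Tendsto (fun n => ∫ x, secondQuot φ ((2 : ℝ) • b j) (h n) x * g x) atTop
      (𝓝 (∫ x, secondDeriv φ ((2 : ℝ) • b j) x * g x)) := by
    obtain ⟨⟨M, R, hM0, hM, hR⟩, hlim⟩ := secondQuot_bounds hφ hc ((2 : ℝ) • b j) h0 h1 hl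
    obtain ⟨M', -, hM0', hM', -⟩ := hg.exists_bound
    refine tendsto_integral_of_uniformly_bounded (M := M * M') (R := R)
      (fun n => (hQc _ _).mul hg.1) (fun n x => ?_) (fun n x hx => ?_)
      (fun x => (hlim x).mul_const _)
    · rw [abs_mul]; exact mul_le_mul (hM n x) (hM' x) (abs_nonneg _) hM0
    · rw [hR n x hx, zero_mul]
  have lim2 : Tendsto (fun n => ∫ x, |G n x| ^ p) atTop
      (𝓝 (∫ x, |∑ k, (Fintype.card ι : ℝ)⁻¹ * (2⁻¹ * secondDeriv φ (b k) x)| ^ p)) := by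
    choose hex hlim using fun k => secondQuot_bounds hφ hc (b k) h0 h1 hl
    choose M R hM0 hM hR using hex
    have hGl : ∀ x, Tendsto (fun n => G n x) atTop
        (𝓝 (∑ k, (Fintype.card ι : ℝ)⁻¹ * (2⁻¹ * secondDeriv φ (b k) x))) := fun x =>
      tendsto_finsetSum _ fun k _ => ((hlim k x).const_mul _).const_mul _
    refine tendsto_integral_of_uniformly_bounded
      (M := (∑ k, (Fintype.card ι : ℝ)⁻¹ * (2⁻¹ * M k)) ^ p) (R := ∑ k, |R k|)
      (fun n => (hGc n).abs.rpow_const fun _ => Or.inr hp0.le) (fun n x => ?_) (fun n x hx => ?_)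
      (fun x => (((continuous_abs.tendsto _).comp (hGl x)).rpow_const (Or.inr hp0.le)))
    · rw [abs_of_nonneg (by positivity)]
      refine Real.rpow_le_rpow (abs_nonneg _) ?_ hp0.le
      refine (Finset.abs_sum_le_sum_abs _ _).trans (Finset.sum_le_sum fun k _ => ?_)
      rw [abs_mul, abs_mul, abs_of_nonneg (by positivity : (0 : ℝ) ≤ (Fintype.card ι : ℝ)⁻¹),
        abs_of_nonneg (by positivity : (0 : ℝ) ≤ 2⁻¹)]
      have := hM k n x
      gcongr
    · have : G n x = 0 := Finset.sum_eq_zero fun k _ => by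
        rw [hR k n x (lt_of_le_of_lt ((le_abs_self _).trans
          (Finset.single_le_sum (f := fun k => |R k|) (fun _ _ => abs_nonneg _)
            (Finset.mem_univ k))) hx)]
        simp
      rw [this, abs_zero, Real.zero_rpow hp0.ne']
  exact le_of_tendsto_of_tendsto' ((continuous_abs.tendsto _).comp lim1)
    (((lim2.const_mul _).add_const _).const_mul _) hstep

/-- The odd power `|t|^(r-1) t`. -/
def signedRpow (r t : ℝ) : ℝ := max t 0 ^ r - max (-t) 0 ^ r

lemma continuous_signedRpow {r : ℝ} (hr : 0 < r) : Continuous (signedRpow r) := by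
  unfold signedRpow
  exact ((continuous_id.max continuous_const).rpow_const fun _ => Or.inr hr.le).sub
    ((continuous_neg.max continuous_const).rpow_const fun _ => Or.inr hr.le)

lemma abs_signedRpow {r : ℝ} (hr : 0 < r) (t : ℝ) : |signedRpow r t| = |t| ^ r := by
  unfold signedRpow
  rcases le_total 0 t with h | h
  · rw [max_eq_left h, max_eq_right (by linarith), Real.zero_rpow hr.ne', sub_zero, abs_of_nonneg h,
      abs_of_nonneg (Real.rpow_nonneg h _)]
  · rw [max_eq_right h, max_eq_left (by linarith), Real.zero_rpow hr.ne', zero_sub, abs_neg,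
      abs_of_nonpos h, abs_of_nonneg (Real.rpow_nonneg (by linarith) _)]

lemma mul_signedRpow {r : ℝ} (hr : 0 < r) (t : ℝ) : t * signedRpow r t = |t| ^ (r + 1) := by
  unfold signedRpow
  rcases le_total 0 t with h | h
  · rw [max_eq_left h, max_eq_right (by linarith), Real.zero_rpow hr.ne', sub_zero, abs_of_nonneg h,
      Real.rpow_add_one' h (by linarith)]
    ring
  · rw [max_eq_right h, max_eq_left (by linarith), Real.zero_rpow hr.ne', zero_sub,
      abs_of_nonpos h, Real.rpow_add_one' (by linarith) (by linarith)]
    ring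

/-- Duality: the previous bound is tested against a multiple of `|g|^(p-2) g`, where `g` is the
second derivative to be estimated, and the `q`-term is absorbed. -/
lemma exists_secondDeriv_le [Nonempty ι] {p : ℝ} (hp : 1 < p) :
    ∃ C : ℝ, 0 < C ∧ ∀ (φ : Space N → ℝ), ContDiff ℝ ∞ φ → HasCompactSupport φ →
      ∀ (b : ι → Space N) (j : ι), ∫ x, |secondDeriv φ (b j) x| ^ p ≤
        C * ∫ x, |∑ k, (Fintype.card ι : ℝ)⁻¹ * (2⁻¹ * secondDeriv φ (b k) x)| ^ p := by
  set q := p.conjExponent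
  have hpq : p.HolderConjugate q := Real.HolderConjugate.conjExponent hp
  obtain ⟨C, hC0, hC⟩ := exists_bilinearSum_le N ι hpq
  -- This `t` solves `C t^q = 2 t`. The left side is `4 t ∫ |g|^p`, the 4 coming from the direction
  -- `2 • b j`, so half of it survives the absorption.
  set t : ℝ := (2 / C) ^ (q - 1)⁻¹ with ht
  have ht0 : 0 < t := by positivity
  have hq1 := hpq.symm.lt
  have htq : t ^ q = t * (2 / C) := by
    have : t ^ (q - 1) = 2 / C := by
      rw [ht, ← Real.rpow_mul (by positivity), inv_mul_cancel₀ (by linarith), Real.rpow_one]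
    rw [← this, mul_comm, ← Real.rpow_add_one ht0.ne', sub_add_cancel]
  refine ⟨C * 2 ^ p / (2 * t), by positivity, fun φ hφ hc b j => ?_⟩
  set g := secondDeriv φ (b j) with hg
  have hgc : IsCc g := isCc_secondDeriv hφ hc _
  have hp1 : 0 < p - 1 := by linarith
  set ψ : Space N → ℝ := fun x => t * signedRpow (p - 1) (g x) with hψ
  have hψc : IsCc ψ := (hgc.comp (continuous_signedRpow hp1) (by
    simp [signedRpow])).const_mul t
  have h1 := abs_integral_secondDeriv_mul_le hp.le hC0 hC hφ hc hψc b j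
  have e1 : ∀ x, secondDeriv φ ((2 : ℝ) • b j) x * ψ x = 4 * t * |g x| ^ p := by
    intro x
    have := mul_signedRpow hp1 (g x)
    rw [sub_add_cancel] at this
    rw [secondDeriv_smul, ← this, hψ]; simp only [← hg]; ring
  have e2 : ∀ x, |ψ x| ^ q = t ^ q * |g x| ^ p := by
    intro x
    have e3 : (p - 1) * q = p := by have := hpq.mul_eq_add; linarith
    rw [hψ]; simp only
    rw [abs_mul, abs_of_pos ht0, abs_signedRpow hp1,
      Real.mul_rpow ht0.le (by positivity), ← Real.rpow_mul (abs_nonneg _), e3]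
  simp only [e1, e2, integral_const_mul] at h1
  rw [htq] at h1
  set I := ∫ x, |g x| ^ p with hI
  set J := ∫ x, |∑ k, (Fintype.card ι : ℝ)⁻¹ * (2⁻¹ * secondDeriv φ (b k) x)| ^ p
  have h2 : 4 * t * I ≤ C * 2 ^ p * J + 2 * t * I := by
    refine (le_abs_self _).trans (h1.trans (le_of_eq ?_))
    field_simp
  rw [div_mul_eq_mul_div, le_div_iff₀ (by positivity)]
  linarith

lemma classicalDeriv_pair {φ : Space N → ℝ} (hφ : ContDiff ℝ ∞ φ) (i j : Fin N) (x : Space N) :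
    classicalDeriv [i, j] φ x =
      fderiv ℝ (fderiv ℝ φ) x (EuclideanSpace.single i 1) (EuclideanSpace.single j 1) := by
  have h1 : ContDiff ℝ ∞ (fderiv ℝ φ) := hφ.fderiv_right (by norm_cast)
  simp only [classicalDeriv]
  rw [fderiv_clm_apply (h1.differentiable (by simp) x) (differentiableAt_const _)]
  simp

lemma fderiv_fderiv_symm {φ : Space N → ℝ} (hφ : ContDiff ℝ ∞ φ) (x a b : Space N) :
    fderiv ℝ (fderiv ℝ φ) x a b = fderiv ℝ (fderiv ℝ φ) x b a := by
  have : IsSymmSndFDerivAt ℝ φ x := hφ.contDiffAt.isSymmSndFDerivAt (by simp; norm_cast)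
  exact this a b

/-- Second derivatives are controlled by the Laplacian in `L^p`, `1 < p < ∞`. -/
theorem exists_integral_classicalDeriv_pair_le (N : ℕ) {p : ℝ} (hp : 1 < p) :
    ∃ C : ℝ, 0 < C ∧ ∀ φ : Space N → ℝ, ContDiff ℝ ∞ φ → HasCompactSupport φ → ∀ i j : Fin N,
      ∫ x, |classicalDeriv [i, j] φ x| ^ p ≤ C * ∫ x, |∑ k, classicalDeriv [k, k] φ x| ^ p := by
  rcases Nat.eq_zero_or_pos N with rfl | hN
  · exact ⟨1, one_pos, fun φ _ _ i => i.elim0⟩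
  have : Nonempty (Fin N) := ⟨⟨0, hN⟩⟩
  have hp0 : 0 < p := by linarith
  obtain ⟨C, hC0, hC⟩ := exists_secondDeriv_le (N := N) (ι := Fin N × Fin N × Bool) hp
  set e : Fin N → Space N := fun i => EuclideanSpace.single i 1 with he
  -- The directions are `e_k ± e_l`. Their second derivatives sum to `4N` times the Laplacian, while
  -- the difference of the two signs for `(i, j)` is four times the mixed derivative.
  set b : Fin N × Fin N × Bool → Space N :=
    fun k => e k.1 + (if k.2.2 then (1 : ℝ) else -1) • e k.2.1 with hb
  set c : ℝ := (Fintype.card (Fin N × Fin N × Bool) : ℝ)⁻¹ * 2⁻¹ * (4 * N) with hcdef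
  refine ⟨2 ^ (p - 1) * (2 * C) * |c| ^ p + 1, by positivity, fun φ hφ hc i j => ?_⟩
  have hsum : ∀ x, ∑ k, (Fintype.card (Fin N × Fin N × Bool) : ℝ)⁻¹ *
      (2⁻¹ * secondDeriv φ (b k) x) = c * ∑ k, classicalDeriv [k, k] φ x := by
    intro x
    have h1 : ∀ k l : Fin N, secondDeriv φ (b (k, l, true)) x + secondDeriv φ (b (k, l, false)) x =
        2 * classicalDeriv [k, k] φ x + 2 * classicalDeriv [l, l] φ x := by
      intro k l
      rw [classicalDeriv_pair hφ, classicalDeriv_pair hφ]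
      simp [secondDeriv, hb, he]
      ring
    rw [← Finset.mul_sum, ← Finset.mul_sum, Fintype.sum_prod_type]
    simp only [Fintype.sum_prod_type, Fintype.sum_bool, h1]
    simp only [Finset.sum_add_distrib, Finset.sum_const, Finset.card_univ, Fintype.card_fin,
      ← Finset.mul_sum, nsmul_eq_mul, hcdef]
    ring
  have h2 : ∀ k, ∫ x, |secondDeriv φ (b k) x| ^ p ≤
      C * (|c| ^ p * ∫ x, |∑ k, classicalDeriv [k, k] φ x| ^ p) := by
    intro k
    refine (hC φ hφ hc b k).trans (le_of_eq ?_)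
    simp only [hsum, abs_mul, Real.mul_rpow (abs_nonneg _) (abs_nonneg _), integral_const_mul]
  have h3 : ∀ x, |classicalDeriv [i, j] φ x| ≤
      |secondDeriv φ (b (i, j, true)) x| + |secondDeriv φ (b (i, j, false)) x| := by
    intro x
    have h4 : 4 * classicalDeriv [i, j] φ x =
        secondDeriv φ (b (i, j, true)) x - secondDeriv φ (b (i, j, false)) x := by
      rw [classicalDeriv_pair hφ]
      have := fderiv_fderiv_symm hφ x (e i) (e j)
      simp only [he] at this
      simp [secondDeriv, hb, he]
      linarith
    have h5 := abs_sub (secondDeriv φ (b (i, j, true)) x) (secondDeriv φ (b (i, j, false)) x)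
    rw [← h4, abs_mul] at h5
    have : |(4 : ℝ)| = 4 := by norm_num
    rw [this] at h5
    linarith [abs_nonneg (classicalDeriv [i, j] φ x)]
  have hcc := fun k => (isCc_secondDeriv hφ hc (b k)).abs_rpow hp0
  have h6 : ∫ x, |classicalDeriv [i, j] φ x| ^ p ≤
      2 ^ (p - 1) * ((∫ x, |secondDeriv φ (b (i, j, true)) x| ^ p) +
        ∫ x, |secondDeriv φ (b (i, j, false)) x| ^ p) := by
    rw [← integral_add (hcc _).integrable (hcc _).integrable, ← integral_const_mul]
    refine integral_mono_of_nonneg (ae_of_all _ fun x => by positivity)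
      (((hcc _).add (hcc _)).const_mul _).integrable (ae_of_all _ fun x => ?_)
    exact (Real.rpow_le_rpow (abs_nonneg _) (h3 x) hp0.le).trans
      (real_add_rpow_le (abs_nonneg _) (abs_nonneg _) hp.le)
  have hJ : 0 ≤ ∫ x, |∑ k, classicalDeriv [k, k] φ x| ^ p := integral_nonneg fun x => by positivity
  refine h6.trans ?_
  have h7 := add_le_add (h2 (i, j, true)) (h2 (i, j, false))
  have h8 := mul_le_mul_of_nonneg_left h7 (by positivity : (0 : ℝ) ≤ 2 ^ (p - 1))
  linarith

end

/-! ### Classical derivatives of test functions -/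

section

variable {N : ℕ} {Ω : Set (Space N)} {φ ψ : Space N → ℝ}

lemma contDiff_classicalDeriv (hφ : ContDiff ℝ ∞ φ) (I : List (Fin N)) :
    ContDiff ℝ ∞ (classicalDeriv I φ) := by
  induction I with
  | nil => exact hφ
  | cons i I ih => exact (ih.fderiv_right (by norm_cast)).clm_apply contDiff_const

lemma tsupport_classicalDeriv_subset (I : List (Fin N)) (φ : Space N → ℝ) :
    tsupport (classicalDeriv I φ) ⊆ tsupport φ := by
  induction I with
  | nil => exact subset_rfl
  | cons i I ih => exact (tsupport_fderiv_apply_subset ℝ _).trans ih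

lemma IsTestFunction.classicalDeriv (hφ : IsTestFunction Ω φ) (I : List (Fin N)) :
    IsTestFunction Ω (classicalDeriv I φ) :=
  ⟨contDiff_classicalDeriv hφ.1 I,
    hφ.2.1.of_isClosed_subset (isClosed_tsupport _) (tsupport_classicalDeriv_subset I φ),
    (tsupport_classicalDeriv_subset I φ).trans hφ.2.2⟩

lemma classicalDeriv_append (I J : List (Fin N)) (φ : Space N → ℝ) :
    classicalDeriv (I ++ J) φ = classicalDeriv I (classicalDeriv J φ) := by
  induction I with
  | nil => rfl
  | cons i I ih => simp only [List.cons_append, classicalDeriv, ih]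

lemma classicalDeriv_add (hφ : ContDiff ℝ ∞ φ) (hψ : ContDiff ℝ ∞ ψ) (I : List (Fin N)) :
    classicalDeriv I (φ + ψ) = classicalDeriv I φ + classicalDeriv I ψ := by
  induction I with
  | nil => rfl
  | cons i I ih =>
    ext x
    simp only [classicalDeriv, ih, Pi.add_apply]
    rw [fderiv_add ((contDiff_classicalDeriv hφ I).differentiable (by simp) x)
      ((contDiff_classicalDeriv hψ I).differentiable (by simp) x)]
    simp

lemma classicalDeriv_const_smul (c : ℝ) (hφ : ContDiff ℝ ∞ φ) (I : List (Fin N)) :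
    classicalDeriv I (c • φ) = c • classicalDeriv I φ := by
  induction I with
  | nil => rfl
  | cons i I ih =>
    ext x
    simp only [classicalDeriv, ih, Pi.smul_apply]
    rw [fderiv_const_smul ((contDiff_classicalDeriv hφ I).differentiable (by simp) x)]
    simp

lemma classicalDeriv_zero (I : List (Fin N)) :
    classicalDeriv I (0 : Space N → ℝ) = 0 := by
  simpa using classicalDeriv_const_smul 0 (φ := (0 : Space N → ℝ)) contDiff_const I

lemma contDiff_finset_sum {κ : Type*} (s : Finset κ) {φ : κ → Space N → ℝ}
    (hφ : ∀ k, ContDiff ℝ ∞ (φ k)) : ContDiff ℝ ∞ (∑ k ∈ s, φ k) := by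
  have := ContDiff.sum (s := s) fun k _ => hφ k
  convert this using 1
  ext x; simp

lemma classicalDeriv_sum {κ : Type*} (s : Finset κ) {φ : κ → Space N → ℝ}
    (hφ : ∀ k, ContDiff ℝ ∞ (φ k)) (I : List (Fin N)) :
    classicalDeriv I (∑ k ∈ s, φ k) = ∑ k ∈ s, classicalDeriv I (φ k) := by
  classical
  induction s using Finset.induction_on with
  | empty => simp [classicalDeriv_zero]
  | insert a s ha ih =>
    rw [Finset.sum_insert ha, Finset.sum_insert ha,
      classicalDeriv_add (hφ a) (contDiff_finset_sum s hφ), ih]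

lemma classicalDeriv_swap (hφ : ContDiff ℝ ∞ φ) (i j : Fin N) :
    classicalDeriv [i, j] φ = classicalDeriv [j, i] φ := by
  ext x
  rw [classicalDeriv_pair hφ, classicalDeriv_pair hφ, fderiv_fderiv_symm hφ]

lemma classicalDeriv_perm (hφ : ContDiff ℝ ∞ φ) {I J : List (Fin N)} (h : I.Perm J) :
    classicalDeriv I φ = classicalDeriv J φ := by
  induction h with
  | nil => rfl
  | cons i _ ih => simp only [classicalDeriv, ih]
  | swap i j I => exact classicalDeriv_swap (contDiff_classicalDeriv hφ I) j i
  | trans _ _ h1 h2 => exact h1.trans h2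

lemma IsTestFunction.add (hφ : IsTestFunction Ω φ) (hψ : IsTestFunction Ω ψ) :
    IsTestFunction Ω (φ + ψ) :=
  ⟨hφ.1.add hψ.1, hφ.2.1.add hψ.2.1,
    (tsupport_add φ ψ).trans (Set.union_subset hφ.2.2 hψ.2.2)⟩

lemma IsTestFunction.const_smul (hφ : IsTestFunction Ω φ) (c : ℝ) : IsTestFunction Ω (c • φ) :=
  ⟨hφ.1.const_smul c, hφ.2.1.smul_left (f := fun _ => c),
    (closure_mono (Function.support_const_smul_subset c φ)).trans hφ.2.2⟩

lemma isTestFunction_zero : IsTestFunction Ω (0 : Space N → ℝ) :=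
  ⟨contDiff_const, HasCompactSupport.zero, by simp [tsupport]⟩

lemma IsTestFunction.sum {κ : Type*} (s : Finset κ) {φ : κ → Space N → ℝ}
    (hφ : ∀ k, IsTestFunction Ω (φ k)) : IsTestFunction Ω (∑ k ∈ s, φ k) := by
  classical
  induction s using Finset.induction_on with
  | empty => simpa using isTestFunction_zero
  | insert a s ha ih => rw [Finset.sum_insert ha]; exact (hφ a).add ih

lemma IsTestFunction.isCc (hφ : IsTestFunction Ω φ) : IsCc φ := ⟨hφ.1.continuous, hφ.2.1⟩

lemma IsTestFunction.support_subset (hφ : IsTestFunction Ω φ) : Function.support φ ⊆ Ω :=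
  (subset_tsupport φ).trans hφ.2.2

lemma IsTestFunction.memLp (hφ : IsTestFunction Ω φ) (p : ℝ≥0∞) (μ : Measure (Space N))
    [IsFiniteMeasureOnCompacts μ] : MemLp φ p μ :=
  hφ.1.continuous.memLp_of_hasCompactSupport hφ.2.1

/-! ### The Laplacian and the operator `D_r` on test functions -/

/-- The classical Laplacian. -/
def classicalLaplacian (φ : Space N → ℝ) : Space N → ℝ := ∑ i, classicalDeriv [i, i] φ

lemma IsTestFunction.classicalLaplacian (hφ : IsTestFunction Ω φ) :
    IsTestFunction Ω (classicalLaplacian φ) :=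
  IsTestFunction.sum _ fun i => hφ.classicalDeriv [i, i]

lemma IsTestFunction.iterate_classicalLaplacian (hφ : IsTestFunction Ω φ) (k : ℕ) :
    IsTestFunction Ω (Kirchhoff.classicalLaplacian^[k] φ) := by
  induction k with
  | zero => exact hφ
  | succ k ih => rw [Function.iterate_succ_apply']; exact ih.classicalLaplacian

lemma classicalDeriv_classicalLaplacian (hφ : ContDiff ℝ ∞ φ) (I : List (Fin N)) :
    classicalDeriv I (classicalLaplacian φ) = ∑ i, classicalDeriv (I ++ [i, i]) φ := by
  rw [classicalLaplacian, classicalDeriv_sum _ fun i => contDiff_classicalDeriv hφ _]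
  simp only [classicalDeriv_append]

lemma classicalLaplacian_classicalDeriv (hφ : ContDiff ℝ ∞ φ) (I : List (Fin N)) :
    classicalLaplacian (classicalDeriv I φ) = classicalDeriv I (classicalLaplacian φ) := by
  rw [classicalDeriv_classicalLaplacian hφ, classicalLaplacian]
  refine Finset.sum_congr rfl fun i _ => ?_
  rw [← classicalDeriv_append]
  exact classicalDeriv_perm hφ List.perm_append_comm

lemma classicalLaplacian_add (hφ : ContDiff ℝ ∞ φ) (hψ : ContDiff ℝ ∞ ψ) :
    classicalLaplacian (φ + ψ) = classicalLaplacian φ + classicalLaplacian ψ := by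
  simp only [classicalLaplacian, classicalDeriv_add hφ hψ, Finset.sum_add_distrib]

lemma classicalLaplacian_const_smul (c : ℝ) (hφ : ContDiff ℝ ∞ φ) :
    classicalLaplacian (c • φ) = c • classicalLaplacian φ := by
  simp only [classicalLaplacian, classicalDeriv_const_smul c hφ, Finset.smul_sum]

lemma iterate_classicalLaplacian_add (hφ : IsTestFunction Ω φ) (hψ : IsTestFunction Ω ψ) (k : ℕ) :
    classicalLaplacian^[k] (φ + ψ) = classicalLaplacian^[k] φ + classicalLaplacian^[k] ψ := by
  induction k with
  | zero => rfl
  | succ k ih =>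
    rw [Function.iterate_succ_apply', ih,
      classicalLaplacian_add (hφ.iterate_classicalLaplacian k).1 (hψ.iterate_classicalLaplacian k).1,
      Function.iterate_succ_apply', Function.iterate_succ_apply']

lemma iterate_classicalLaplacian_const_smul (c : ℝ) (hφ : IsTestFunction Ω φ) (k : ℕ) :
    classicalLaplacian^[k] (c • φ) = c • classicalLaplacian^[k] φ := by
  induction k with
  | zero => rfl
  | succ k ih =>
    rw [Function.iterate_succ_apply', ih,
      classicalLaplacian_const_smul c (hφ.iterate_classicalLaplacian k).1,
      Function.iterate_succ_apply']

/-- The values of `D_r`, scalar or vector. -/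
abbrev DrSpace (N : ℕ) : Type := EuclideanSpace ℝ (Option (Fin N))

/-- Assembles a value of `D_r` from a scalar and a gradient, according to the parity of `r`. -/
def drVec (r : ℕ) (a : ℝ) (b : Fin N → ℝ) : DrSpace N :=
  WithLp.toLp 2 fun o => o.elim (if Even r then a else 0) fun i => if Even r then 0 else b i

lemma drVec_add (r : ℕ) (a a' : ℝ) (b b' : Fin N → ℝ) :
    drVec r (a + a') (b + b') = drVec r a b + drVec r a' b' := by
  ext o
  cases o <;> by_cases h : Even r <;> simp [drVec, h]

lemma drVec_smul (r : ℕ) (c a : ℝ) (b : Fin N → ℝ) :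
    drVec r (c • a) (c • b) = c • drVec r a b := by
  ext o
  cases o <;> by_cases h : Even r <;> simp [drVec, h]

lemma norm_drVec_le (r : ℕ) (a : ℝ) (b : Fin N → ℝ) :
    ‖drVec r a b‖ ≤ (if Even r then |a| else 0) + ∑ i, (if Even r then 0 else |b i|) := by
  have h1 : ∀ o, ‖drVec r a b o‖ = o.elim (if Even r then |a| else 0)
      fun i => if Even r then 0 else |b i| := by
    intro o
    cases o <;> by_cases h : Even r <;> simp [drVec, h]
  have h2 : ‖drVec r a b‖ ≤ ∑ o, ‖drVec r a b o‖ := by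
    rw [EuclideanSpace.norm_eq]
    refine Real.sqrt_le_iff.2 ⟨Finset.sum_nonneg fun _ _ => norm_nonneg _, ?_⟩
    exact Finset.sum_sq_le_sq_sum_of_nonneg fun _ _ => norm_nonneg _
  refine h2.trans (le_of_eq ?_)
  rw [Fintype.sum_option]
  simp only [h1, Option.elim_none, Option.elim_some]

/-- The classical `D_r φ`. -/
def classicalDr (r : ℕ) (φ : Space N → ℝ) (x : Space N) : DrSpace N :=
  drVec r (classicalLaplacian^[r / 2] φ x) fun i => classicalDeriv [i] (classicalLaplacian^[r / 2] φ) x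

lemma classicalDr_add (r : ℕ) (hφ : IsTestFunction Ω φ) (hψ : IsTestFunction Ω ψ) :
    classicalDr r (φ + ψ) = classicalDr r φ + classicalDr r ψ := by
  ext1 x
  simp only [Pi.add_apply, classicalDr]
  rw [← drVec_add, iterate_classicalLaplacian_add hφ hψ]
  congr 1
  ext i
  rw [classicalDeriv_add (hφ.iterate_classicalLaplacian _).1 (hψ.iterate_classicalLaplacian _).1]
  rfl

lemma classicalDr_const_smul (r : ℕ) (c : ℝ) (hφ : IsTestFunction Ω φ) :
    classicalDr r (c • φ) = c • classicalDr r φ := by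
  ext1 x
  simp only [Pi.smul_apply, classicalDr]
  rw [← drVec_smul, iterate_classicalLaplacian_const_smul c hφ]
  congr 1
  ext i
  rw [classicalDeriv_const_smul c (hφ.iterate_classicalLaplacian _).1]
  rfl

lemma classicalDr_add_two (r : ℕ) (φ : Space N → ℝ) :
    classicalDr (r + 2) φ = classicalDr r (classicalLaplacian φ) := by
  ext1 x
  have h1 : (r + 2) / 2 = r / 2 + 1 := by omega
  have h2 : Even (r + 2) ↔ Even r := by simp [Nat.even_add]
  simp only [classicalDr, drVec, h1, h2, Function.iterate_succ_apply]

lemma continuous_classicalDr (r : ℕ) (hφ : IsTestFunction Ω φ) : Continuous (classicalDr r φ) := by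
  have h1 := (hφ.iterate_classicalLaplacian (r / 2)).1.continuous
  have h2 := fun i => ((hφ.iterate_classicalLaplacian (r / 2)).classicalDeriv [i]).1.continuous
  unfold classicalDr drVec
  refine (PiLp.continuous_toLp 2 _).comp (continuous_pi fun o => ?_)
  cases o <;> by_cases h : Even r <;> simp only [h, if_true, if_false, Option.elim]
  · exact h1
  · exact continuous_const
  · exact continuous_const
  · exact h2 _

lemma support_classicalDr_subset (r : ℕ) (hφ : IsTestFunction Ω φ) :
    Function.support (classicalDr r φ) ⊆ tsupport φ := by
  intro x hx
  by_contra h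
  apply hx
  have h1 : ∀ k, tsupport (classicalLaplacian^[k] φ) ⊆ tsupport φ := fun k =>
    (IsTestFunction.iterate_classicalLaplacian (Ω := tsupport φ) ⟨hφ.1, hφ.2.1, subset_rfl⟩ k).2.2
  have h2 : classicalLaplacian^[r / 2] φ x = 0 := by
    by_contra h3; exact h (h1 _ (subset_tsupport _ h3))
  have h3 : ∀ i, classicalDeriv [i] (classicalLaplacian^[r / 2] φ) x = 0 := fun i => by
    by_contra h3; exact h (h1 _ (tsupport_classicalDeriv_subset [i] _ (subset_tsupport _ h3)))
  ext o
  cases o <;> by_cases h : Even r <;> simp [classicalDr, drVec, h2, h3, h]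

lemma hasCompactSupport_classicalDr (r : ℕ) (hφ : IsTestFunction Ω φ) :
    HasCompactSupport (classicalDr r φ) :=
  hφ.2.1.mono' (support_classicalDr_subset r hφ)

lemma memLp_classicalDr (r : ℕ) (hφ : IsTestFunction Ω φ) (p : ℝ≥0∞) (μ : Measure (Space N))
    [IsFiniteMeasureOnCompacts μ] : MemLp (classicalDr r φ) p μ :=
  (continuous_classicalDr r hφ).memLp_of_hasCompactSupport (hasCompactSupport_classicalDr r hφ)

lemma isCc_norm_classicalDr_rpow (r : ℕ) (hφ : IsTestFunction Ω φ) {p : ℝ} (hp : 0 < p) :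
    IsCc (fun x => ‖classicalDr r φ x‖ ^ p) :=
  IsCc.rpow (f := fun x => ‖classicalDr r φ x‖) ⟨(continuous_classicalDr r hφ).norm,
    (hasCompactSupport_classicalDr r hφ).norm⟩ hp

/-- All derivatives of order `r` are controlled by `D_r`. -/
theorem exists_integral_classicalDeriv_le (N r : ℕ) {p : ℝ} (hp : 1 < p) :
    ∃ C : ℝ, 0 < C ∧ ∀ (Ω : Set (Space N)) (φ : Space N → ℝ), IsTestFunction Ω φ →
      ∀ I : List (Fin N), I.length = r →
      ∫ x, |classicalDeriv I φ x| ^ p ≤ C * ∫ x, ‖classicalDr r φ x‖ ^ p := by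
  have hp0 : 0 < p := by linarith
  induction r using Nat.twoStepInduction with
  | zero =>
    refine ⟨1, one_pos, fun Ω φ hφ I hI => ?_⟩
    rw [List.length_eq_zero_iff] at hI
    subst hI
    rw [one_mul]
    refine integral_mono (hφ.isCc.abs_rpow hp0).integrable
      (isCc_norm_classicalDr_rpow 0 hφ hp0).integrable fun x => ?_
    refine Real.rpow_le_rpow (abs_nonneg _) ?_ hp0.le
    have := PiLp.norm_apply_le (classicalDr 0 φ x) none
    simpa [classicalDr, drVec, classicalDeriv] using this
  | one =>
    refine ⟨1, one_pos, fun Ω φ hφ I hI => ?_⟩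
    obtain ⟨i, rfl⟩ := List.length_eq_one_iff.1 hI
    rw [one_mul]
    refine integral_mono ((hφ.classicalDeriv [i]).isCc.abs_rpow hp0).integrable
      (isCc_norm_classicalDr_rpow 1 hφ hp0).integrable fun x => ?_
    refine Real.rpow_le_rpow (abs_nonneg _) ?_ hp0.le
    have := PiLp.norm_apply_le (classicalDr 1 φ x) (some i)
    simpa [classicalDr, drVec] using this
  | more r ih _ =>
    obtain ⟨C, hC0, hC⟩ := ih
    obtain ⟨C', hCpos, hC'⟩ := exists_integral_classicalDeriv_pair_le N hp
    -- The two outermost derivatives of `∂_J φ` are bounded by its Laplacian, which equals `∂_J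
    -- (Δφ)`. The induction hypothesis applies to `Δφ`, since `D_{r+2} φ = D_r (Δφ)`.
    refine ⟨C' * C, by positivity, fun Ω φ hφ I hI => ?_⟩
    obtain ⟨i, j, J, rfl⟩ : ∃ i j J, I = i :: j :: J := by
      match I, hI with
      | i :: j :: J, _ => exact ⟨i, j, J, rfl⟩
    have hJ : J.length = r := by simpa using hI
    have h1 := hC' (classicalDeriv J φ) (hφ.classicalDeriv J).1 (hφ.classicalDeriv J).2.1 i j
    have h2 := hC Ω (classicalLaplacian φ) hφ.classicalLaplacian J hJ
    rw [← classicalDeriv_append] at h1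
    have e : ∀ x, ∑ k, classicalDeriv [k, k] (classicalDeriv J φ) x =
        classicalDeriv J (classicalLaplacian φ) x := fun x => by
      rw [← classicalLaplacian_classicalDeriv hφ.1, classicalLaplacian, Finset.sum_apply]
    simp only [e] at h1
    rw [classicalDr_add_two, mul_assoc]
    exact h1.trans (mul_le_mul_of_nonneg_left h2 hCpos.le)

/-! ### Sobolev and Poincaré inequalities -/

lemma eLpNorm_le_of_integral_le {α F G : Type*} [MeasurableSpace α] {μ : Measure α}
    [NormedAddCommGroup F] [NormedAddCommGroup G] {f : α → F} {g : α → G} {p C : ℝ} (hp : 0 < p)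
    (hC : 0 ≤ C) (hf : MemLp f (ENNReal.ofReal p) μ) (hg : MemLp g (ENNReal.ofReal p) μ)
    (h : ∫ x, ‖f x‖ ^ p ∂μ ≤ C * ∫ x, ‖g x‖ ^ p ∂μ) :
    eLpNorm f (ENNReal.ofReal p) μ ≤ ENNReal.ofReal (C ^ p⁻¹) * eLpNorm g (ENNReal.ofReal p) μ := by
  have h0 : ENNReal.ofReal p ≠ 0 := by simpa using hp
  rw [hf.eLpNorm_eq_integral_rpow_norm h0 ENNReal.ofReal_ne_top,
    hg.eLpNorm_eq_integral_rpow_norm h0 ENNReal.ofReal_ne_top, ENNReal.toReal_ofReal hp.le,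
    ← ENNReal.ofReal_mul (by positivity)]
  refine ENNReal.ofReal_le_ofReal ?_
  rw [← Real.mul_rpow hC (integral_nonneg fun _ => by positivity)]
  exact Real.rpow_le_rpow (integral_nonneg fun _ => by positivity) h (by positivity)

lemma norm_fderiv_le_sum (φ : Space N → ℝ) (x : Space N) :
    ‖fderiv ℝ φ x‖ ≤ ∑ i, ‖classicalDeriv [i] φ x‖ := by
  refine ContinuousLinearMap.opNorm_le_bound _ (Finset.sum_nonneg fun _ _ => norm_nonneg _) fun y => ?_
  have hy : y = ∑ i, y i • (EuclideanSpace.single i (1 : ℝ) : Space N) := by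
    ext j
    simp [Pi.single_apply]
  conv_lhs => rw [hy, map_sum]
  rw [Finset.sum_mul]
  refine (norm_sum_le _ _).trans (Finset.sum_le_sum fun i _ => ?_)
  rw [map_smul, norm_smul, mul_comm]
  exact mul_le_mul_of_nonneg_left (PiLp.norm_apply_le y i) (norm_nonneg _)

lemma exists_eLpNorm_le_first_order (hΩ : Bornology.IsBounded Ω) {p q : NNReal} (hp : 1 ≤ p)
    (hpN : (p : ℝ) < N) (hpq : (p : ℝ)⁻¹ - (N : ℝ)⁻¹ ≤ (q : ℝ)⁻¹) :
    ∃ C : NNReal, ∀ (φ : Space N → ℝ) (B : ℝ≥0∞), IsTestFunction Ω φ →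
      (∀ i, eLpNorm (classicalDeriv [i] φ) p volume ≤ B) → eLpNorm φ q volume ≤ C * B := by
  refine ⟨eLpNormLESNormFDerivOfLeConst ℝ (volume : Measure (Space N)) Ω p q * N,
    fun φ B hφ hB => ?_⟩
  have h1 := eLpNorm_le_eLpNorm_fderiv_of_le (volume : Measure (Space N)) (hφ.1.of_le (by norm_cast))
    hφ.support_subset hp (by
      rw [← NNReal.coe_lt_coe]; simpa using hpN) (by simpa using hpq) hΩ
  refine h1.trans ?_
  rw [ENNReal.coe_mul, mul_assoc]
  refine mul_le_mul_right ?_ _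
  have h2 : eLpNorm (fderiv ℝ φ) p volume ≤
      eLpNorm (fun x => ∑ i, ‖classicalDeriv [i] φ x‖) p volume :=
    eLpNorm_mono_real fun x => norm_fderiv_le_sum φ x
  refine h2.trans ?_
  have h3 : (fun x => ∑ i, ‖classicalDeriv [i] φ x‖) = ∑ i, fun x => ‖classicalDeriv [i] φ x‖ := by
    ext x; simp
  rw [h3]
  refine (eLpNorm_sum_le (fun i _ =>
    ((hφ.classicalDeriv [i]).1.continuous.norm.aestronglyMeasurable)) (by exact_mod_cast hp)).trans ?_
  refine (Finset.sum_le_card_nsmul _ _ B fun i _ => by rw [eLpNorm_norm]; exact hB i).trans ?_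
  simp

/-- Poincaré's inequality, iterated: boundedness of `Ω` allows equal exponents on both sides of the
first-order inequality. -/
lemma exists_eLpNorm_le_of_order (hΩ : Bornology.IsBounded Ω) {m : ℝ} (hm : 1 ≤ m)
    (hmN : m < N) (k : ℕ) :
    ∃ C : NNReal, ∀ (φ : Space N → ℝ) (B : ℝ≥0∞), IsTestFunction Ω φ →
      (∀ I : List (Fin N), I.length = k →
        eLpNorm (classicalDeriv I φ) (ENNReal.ofReal m) volume ≤ B) →
      eLpNorm φ (ENNReal.ofReal m) volume ≤ C * B := by
  induction k with
  | zero => exact ⟨1, fun φ B _ hB => by simpa [classicalDeriv] using hB [] rfl⟩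
  | succ k ih =>
    obtain ⟨C, hC⟩ := ih
    have hm' : ((Real.toNNReal m : NNReal) : ℝ) = m := Real.coe_toNNReal m (by linarith)
    obtain ⟨C', hC'⟩ := exists_eLpNorm_le_first_order hΩ (p := Real.toNNReal m)
      (q := Real.toNNReal m) (by simpa using hm) (by rw [hm']; exact hmN)
      (by rw [hm']; have : (0 : ℝ) ≤ (N : ℝ)⁻¹ := by positivity
          linarith)
    refine ⟨C' * C, fun φ B hφ hB => ?_⟩
    rw [ENNReal.coe_mul, mul_assoc]
    refine hC' φ (C * B) hφ fun i => hC _ B (hφ.classicalDeriv [i]) fun I hI => ?_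
    rw [← classicalDeriv_append]
    exact hB _ (by simp [hI])

/-- Each order gained lowers the reciprocal exponent by `1/N`: with `p_k = mN / (N - km)`, `1/p_k -
1/N = 1/p_{k+1}`. The condition `p_k < N` of the first-order step is `(k + 1) m < N`. -/
lemma exists_eLpNorm_le_of_order_sobolev (hΩ : Bornology.IsBounded Ω) {m : ℝ} (hm : 1 ≤ m) (k : ℕ)
    (hk : k * m < N) :
    ∃ C : NNReal, ∀ (φ : Space N → ℝ) (B : ℝ≥0∞), IsTestFunction Ω φ →
      (∀ I : List (Fin N), I.length = k →
        eLpNorm (classicalDeriv I φ) (ENNReal.ofReal m) volume ≤ B) →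
      eLpNorm φ (ENNReal.ofReal (m * N / (N - k * m))) volume ≤ C * B := by
  induction k with
  | zero =>
    have hN : (N : ℝ) ≠ 0 := by
      have : (0 : ℝ) < N := by simpa using hk
      exact this.ne'
    refine ⟨1, fun φ B _ hB => ?_⟩
    have := hB [] rfl
    simpa [hN, classicalDeriv] using this
  | succ k ih =>
    push_cast at hk
    obtain ⟨C, hC⟩ := ih (by nlinarith)
    have hN : (0 : ℝ) < N := by
      have : (0 : ℝ) ≤ k := Nat.cast_nonneg k
      nlinarith
    have hd : 0 < N - k * m := by nlinarith
    have hd' : 0 < N - (k + 1) * m := by nlinarith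
    set p : ℝ := m * N / (N - k * m) with hp
    set q : ℝ := m * N / (N - ((k + 1 : ℕ) : ℝ) * m) with hq
    have hp0 : 0 < p := by positivity
    have hp1 : 1 ≤ p := by
      rw [hp, le_div_iff₀ hd]
      have : (0 : ℝ) ≤ k * m := by positivity
      nlinarith
    have hpN : p < N := by
      rw [hp, div_lt_iff₀ hd]; nlinarith
    have hq' : q = m * N / (N - (k + 1) * m) := by rw [hq]; push_cast; rfl
    have hq0 : 0 < q := by rw [hq']; positivity
    obtain ⟨C', hC'⟩ := exists_eLpNorm_le_first_order hΩ (p := Real.toNNReal p)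
      (q := Real.toNNReal q) (by simpa using hp1) (by rw [Real.coe_toNNReal _ hp0.le]; exact hpN)
      (by
        rw [Real.coe_toNNReal _ hp0.le, Real.coe_toNNReal _ hq0.le, hp, hq']
        have hm0 : 0 < m := by linarith
        apply le_of_eq
        field_simp
        ring)
    refine ⟨C' * C, fun φ B hφ hB => ?_⟩
    rw [ENNReal.coe_mul, mul_assoc]
    refine hC' φ (C * B) hφ fun i => hC _ B (hφ.classicalDeriv [i]) fun I hI => ?_
    rw [← classicalDeriv_append]
    exact hB _ (by simp [hI])

lemma eLpNorm_restrict_of_support {F : Type*} [NormedAddCommGroup F] {f : Space N → F}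
    {p : ℝ≥0∞} (h : Function.support f ⊆ Ω) :
    eLpNorm f p (volume.restrict Ω) = eLpNorm f p volume :=
  eLpNorm_restrict_eq_of_support_subset h

/-- The a priori estimate: all derivatives of order at most `r`, and the function itself in the
critical Lebesgue space, are controlled by `D_r`. -/
theorem exists_apriori (hΩ : Bornology.IsBounded Ω) {r : ℕ} (hr : 1 ≤ r) {m : ℝ} (hm : 1 < m)
    (hN : r * m < N) :
    ∃ C : NNReal, ∀ φ : Space N → ℝ, IsTestFunction Ω φ →
      (∀ I : List (Fin N), I.length ≤ r →
        eLpNorm (classicalDeriv I φ) (ENNReal.ofReal m) (volume.restrict Ω) ≤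
          C * eLpNorm (classicalDr r φ) (ENNReal.ofReal m) (volume.restrict Ω)) ∧
      eLpNorm φ (ENNReal.ofReal (criticalExponent N r m)) (volume.restrict Ω) ≤
        C * eLpNorm (classicalDr r φ) (ENNReal.ofReal m) (volume.restrict Ω) := by
  have hm0 : 0 < m := by linarith
  have hmN : m < N := by
    have : (1 : ℝ) ≤ r := by exact_mod_cast hr
    nlinarith
  obtain ⟨C₀, hC₀, hC⟩ := exists_integral_classicalDeriv_le N r hm
  choose C₁ hC₁ using fun k => exists_eLpNorm_le_of_order hΩ hm.le hmN k
  obtain ⟨C₂, hC₂⟩ := exists_eLpNorm_le_of_order_sobolev hΩ hm.le r hN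
  set K : NNReal := Real.toNNReal (C₀ ^ m⁻¹)
  refine ⟨(∑ k ∈ Finset.range (r + 1), C₁ k + C₂) * K, fun φ hφ => ?_⟩
  have htop : ∀ I : List (Fin N), I.length = r →
      eLpNorm (classicalDeriv I φ) (ENNReal.ofReal m) volume ≤
        K * eLpNorm (classicalDr r φ) (ENNReal.ofReal m) volume := fun I hI =>
    eLpNorm_le_of_integral_le hm0 hC₀.le ((hφ.classicalDeriv I).memLp _ _)
      (memLp_classicalDr r hφ _ _) (hC Ω φ hφ I hI)
  rw [eLpNorm_restrict_of_support ((support_classicalDr_subset r hφ).trans hφ.2.2)]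
  constructor
  · intro I hI
    rw [eLpNorm_restrict_of_support (hφ.classicalDeriv I).support_subset]
    -- Poincaré's inequality supplies the `r - I.length` missing derivatives, after which only those
    -- of top order `r` have to be controlled.
    refine (hC₁ (r - I.length) _ (K * eLpNorm (classicalDr r φ) (ENNReal.ofReal m) volume)
      (hφ.classicalDeriv I) fun J hJ => ?_).trans ?_
    · rw [← classicalDeriv_append]
      exact htop _ (by simp [hJ, hI])
    · rw [← mul_assoc, ← ENNReal.coe_mul]
      refine mul_le_mul_left ?_ _
      refine ENNReal.coe_le_coe.2 (mul_le_mul_left ?_ _)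
      refine (Finset.single_le_sum (f := C₁) (fun _ _ => zero_le)
        (Finset.mem_range.2 (by omega : r - I.length < r + 1))).trans le_self_add
  · rw [eLpNorm_restrict_of_support hφ.support_subset]
    refine (hC₂ φ _ hφ htop).trans ?_
    rw [← mul_assoc, ← ENNReal.coe_mul]
    refine mul_le_mul_left ?_ _
    exact ENNReal.coe_le_coe.2 (mul_le_mul_left le_add_self _)

end

/-! ### Weak derivatives as limits of classical derivatives -/

section

variable {N : ℕ} {Ω : Set (Space N)} {φ ψ : Space N → ℝ}

lemma integral_mul_classicalDeriv (hφ : ContDiff ℝ ∞ φ) (hψ : IsTestFunction Ω ψ)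
    (hφc : HasCompactSupport φ) (I : List (Fin N)) :
    ∫ x, φ x * classicalDeriv I ψ x = (-1 : ℝ) ^ I.length * ∫ x, classicalDeriv I φ x * ψ x := by
  induction I generalizing φ with
  | nil => simp [classicalDeriv]
  | cons i I ih =>
    have hφt : IsTestFunction Set.univ φ := ⟨hφ, hφc, Set.subset_univ _⟩
    have hφi := hφt.classicalDeriv [i]
    have hψI := hψ.classicalDeriv I
    have h1 : ∫ x, φ x * classicalDeriv (i :: I) ψ x =
        - ∫ x, classicalDeriv [i] φ x * classicalDeriv I ψ x :=
      integral_mul_fderiv_eq_neg_fderiv_mul_of_integrable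
        (hφi.isCc.mul hψI.isCc).integrable
        (hφt.isCc.mul (hψ.classicalDeriv (i :: I)).isCc).integrable
        (hφt.isCc.mul hψI.isCc).integrable
        (fun x _ => hφ.differentiable (by simp) x) (fun x _ => hψI.1.differentiable (by simp) x)
    rw [h1, ih hφi.1 hφi.2.1, ← classicalDeriv_append,
      classicalDeriv_perm hφ (List.perm_append_comm : (I ++ [i]).Perm ([i] ++ I))]
    simp only [List.length_cons, pow_succ, List.singleton_append]
    ring

lemma setIntegral_mul_test (f : Space N → ℝ) (hψ : IsTestFunction Ω ψ) :
    ∫ x in Ω, f x * ψ x = ∫ x, f x * ψ x :=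
  setIntegral_eq_integral_of_forall_compl_eq_zero fun x hx => by
    have : ψ x = 0 := by
      by_contra h
      exact hx (hψ.support_subset h)
    rw [this, mul_zero]

lemma integrable_mul_test {f : Space N → ℝ} (hf : LocallyIntegrableOn f Ω)
    (hψ : IsTestFunction Ω ψ) : Integrable (fun x => f x * ψ x) := by
  have h1 : IntegrableOn f (tsupport ψ) :=
    hf.integrableOn_compact_subset hψ.2.2 hψ.2.1
  have h2 : IntegrableOn (fun x => f x * ψ x) (tsupport ψ) :=
    h1.mul_continuousOn hψ.1.continuous.continuousOn hψ.2.1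
  refine (integrableOn_iff_integrable_of_support_subset fun x hx => ?_).1 h2
  refine subset_tsupport ψ fun h => hx ?_
  simp [h]

/-- The fundamental lemma of the calculus of variations applied to `g - g'`. It frees later
arguments from the arbitrary choice in `weakDeriv`. -/
lemma IsWeakDeriv.ae_eq (hΩ : IsOpen Ω) {I : List (Fin N)} {u g g' : Space N → ℝ}
    (h : IsWeakDeriv Ω I u g) (h' : IsWeakDeriv Ω I u g') : g =ᵐ[volume.restrict Ω] g' := by
  have h1 := hΩ.ae_eq_zero_of_integral_contDiff_smul_eq_zero (μ := volume) (h.2.1.sub h'.2.1)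
    fun ψ h1 h2 h3 => by
      have hψ : IsTestFunction Ω ψ := ⟨h1, h2, h3⟩
      have e := (h.2.2 ψ hψ).symm.trans (h'.2.2 ψ hψ)
      rw [mul_right_inj' (by positivity), setIntegral_mul_test _ hψ, setIntegral_mul_test _ hψ] at e
      have : ∀ x, ψ x • (g - g') x = g x * ψ x - g' x * ψ x := fun x => by
        simp only [Pi.sub_apply, smul_eq_mul]; ring
      simp only [this]
      rw [integral_sub (integrable_mul_test h.2.1 hψ) (integrable_mul_test h'.2.1 hψ), e, sub_self]
  rw [Filter.EventuallyEq, ae_restrict_iff' hΩ.measurableSet]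
  filter_upwards [h1] with x hx hxΩ
  have := hx hxΩ
  simpa [sub_eq_zero] using this

lemma IsWeakDeriv.weakDeriv_ae_eq (hΩ : IsOpen Ω) {I : List (Fin N)} {u g : Space N → ℝ}
    (h : IsWeakDeriv Ω I u g) : weakDeriv Ω I u =ᵐ[volume.restrict Ω] g := by
  have hex : ∃ g, IsWeakDeriv Ω I u g := ⟨g, h⟩
  rw [weakDeriv, dif_pos hex]
  exact hex.choose_spec.ae_eq hΩ h

lemma isFiniteMeasure_restrict (hΩb : Bornology.IsBounded Ω) :
    IsFiniteMeasure (volume.restrict Ω) :=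
  ⟨by rw [Measure.restrict_apply_univ]; exact hΩb.measure_lt_top⟩

lemma MemLp.locallyIntegrableOn (hΩb : Bornology.IsBounded Ω) {f : Space N → ℝ} {p : ℝ≥0∞}
    (hp : 1 ≤ p) (hf : MemLp f p (volume.restrict Ω)) : LocallyIntegrableOn f Ω := by
  have := isFiniteMeasure_restrict hΩb
  have h1 : IntegrableOn f Ω := hf.integrable hp
  exact h1.locallyIntegrableOn

lemma tendsto_eLpNorm_of_le {α F : Type*} [MeasurableSpace α] {μ : Measure α} [IsFiniteMeasure μ]
    [NormedAddCommGroup F] {f : ℕ → α → F} (hf : ∀ n, AEStronglyMeasurable (f n) μ) {p q : ℝ≥0∞}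
    (hpq : p ≤ q) (hp : p ≠ 0) (h : Tendsto (fun n => eLpNorm (f n) q μ) atTop (𝓝 0)) :
    Tendsto (fun n => eLpNorm (f n) p μ) atTop (𝓝 0) := by
  rcases eq_or_ne p ⊤ with rfl | hpt
  · rwa [top_le_iff.1 hpq] at h
  have hexp : 0 ≤ 1 / p.toReal - 1 / q.toReal := by
    rcases eq_or_ne q ⊤ with rfl | hqt
    · simp
    · have h1 : p.toReal ≤ q.toReal := (ENNReal.toReal_le_toReal hpt hqt).2 hpq
      have h2 : 0 < p.toReal := ENNReal.toReal_pos hp hpt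
      have := one_div_le_one_div_of_le h2 h1
      linarith
  have hC : μ Set.univ ^ (1 / p.toReal - 1 / q.toReal) ≠ ⊤ :=
    ENNReal.rpow_ne_top_of_nonneg hexp (measure_ne_top _ _)
  have h1 := ENNReal.Tendsto.mul_const h (Or.inr hC)
  rw [zero_mul] at h1
  exact tendsto_of_tendsto_of_tendsto_of_le_of_le tendsto_const_nhds h1 (fun _ => zero_le)
    fun n => eLpNorm_le_eLpNorm_mul_rpow_measure_univ hpq (hf n)

lemma tendsto_setIntegral_mul_test (hΩb : Bornology.IsBounded Ω) {p : ℝ≥0∞} (hp : 1 ≤ p)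
    {f : ℕ → Space N → ℝ} {g : Space N → ℝ} (hf : ∀ n, MemLp (f n) p (volume.restrict Ω))
    (hg : MemLp g p (volume.restrict Ω)) (hψ : IsTestFunction Ω ψ)
    (h : Tendsto (fun n => eLpNorm (fun x => g x - f n x) p (volume.restrict Ω)) atTop (𝓝 0)) :
    Tendsto (fun n => ∫ x in Ω, f n x * ψ x) atTop (𝓝 (∫ x in Ω, g x * ψ x)) := by
  have := isFiniteMeasure_restrict hΩb
  obtain ⟨M, -, hM0, hM, -⟩ := hψ.isCc.exists_bound
  have h1 := tendsto_eLpNorm_of_le (fun n => (hg.sub (hf n)).1) hp one_ne_zero h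
  refine tendsto_integral_of_L1' _ (hg.1.mul hψ.1.continuous.aestronglyMeasurable)
    (Eventually.of_forall fun n =>
      (integrable_mul_test (MemLp.locallyIntegrableOn hΩb hp (hf n)) hψ).restrict) ?_
  have h2 : ∀ n, eLpNorm ((fun x => f n x * ψ x) - fun x => g x * ψ x) 1 (volume.restrict Ω) ≤
      ENNReal.ofReal M * eLpNorm (fun x => g x - f n x) 1 (volume.restrict Ω) := by
    intro n
    refine eLpNorm_le_mul_eLpNorm_of_ae_le_mul (ae_of_all _ fun x => ?_) 1
    simp only [Pi.sub_apply, ← sub_mul]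
    rw [norm_mul, mul_comm, norm_sub_rev]
    exact mul_le_mul_of_nonneg_right (hM x) (norm_nonneg _)
  have h3 := ENNReal.Tendsto.const_mul (a := ENNReal.ofReal M) h1 (Or.inr ENNReal.ofReal_ne_top)
  rw [mul_zero] at h3
  exact tendsto_of_tendsto_of_tendsto_of_le_of_le tendsto_const_nhds h3 (fun _ => zero_le) h2

/-- Integration by parts holds for each test function `φ n`, and both of its sides are continuous in
`L^p` when paired with a fixed test function. -/
lemma isWeakDeriv_of_tendsto (hΩb : Bornology.IsBounded Ω) {p : ℝ≥0∞} (hp : 1 ≤ p)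
    {φ : ℕ → Space N → ℝ} (hφ : ∀ n, IsTestFunction Ω (φ n)) {u g : Space N → ℝ}
    (hu : MemLp u p (volume.restrict Ω)) (hg : MemLp g p (volume.restrict Ω)) {I : List (Fin N)}
    (h1 : Tendsto (fun n => eLpNorm (fun x => u x - φ n x) p (volume.restrict Ω)) atTop (𝓝 0))
    (h2 : Tendsto (fun n => eLpNorm (fun x => g x - classicalDeriv I (φ n) x) p
      (volume.restrict Ω)) atTop (𝓝 0)) : IsWeakDeriv Ω I u g := by
  have := isFiniteMeasure_restrict hΩb
  refine ⟨MemLp.locallyIntegrableOn hΩb hp hu, MemLp.locallyIntegrableOn hΩb hp hg,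
    fun ψ hψ => ?_⟩
  have l1 := tendsto_setIntegral_mul_test hΩb hp (fun n => (hφ n).memLp p _) hu
    (hψ.classicalDeriv I) h1
  have l2 := (tendsto_setIntegral_mul_test hΩb hp
    (fun n => ((hφ n).classicalDeriv I).memLp p _) hg hψ h2).const_mul ((-1 : ℝ) ^ I.length)
  refine tendsto_nhds_unique l1 (l2.congr fun n => ?_)
  rw [setIntegral_mul_test _ hψ, setIntegral_mul_test _ (hψ.classicalDeriv I),
    integral_mul_classicalDeriv (hφ n).1 hψ (hφ n).2.1]

lemma ae_eq_of_tendsto_eLpNorm {α F : Type*} [MeasurableSpace α] {μ : Measure α}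
    [NormedAddCommGroup F] {p : ℝ≥0∞} (hp : 1 ≤ p) {f : ℕ → α → F} {g h : α → F}
    (hf : ∀ n, MemLp (f n) p μ) (hg : MemLp g p μ) (hh : MemLp h p μ)
    (h1 : Tendsto (fun n => eLpNorm (fun x => g x - f n x) p μ) atTop (𝓝 0))
    (h2 : Tendsto (fun n => eLpNorm (fun x => h x - f n x) p μ) atTop (𝓝 0)) : g =ᵐ[μ] h := by
  have h3 : ∀ n, eLpNorm (g - h) p μ ≤
      eLpNorm (fun x => g x - f n x) p μ + eLpNorm (fun x => h x - f n x) p μ := by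
    intro n
    have e : g - h = (fun x => g x - f n x) - (fun x => h x - f n x) := by
      ext x; simp
    rw [e]
    exact eLpNorm_sub_le (hg.sub (hf n)).1 (hh.sub (hf n)).1 hp
  have h4 := ge_of_tendsto' (h1.add h2) h3
  rw [add_zero, nonpos_iff_eq_zero, eLpNorm_eq_zero_iff (hg.sub hh).1 (by
    intro h; rw [h] at hp; simp at hp)] at h4
  filter_upwards [h4] with x hx
  simpa [sub_eq_zero] using hx

/-! ### Approximation by test functions and the weak `D_r` -/

/-- The test functions `φ n` converge to `u` in `L^m` with all derivatives of order at most `r`. -/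
structure Approx (Ω : Set (Space N)) (r : ℕ) (m : ℝ) (u : Space N → ℝ) (φ : ℕ → Space N → ℝ) :
    Prop where
  test : ∀ n, IsTestFunction Ω (φ n)
  memLp_self : MemLp u (ENNReal.ofReal m) (volume.restrict Ω)
  isWeakDeriv : ∀ I : List (Fin N), I.length ≤ r → IsWeakDeriv Ω I u (weakDeriv Ω I u)
  memLp : ∀ I : List (Fin N), I.length ≤ r →
    MemLp (weakDeriv Ω I u) (ENNReal.ofReal m) (volume.restrict Ω)
  tendsto : ∀ I : List (Fin N), I.length ≤ r →
    Tendsto (fun n => eLpNorm (fun x => weakDeriv Ω I u x - classicalDeriv I (φ n) x)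
        (ENNReal.ofReal m) (volume.restrict Ω)) atTop (𝓝 0)

lemma isWeakDeriv_weakDeriv {I : List (Fin N)} {u g : Space N → ℝ} (h : IsWeakDeriv Ω I u g) :
    IsWeakDeriv Ω I u (weakDeriv Ω I u) := by
  have hex : ∃ g, IsWeakDeriv Ω I u g := ⟨g, h⟩
  rw [weakDeriv, dif_pos hex]
  exact hex.choose_spec

/-- This is how `Approx` gets verified: `L^m` limits of the classical derivatives are automatically
the weak derivatives of the limit. -/
lemma approx_of_tendsto (hΩ : IsOpen Ω) (hΩb : Bornology.IsBounded Ω) {r : ℕ} {m : ℝ} (hm : 1 ≤ m)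
    {φ : ℕ → Space N → ℝ} (hφ : ∀ n, IsTestFunction Ω (φ n)) {u : Space N → ℝ}
    {g : List (Fin N) → Space N → ℝ} (hu : u =ᵐ[volume.restrict Ω] g [])
    (hg : ∀ I : List (Fin N), I.length ≤ r →
      MemLp (g I) (ENNReal.ofReal m) (volume.restrict Ω) ∧
      Tendsto (fun n => eLpNorm (fun x => g I x - classicalDeriv I (φ n) x)
        (ENNReal.ofReal m) (volume.restrict Ω)) atTop (𝓝 0)) :
    Approx Ω r m u φ ∧ ∀ I : List (Fin N), I.length ≤ r →
      weakDeriv Ω I u =ᵐ[volume.restrict Ω] g I := by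
  have hp : 1 ≤ ENNReal.ofReal m := by simpa using hm
  have hu' : MemLp u (ENNReal.ofReal m) (volume.restrict Ω) :=
    (memLp_congr_ae hu).2 (hg [] (by simp)).1
  have hu2 : Tendsto (fun n => eLpNorm (fun x => u x - φ n x)
        (ENNReal.ofReal m) (volume.restrict Ω)) atTop (𝓝 0) := by
    refine (hg [] (by simp)).2.congr fun n => eLpNorm_congr_ae ?_
    filter_upwards [hu] with x hx
    rw [hx]; rfl
  have hw : ∀ I : List (Fin N), I.length ≤ r → IsWeakDeriv Ω I u (g I) := fun I hI =>
    isWeakDeriv_of_tendsto hΩb hp hφ hu' (hg I hI).1 hu2 (hg I hI).2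
  have he : ∀ I : List (Fin N), I.length ≤ r → weakDeriv Ω I u =ᵐ[volume.restrict Ω] g I :=
    fun I hI => (hw I hI).weakDeriv_ae_eq hΩ
  refine ⟨⟨hφ, hu', fun I hI => isWeakDeriv_weakDeriv (hw I hI),
    fun I hI => (memLp_congr_ae (he I hI)).2 (hg I hI).1,
    fun I hI => (hg I hI).2.congr fun n => eLpNorm_congr_ae ?_⟩, he⟩
  filter_upwards [he I hI] with x hx
  rw [hx]

lemma Approx.weakDeriv_nil (hΩ : IsOpen Ω) (hΩb : Bornology.IsBounded Ω) {r : ℕ} {m : ℝ}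
    (hm : 1 ≤ m) {φ : ℕ → Space N → ℝ} {u : Space N → ℝ} (h : Approx Ω r m u φ) :
    weakDeriv Ω [] u =ᵐ[volume.restrict Ω] u := by
  refine IsWeakDeriv.weakDeriv_ae_eq hΩ ?_
  have := MemLp.locallyIntegrableOn hΩb (by simpa using hm) h.memLp_self
  exact ⟨this, this, fun ψ _ => by simp [classicalDeriv]⟩

lemma Approx.tendsto_self (hΩ : IsOpen Ω) (hΩb : Bornology.IsBounded Ω) {r : ℕ} {m : ℝ}
    (hm : 1 ≤ m) {φ : ℕ → Space N → ℝ} {u : Space N → ℝ} (h : Approx Ω r m u φ) :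
    Tendsto (fun n => eLpNorm (fun x => u x - φ n x)
        (ENNReal.ofReal m) (volume.restrict Ω)) atTop (𝓝 0) := by
  refine (h.tendsto [] (by simp)).congr fun n => eLpNorm_congr_ae ?_
  filter_upwards [h.weakDeriv_nil hΩ hΩb hm] with x hx
  rw [hx]; rfl

lemma mem_sobolevZero_iff (hΩ : IsOpen Ω) {r : ℕ} {m : ℝ} {u : LmSpace Ω m} :
    u ∈ sobolevZero Ω r m ↔ ∃ φ, Approx Ω r m u φ := by
  constructor
  · rintro ⟨h1, φ, hφ, h2⟩
    refine ⟨φ, hφ, Lp.memLp u, fun I hI => ?_, fun I hI => ?_, h2⟩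
    · obtain ⟨g, hg, -⟩ := h1 I hI
      exact isWeakDeriv_weakDeriv hg
    · obtain ⟨g, hg, hg'⟩ := h1 I hI
      exact (memLp_congr_ae (hg.weakDeriv_ae_eq hΩ)).2 hg'
  · rintro ⟨φ, h⟩
    exact ⟨fun I hI => ⟨_, h.isWeakDeriv I hI, h.memLp I hI⟩, φ, h.test, h.tendsto⟩

lemma tendsto_eLpNorm_add {α F : Type*} [MeasurableSpace α] {μ : Measure α}
    [NormedAddCommGroup F] {p : ℝ≥0∞} (hp : 1 ≤ p) {f f' : ℕ → α → F}
    (hf : ∀ n, AEStronglyMeasurable (f n) μ) (hf' : ∀ n, AEStronglyMeasurable (f' n) μ)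
    (h : Tendsto (fun n => eLpNorm (f n) p μ) atTop (𝓝 0))
    (h' : Tendsto (fun n => eLpNorm (f' n) p μ) atTop (𝓝 0)) :
    Tendsto (fun n => eLpNorm (f n + f' n) p μ) atTop (𝓝 0) := by
  have h3 := h.add h'
  rw [add_zero] at h3
  exact tendsto_of_tendsto_of_tendsto_of_le_of_le tendsto_const_nhds h3 (fun _ => zero_le)
    fun n => eLpNorm_add_le (hf n) (hf' n) hp

lemma tendsto_eLpNorm_sum {α F κ : Type*} [MeasurableSpace α] {μ : Measure α}
    [NormedAddCommGroup F] {p : ℝ≥0∞} (hp : 1 ≤ p) (s : Finset κ) {f : κ → ℕ → α → F}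
    (hf : ∀ k n, AEStronglyMeasurable (f k n) μ)
    (h : ∀ k, Tendsto (fun n => eLpNorm (f k n) p μ) atTop (𝓝 0)) :
    Tendsto (fun n => eLpNorm (∑ k ∈ s, f k n) p μ) atTop (𝓝 0) := by
  classical
  induction s using Finset.induction_on with
  | empty => simp
  | insert a s ha ih =>
    simp only [Finset.sum_insert ha]
    exact tendsto_eLpNorm_add hp (hf a) (fun n => Finset.aestronglyMeasurable_sum _ fun k _ => hf k n)
      (h a) ih

lemma Approx.add_smul (hΩ : IsOpen Ω) (hΩb : Bornology.IsBounded Ω) {r : ℕ} {m : ℝ} (hm : 1 ≤ m)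
    {φ ψ : ℕ → Space N → ℝ} {u v w : Space N → ℝ} (hu : Approx Ω r m u φ) (hv : Approx Ω r m v ψ)
    (c : ℝ) (hw : w =ᵐ[volume.restrict Ω] u + c • v) :
    Approx Ω r m w (fun n => φ n + c • ψ n) := by
  have hp : 1 ≤ ENNReal.ofReal m := by simpa using hm
  refine (approx_of_tendsto hΩ hΩb hm (fun n => (hu.test n).add ((hv.test n).const_smul c))
    (g := fun I => weakDeriv Ω I u + c • weakDeriv Ω I v) ?_ fun I hI =>
      ⟨(hu.memLp I hI).add ((hv.memLp I hI).const_smul c), ?_⟩).1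
  · filter_upwards [hw, hu.weakDeriv_nil hΩ hΩb hm, hv.weakDeriv_nil hΩ hΩb hm] with x h1 h2 h3
    simp [h1, h2, h3]
  · have m1 := fun n => ((hu.memLp I hI).sub (((hu.test n).classicalDeriv I).memLp
      (ENNReal.ofReal m) (volume.restrict Ω))).1
    have m2 := fun n => ((hv.memLp I hI).sub (((hv.test n).classicalDeriv I).memLp
      (ENNReal.ofReal m) (volume.restrict Ω))).1
    have h3 : Tendsto (fun n => eLpNorm (c • fun x => weakDeriv Ω I v x - classicalDeriv I (ψ n) x)
        (ENNReal.ofReal m) (volume.restrict Ω)) atTop (𝓝 0) := by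
      simp only [eLpNorm_const_smul]
      have := ENNReal.Tendsto.const_mul (a := ‖c‖ₑ) (hv.tendsto I hI) (Or.inr enorm_ne_top)
      rwa [mul_zero] at this
    refine (tendsto_eLpNorm_add hp m1 (fun n => (m2 n).const_smul c) (hu.tendsto I hI) h3).congr
      fun n => ?_
    congr 1
    ext x
    rw [classicalDeriv_add (hu.test n).1 ((hv.test n).const_smul c).1,
      classicalDeriv_const_smul c (hv.test n).1]
    simp only [Pi.add_apply, Pi.smul_apply, smul_eq_mul, Pi.sub_apply]
    ring

/-- The classical Laplacians of the approximants serve as approximants, at a cost of two orders.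
Iterating this gives meaning to nested weak Laplacians, each of which involves a fresh choice of
representative. -/
lemma Approx.weakLaplacian (hΩ : IsOpen Ω) (hΩb : Bornology.IsBounded Ω) {r : ℕ} {m : ℝ}
    (hm : 1 ≤ m) {φ : ℕ → Space N → ℝ} {u : Space N → ℝ} (hu : Approx Ω (r + 2) m u φ) :
    Approx Ω r m (weakLaplacian Ω u) (fun n => classicalLaplacian (φ n)) := by
  have hp : 1 ≤ ENNReal.ofReal m := by simpa using hm
  refine (approx_of_tendsto hΩ hΩb hm (fun n => (hu.test n).classicalLaplacian)
    (g := fun I => ∑ i, weakDeriv Ω (I ++ [i, i]) u) ?_ fun I hI => ?_).1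
  · refine Eventually.of_forall fun x => ?_
    simp [Kirchhoff.weakLaplacian]
  · have hI' : ∀ i, (I ++ [i, i]).length ≤ r + 2 := fun i => by simpa using hI
    refine ⟨memLp_finsetSum' _ fun i _ => hu.memLp _ (hI' i), ?_⟩
    refine (tendsto_eLpNorm_sum hp Finset.univ (f := fun i n x => weakDeriv Ω (I ++ [i, i]) u x -
      classicalDeriv (I ++ [i, i]) (φ n) x) (fun i n => ((hu.memLp _ (hI' i)).sub
        (((hu.test n).classicalDeriv _).memLp (ENNReal.ofReal m) (volume.restrict Ω))).1)
      fun i => hu.tendsto _ (hI' i)).congr fun n => ?_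
    congr 1
    ext x
    rw [classicalDeriv_classicalLaplacian (hu.test n).1]
    simp [Finset.sum_apply, Finset.sum_sub_distrib]

lemma Approx.iterate_weakLaplacian (hΩ : IsOpen Ω) (hΩb : Bornology.IsBounded Ω) {r : ℕ} {m : ℝ}
    (hm : 1 ≤ m) (k : ℕ) {φ : ℕ → Space N → ℝ} {u : Space N → ℝ}
    (hu : Approx Ω (r + 2 * k) m u φ) :
    Approx Ω r m ((Kirchhoff.weakLaplacian Ω)^[k] u) (fun n => classicalLaplacian^[k] (φ n)) := by
  induction k generalizing u φ with
  | zero => exact hu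
  | succ k ih => exact ih (hu.weakLaplacian hΩ hΩb hm (r := r + 2 * k))

/-- The weak `D_r u`. -/
def weakDr (Ω : Set (Space N)) (r : ℕ) (u : Space N → ℝ) (x : Space N) : DrSpace N :=
  drVec r ((weakLaplacian Ω)^[r / 2] u x) fun i => weakDeriv Ω [i] ((weakLaplacian Ω)^[r / 2] u) x

lemma norm_weakDr (r : ℕ) (u : Space N → ℝ) (x : Space N) : ‖weakDr Ω r u x‖ = DrAbs Ω r u x := by
  rw [EuclideanSpace.norm_eq, Fintype.sum_option]
  by_cases h : Even r
  · simp [weakDr, drVec, DrAbs, h, Real.sqrt_sq_eq_abs]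
  · simp [weakDr, drVec, DrAbs, h, weakGrad, EuclideanSpace.norm_eq]

lemma inner_weakDr (r : ℕ) (u v : Space N → ℝ) (x : Space N) :
    inner ℝ (weakDr Ω r u x) (weakDr Ω r v x) = DrInner Ω r u v x := by
  rw [PiLp.inner_apply, Fintype.sum_option]
  by_cases h : Even r
  · simp [weakDr, drVec, DrInner, h, mul_comm]
  · simp [weakDr, drVec, DrInner, h, weakGrad, PiLp.inner_apply]

lemma drVec_sub (r : ℕ) (a a' : ℝ) (b b' : Fin N → ℝ) :
    drVec r a b - drVec r a' b' = drVec r (a - a') (b - b') := by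
  ext o
  cases o <;> by_cases h : Even r <;> simp [drVec, h]

/-- Measurability of the gradient entries is asked for odd `r` only: for even `r` they are not part
of `D_r`, and the corresponding weak derivatives need not exist. -/
lemma eLpNorm_drVec_le {p : ℝ≥0∞} (hp : 1 ≤ p) (r : ℕ) {μ : Measure (Space N)} {a : Space N → ℝ}
    {b : Fin N → Space N → ℝ} (hb : ¬ Even r → ∀ i, AEStronglyMeasurable (b i) μ) :
    eLpNorm (fun x => drVec r (a x) fun i => b i x) p μ ≤
      (if Even r then eLpNorm a p μ else 0) + ∑ i, if Even r then 0 else eLpNorm (b i) p μ := by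
  by_cases h : Even r
  · simp only [h, if_true]
    refine (eLpNorm_mono (g := a) fun x => ?_).trans le_self_add
    simpa [h] using norm_drVec_le r (a x) fun i => b i x
  · simp only [h, if_false, zero_add]
    have h1 : eLpNorm (fun x => drVec r (a x) fun i => b i x) p μ ≤
        eLpNorm (∑ i, fun x => ‖b i x‖) p μ := by
      refine eLpNorm_mono_real fun x => ?_
      simpa [h] using norm_drVec_le r (a x) fun i => b i x
    refine h1.trans ((eLpNorm_sum_le (fun i _ => (hb h i).norm) hp).trans (le_of_eq ?_))
    simp only [eLpNorm_norm]

lemma aestronglyMeasurable_drVec (r : ℕ) {μ : Measure (Space N)} {a : Space N → ℝ}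
    {b : Fin N → Space N → ℝ} (ha : Even r → AEStronglyMeasurable a μ)
    (hb : ¬ Even r → ∀ i, AEStronglyMeasurable (b i) μ) :
    AEStronglyMeasurable (fun x => drVec r (a x) fun i => b i x) μ := by
  unfold drVec
  refine (PiLp.continuous_toLp 2 _).comp_aestronglyMeasurable ?_
  refine AEMeasurable.aestronglyMeasurable (aemeasurable_pi_lambda _ fun o => ?_)
  cases o <;> by_cases h : Even r <;> simp only [h, if_true, if_false, Option.elim]
  · exact (ha h).aemeasurable
  · exact aemeasurable_const
  · exact aemeasurable_const
  · exact (hb h _).aemeasurable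

lemma Approx.weakDr (hΩ : IsOpen Ω) (hΩb : Bornology.IsBounded Ω) {r : ℕ} {m : ℝ}
    (hm : 1 ≤ m) {φ : ℕ → Space N → ℝ} {u : Space N → ℝ} (hu : Approx Ω r m u φ) :
    MemLp (weakDr Ω r u) (ENNReal.ofReal m) (volume.restrict Ω) ∧
    Tendsto (fun n => eLpNorm (fun x => Kirchhoff.weakDr Ω r u x - classicalDr r (φ n) x)
        (ENNReal.ofReal m) (volume.restrict Ω)) atTop (𝓝 0) := by
  have hp : 1 ≤ ENNReal.ofReal m := by simpa using hm
  -- After `r / 2` Laplacians, `r % 2` orders of differentiability remain: none for even `r`, and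
  -- the one needed by the gradient for odd `r`.
  have hr : r = r % 2 + 2 * (r / 2) := by omega
  have hu' : Approx Ω (r % 2 + 2 * (r / 2)) m u φ := by rwa [← hr]
  have hL := hu'.iterate_weakLaplacian hΩ hΩb hm
  set w := (Kirchhoff.weakLaplacian Ω)^[r / 2] u with hw
  have hodd : ¬ Even r → ∀ i : Fin N, [i].length ≤ r % 2 := fun h i => by
    have : r % 2 = 1 := Nat.odd_iff.1 (Nat.not_even_iff_odd.1 h)
    simp [this]
  have hself := hL.tendsto_self hΩ hΩb hm
  have ha : AEStronglyMeasurable w (volume.restrict Ω) := hL.memLp_self.1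
  constructor
  · refine ⟨aestronglyMeasurable_drVec r (fun _ => ha) fun h i => (hL.memLp [i] (hodd h i)).1, ?_⟩
    refine (eLpNorm_drVec_le hp r fun h i => (hL.memLp [i] (hodd h i)).1).trans_lt ?_
    by_cases h : Even r
    · simpa [h] using hL.memLp_self.2
    · simpa [h] using fun i => (hL.memLp [i] (hodd h i)).2
  · have m2 := fun (h : ¬ Even r) i n => ((hL.memLp [i] (hodd h i)).sub
      (((hL.test n).classicalDeriv [i]).memLp (ENNReal.ofReal m) (volume.restrict Ω))).1
    refine tendsto_of_tendsto_of_tendsto_of_le_of_le tendsto_const_nhds ?_ (fun _ => zero_le)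
      fun n => (le_of_eq (congrArg (fun f => eLpNorm f _ _) (funext fun x => ?_))).trans
        (eLpNorm_drVec_le (a := w - classicalLaplacian^[r / 2] (φ n)) hp r fun h i => m2 h i n)
    · by_cases h : Even r
      · simp only [h, if_true, Finset.sum_const_zero, add_zero]
        exact hself
      · simp only [h, if_false, zero_add]
        have := tendsto_finsetSum (Finset.univ : Finset (Fin N)) fun i _ =>
          hL.tendsto [i] (hodd h i)
        rw [Finset.sum_const_zero] at this
        exact this
    · exact drVec_sub _ _ _ _ _

/-- Since weak derivatives are chosen representatives, linearity holds only almost everywhere. Both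
sides are `L^m` limits of the same classical sequence. -/
lemma weakDr_add_smul_ae (hΩ : IsOpen Ω) (hΩb : Bornology.IsBounded Ω) {r : ℕ} {m : ℝ} (hm : 1 ≤ m)
    {φ ψ : ℕ → Space N → ℝ} {u v w : Space N → ℝ} (hu : Approx Ω r m u φ) (hv : Approx Ω r m v ψ)
    (c : ℝ) (hw : w =ᵐ[volume.restrict Ω] u + c • v) :
    weakDr Ω r w =ᵐ[volume.restrict Ω] fun x => weakDr Ω r u x + c • weakDr Ω r v x := by
  have hp : 1 ≤ ENNReal.ofReal m := by simpa using hm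
  have hW := hu.add_smul hΩ hΩb hm hv c hw
  obtain ⟨w1, w2⟩ := hW.weakDr hΩ hΩb hm
  obtain ⟨u1, u2⟩ := hu.weakDr hΩ hΩb hm
  obtain ⟨v1, v2⟩ := hv.weakDr hΩ hΩb hm
  refine ae_eq_of_tendsto_eLpNorm hp (fun n => memLp_classicalDr r (hW.test n) _ _) w1
    (u1.add (v1.const_smul c)) w2 ?_
  have m1 := fun n => (u1.sub (memLp_classicalDr r (hu.test n)
    (ENNReal.ofReal m) (volume.restrict Ω))).1
  have m2 := fun n => (v1.sub (memLp_classicalDr r (hv.test n)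
    (ENNReal.ofReal m) (volume.restrict Ω))).1
  have h3 : Tendsto (fun n => eLpNorm (c • fun x => weakDr Ω r v x - classicalDr r (ψ n) x)
      (ENNReal.ofReal m) (volume.restrict Ω)) atTop (𝓝 0) := by
    simp only [eLpNorm_const_smul]
    have := ENNReal.Tendsto.const_mul (a := ‖c‖ₑ) v2 (Or.inr enorm_ne_top)
    rwa [mul_zero] at this
  refine (tendsto_eLpNorm_add hp m1 (fun n => (m2 n).const_smul c) u2 h3).congr fun n => ?_
  congr 1
  ext1 x
  rw [classicalDr_add r (hu.test n) ((hv.test n).const_smul c),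
    classicalDr_const_smul r c (hv.test n)]
  simp only [Pi.add_apply, Pi.smul_apply, Pi.sub_apply]
  module

end

/-! ### Compactness -/

section

variable {N : ℕ} {Ω : Set (Space N)} {φ ψ : Space N → ℝ}

/-- The increment is the integral of the derivative along the segment; Tonelli's theorem and
translation invariance do the rest. -/
lemma lintegral_translate_sub_le (hφ : ContDiff ℝ ∞ φ) (w : Space N) :
    ∫⁻ x, ‖φ x - φ (x + w)‖ₑ ≤ ‖w‖ₑ * ∫⁻ x, ‖fderiv ℝ φ x‖ₑ := by
  have hc : Continuous (fderiv ℝ φ) := hφ.continuous_fderiv (by simp)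
  have h1 : ∀ x, ‖φ x - φ (x + w)‖ₑ ≤
      ∫⁻ t in Set.Ioc (0 : ℝ) 1, ‖w‖ₑ * ‖fderiv ℝ φ (x + t • w)‖ₑ := by
    intro x
    have hd : ∀ t ∈ Set.uIcc (0 : ℝ) 1, HasDerivAt (fun t : ℝ => φ (x + t • w))
        (fderiv ℝ φ (x + t • w) w) t := fun t _ => by
      have hline : HasDerivAt (fun t : ℝ => x + t • w) w t := by
        simpa using ((hasDerivAt_id t).smul_const w).const_add x
      exact (hφ.differentiable (by simp) (x + t • w)).hasFDerivAt.comp_hasDerivAt t hline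
    have hcont : Continuous fun t : ℝ => fderiv ℝ φ (x + t • w) w := by fun_prop
    have h2 := intervalIntegral.integral_eq_sub_of_hasDerivAt hd (hcont.intervalIntegrable 0 1)
    simp only [one_smul, zero_smul, add_zero] at h2
    rw [← enorm_neg, neg_sub, ← h2, intervalIntegral.integral_of_le zero_le_one]
    refine (enorm_integral_le_lintegral_enorm _).trans (lintegral_mono fun t => ?_)
    rw [mul_comm]
    exact ContinuousLinearMap.le_opENorm _ _
  have hmeas : Measurable fun z : Space N × ℝ => ‖w‖ₑ * ‖fderiv ℝ φ (z.1 + z.2 • w)‖ₑ := by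
    have : Continuous fun z : Space N × ℝ => fderiv ℝ φ (z.1 + z.2 • w) := by fun_prop
    exact this.measurable.enorm.const_mul _
  calc ∫⁻ x, ‖φ x - φ (x + w)‖ₑ
      ≤ ∫⁻ x, ∫⁻ t in Set.Ioc (0 : ℝ) 1, ‖w‖ₑ * ‖fderiv ℝ φ (x + t • w)‖ₑ := lintegral_mono h1
    _ = ∫⁻ t in Set.Ioc (0 : ℝ) 1, ∫⁻ x, ‖w‖ₑ * ‖fderiv ℝ φ (x + t • w)‖ₑ :=
      lintegral_lintegral_swap hmeas.aemeasurable
    _ = ∫⁻ t in Set.Ioc (0 : ℝ) 1, ‖w‖ₑ * ∫⁻ x, ‖fderiv ℝ φ x‖ₑ := by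
      refine lintegral_congr fun t => ?_
      rw [lintegral_const_mul _ (by fun_prop),
        lintegral_add_right_eq_self (fun x => ‖fderiv ℝ φ x‖ₑ) (t • w)]
    _ = ‖w‖ₑ * ∫⁻ x, ‖fderiv ℝ φ x‖ₑ := by simp

/-- The index of a point of a dense sequence at distance less than `h` from `x`. -/
def nearIndex {h : ℝ} (hh : 0 < h) (x : Space N) : ℕ :=
  open Classical in
  Nat.find (p := fun j => dist x (TopologicalSpace.denseSeq (Space N) j) < h)
    ((TopologicalSpace.denseRange_denseSeq (Space N)).exists_dist_lt x hh)

lemma dist_nearIndex {h : ℝ} (hh : 0 < h) (x : Space N) :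
    dist x (TopologicalSpace.denseSeq (Space N) (nearIndex hh x)) < h := by
  classical
  exact Nat.find_spec (p := fun j => dist x (TopologicalSpace.denseSeq (Space N) j) < h)
    ((TopologicalSpace.denseRange_denseSeq (Space N)).exists_dist_lt x hh)

lemma measurable_nearIndex {h : ℝ} (hh : 0 < h) : Measurable (nearIndex (N := N) hh) := by
  classical
  refine measurable_find
    (fun x => (TopologicalSpace.denseRange_denseSeq (Space N)).exists_dist_lt x hh) fun j => ?_
  exact measurableSet_ball (x := TopologicalSpace.denseSeq (Space N) j) (ε := h)

/-- The average of `φ` over the ball of radius `h` around the `j`-th point of a dense sequence. -/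
def ballAverage (h : ℝ) (φ : Space N → ℝ) (j : ℕ) : ℝ :=
  ⨍ y in Metric.ball (TopologicalSpace.denseSeq (Space N) j) h, φ y

/-- The chosen centre is within `h` of `x`, so its ball of radius `h` lies in the ball of radius
`2h` around `x`, and the bound becomes translation invariant. -/
lemma enorm_sub_ballAverage_le (hφ : IsCc φ) {h : ℝ} (hh : 0 < h) (x : Space N) :
    ‖φ x - ballAverage h φ (nearIndex hh x)‖ₑ ≤ (volume (Metric.ball (0 : Space N) h))⁻¹ *
      ∫⁻ w in Metric.ball (0 : Space N) (2 * h), ‖φ x - φ (x + w)‖ₑ := by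
  set d := TopologicalSpace.denseSeq (Space N) (nearIndex hh x) with hd
  have hvol : volume (Metric.ball d h) = volume (Metric.ball (0 : Space N) h) :=
    Measure.addHaar_ball_center _ _ _
  have h0 : volume (Metric.ball d h) ≠ 0 := (Metric.measure_ball_pos _ _ hh).ne'
  have htop : volume (Metric.ball d h) ≠ ⊤ := measure_ball_lt_top.ne
  have hInt : IntegrableOn φ (Metric.ball d h) := hφ.integrable.integrableOn
  have h1 : φ x - ballAverage h φ (nearIndex hh x) =
      ∫ y, (φ x - φ y) ∂((volume (Metric.ball d h))⁻¹ • volume.restrict (Metric.ball d h)) := by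
    have hprob : IsProbabilityMeasure
        ((volume (Metric.ball d h))⁻¹ • volume.restrict (Metric.ball d h)) :=
      ⟨by simp [ENNReal.inv_mul_cancel h0 htop]⟩
    rw [integral_sub (integrable_const _) (hInt.smul_measure (by simp [h0]))]
    simp only [integral_const, probReal_univ, one_smul]
    rw [ballAverage, ← hd, average]
    simp
  rw [h1]
  refine (enorm_integral_le_lintegral_enorm _).trans ?_
  rw [lintegral_smul_measure, hvol, smul_eq_mul]
  refine mul_le_mul_right ?_ _
  have hsub : Metric.ball d h ⊆ Metric.ball x (2 * h) := by
    refine Metric.ball_subset_ball' ?_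
    have := dist_nearIndex hh x
    rw [dist_comm] at this
    linarith
  refine (lintegral_mono_set hsub).trans (le_of_eq ?_)
  rw [← lintegral_indicator measurableSet_ball, ← lintegral_indicator measurableSet_ball,
    ← lintegral_add_left_eq_self _ x]
  refine lintegral_congr fun w => ?_
  by_cases hw : w ∈ Metric.ball (0 : Space N) (2 * h)
  · rw [Set.indicator_of_mem hw, Set.indicator_of_mem (by simpa using hw)]
  · rw [Set.indicator_of_notMem hw, Set.indicator_of_notMem (by simpa using hw)]

/-- Tonelli's theorem reduces to translations by `‖w‖ < 2h`, and `2 ^ N` is the ratio of the two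
ball volumes. The approximation by ball averages is thus uniform over functions with bounded
gradient integral. -/
lemma lintegral_sub_ballAverage_le (hφ : IsTestFunction Ω φ) {h : ℝ} (hh : 0 < h) :
    ∫⁻ x, ‖φ x - ballAverage h φ (nearIndex hh x)‖ₑ ≤
      2 ^ N * ENNReal.ofReal (2 * h) * ∫⁻ x, ‖fderiv ℝ φ x‖ₑ := by
  have hmeas : Measurable fun z : Space N × Space N => ‖φ z.1 - φ (z.1 + z.2)‖ₑ := by
    have := hφ.1.continuous
    have : Continuous fun z : Space N × Space N => φ z.1 - φ (z.1 + z.2) := by fun_prop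
    exact this.measurable.enorm
  have hb0 : volume (Metric.ball (0 : Space N) h) ≠ 0 := (Metric.measure_ball_pos _ _ hh).ne'
  have hbt : volume (Metric.ball (0 : Space N) h) ≠ ⊤ := measure_ball_lt_top.ne
  calc ∫⁻ x, ‖φ x - ballAverage h φ (nearIndex hh x)‖ₑ
      ≤ ∫⁻ x, (volume (Metric.ball (0 : Space N) h))⁻¹ *
        ∫⁻ w in Metric.ball (0 : Space N) (2 * h), ‖φ x - φ (x + w)‖ₑ :=
        lintegral_mono fun x => enorm_sub_ballAverage_le hφ.isCc hh x
    _ = (volume (Metric.ball (0 : Space N) h))⁻¹ *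
        ∫⁻ w in Metric.ball (0 : Space N) (2 * h), ∫⁻ x, ‖φ x - φ (x + w)‖ₑ := by
      rw [lintegral_const_mul' _ _ (ENNReal.inv_ne_top.2 hb0),
        lintegral_lintegral_swap hmeas.aemeasurable]
    _ ≤ (volume (Metric.ball (0 : Space N) h))⁻¹ *
        ∫⁻ _w in Metric.ball (0 : Space N) (2 * h),
          ENNReal.ofReal (2 * h) * ∫⁻ x, ‖fderiv ℝ φ x‖ₑ := by
      refine mul_le_mul_right (setLIntegral_mono' measurableSet_ball fun w hw => ?_) _
      refine (lintegral_translate_sub_le hφ.1 w).trans (mul_le_mul_left ?_ _)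
      rw [← ofReal_norm]
      exact ENNReal.ofReal_le_ofReal (by simpa using (Metric.mem_ball.1 hw).le)
    _ = 2 ^ N * ENNReal.ofReal (2 * h) * ∫⁻ x, ‖fderiv ℝ φ x‖ₑ := by
      rw [setLIntegral_const, Measure.addHaar_ball_mul_of_pos _ _ (by norm_num : (0 : ℝ) < 2)]
      have e : ENNReal.ofReal (2 ^ Module.finrank ℝ (Space N)) = 2 ^ N := by
        rw [ENNReal.ofReal_pow (by norm_num)]; simp
      rw [e]
      set b := volume (Metric.ball (0 : Space N) h)
      set J := ∫⁻ x, ‖fderiv ℝ φ x‖ₑ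
      calc b⁻¹ * (ENNReal.ofReal (2 * h) * J * (2 ^ N * b))
          = (b⁻¹ * b) * (2 ^ N * ENNReal.ofReal (2 * h) * J) := by ring
        _ = _ := by rw [ENNReal.inv_mul_cancel hb0 hbt, one_mul]

lemma abs_ballAverage_le (hφ : IsCc φ) {h : ℝ} (j : ℕ) :
    |ballAverage h φ j| ≤ (volume.real (Metric.ball (0 : Space N) h))⁻¹ * ∫ x, |φ x| := by
  set d := TopologicalSpace.denseSeq (Space N) j with hd
  have hvol : volume.real (Metric.ball d h) = volume.real (Metric.ball (0 : Space N) h) := by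
    rw [Measure.real, Measure.addHaar_ball_center]; rfl
  rw [ballAverage, setAverage_eq, ← hd, hvol, smul_eq_mul, abs_mul, abs_of_nonneg (by positivity)]
  refine mul_le_mul_of_nonneg_left ?_ (by positivity)
  exact abs_integral_le_integral_abs.trans (setIntegral_le_integral hφ.abs.integrable
    (ae_of_all _ fun x => abs_nonneg _))

/-- There are only countably many averages, each bounded uniformly in `n`, so a sequence of them
lives in a sequentially compact product of intervals. -/
lemma exists_subseq_tendsto_ballAverage {φ : ℕ → Space N → ℝ} (hφ : ∀ n, IsCc (φ n)) {B : ℝ}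
    (hB : ∀ n, ∫ x, |φ n x| ≤ B) : ∃ σ : ℕ → ℕ, StrictMono σ ∧ ∃ L : ℕ → ℕ → ℝ,
      ∀ k j : ℕ, Tendsto (fun n => ballAverage (1 / ((k : ℝ) + 1)) (φ (σ n)) j) atTop (𝓝 (L k j)) := by
  set R : ℕ × ℕ → ℝ := fun z =>
    (volume.real (Metric.ball (0 : Space N) (1 / ((z.1 : ℝ) + 1))))⁻¹ * B
  have hK : IsCompact (Set.univ.pi fun z => Set.Icc (-(R z)) (R z)) :=
    isCompact_univ_pi fun z => isCompact_Icc
  obtain ⟨L, -, σ, hσ, hL⟩ := hK.isSeqCompact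
    (x := fun n (z : ℕ × ℕ) => ballAverage (1 / ((z.1 : ℝ) + 1)) (φ n) z.2) (fun n z _ => by
      have := (abs_ballAverage_le (hφ n) (h := 1 / ((z.1 : ℝ) + 1)) z.2).trans
        (mul_le_mul_of_nonneg_left (hB n) (by positivity))
      exact abs_le.1 this)
  exact ⟨σ, hσ, fun k j => L (k, j), fun k j => (tendsto_pi_nhds.1 hL) (k, j)⟩

/-- Rellich's theorem in `L¹`: along the subsequence the ball averages converge pointwise, hence in
`L¹(Ω)` by domination, and they are uniformly close to the functions. Two functions are compared
through two averages and their limit, so four errors of `ε / 4` occur. -/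
lemma exists_subseq_cauchy_integral (hΩb : Bornology.IsBounded Ω)
    {φ : ℕ → Space N → ℝ}
    (hφ : ∀ n, IsTestFunction Ω (φ n)) {B : ℝ} (hB : ∀ n, ∫ x, |φ n x| ≤ B) {B' : ℝ≥0∞}
    (hB't : B' ≠ ⊤) (hB' : ∀ n, ∫⁻ x, ‖fderiv ℝ (φ n) x‖ₑ ≤ B') :
    ∃ σ : ℕ → ℕ, StrictMono σ ∧ ∀ ε : ℝ, 0 < ε → ∃ n₀, ∀ a ≥ n₀, ∀ b ≥ n₀,
      ∫ x, |φ (σ a) x - φ (σ b) x| ≤ ε := by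
  have := isFiniteMeasure_restrict hΩb
  obtain ⟨σ, hσ, L, hL⟩ := exists_subseq_tendsto_ballAverage (fun n => (hφ n).isCc) hB
  refine ⟨σ, hσ, fun ε hε => ?_⟩
  have hε' : 0 < ENNReal.ofReal ε / 4 := by
    simp [ENNReal.div_pos_iff, hε]
  obtain ⟨k, hk⟩ : ∃ k : ℕ, 2 ^ N * ENNReal.ofReal (2 * (1 / ((k : ℝ) + 1))) * B' ≤
      ENNReal.ofReal ε / 4 := by
    have h1 : Tendsto (fun k : ℕ => 2 ^ N * ENNReal.ofReal (2 * (1 / ((k : ℝ) + 1))) * B') atTop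
        (𝓝 (2 ^ N * ENNReal.ofReal (2 * 0) * B')) := by
      refine ENNReal.Tendsto.mul_const (ENNReal.Tendsto.const_mul ?_ (Or.inr (by simp)))
        (Or.inr hB't)
      exact ENNReal.tendsto_ofReal (tendsto_one_div_add_atTop_nhds_zero_nat.const_mul 2)
    simp only [mul_zero, ENNReal.ofReal_zero, zero_mul] at h1
    exact (h1.eventually_le_const hε').exists
  set h : ℝ := 1 / ((k : ℝ) + 1) with hh
  have hh0 : 0 < h := by positivity
  set P : ℕ → Space N → ℝ := fun n x => ballAverage h (φ (σ n)) (nearIndex hh0 x) with hP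
  set ℓ : Space N → ℝ := fun x => L k (nearIndex hh0 x) with hℓ
  have hPm : ∀ n, Measurable (P n) := fun n =>
    (measurable_from_nat (f := ballAverage h (φ (σ n)))).comp (measurable_nearIndex hh0)
  have hℓm : Measurable ℓ := (measurable_from_nat (f := L k)).comp (measurable_nearIndex hh0)
  have hlim : Tendsto (fun n => ∫⁻ x in Ω, ‖P n x - ℓ x‖ₑ) atTop (𝓝 0) := by
    refine tendsto_lintegral_norm_of_dominated_convergence (bound := fun _ =>
      (volume.real (Metric.ball (0 : Space N) h))⁻¹ * B) (fun n => (hPm n).aestronglyMeasurable)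
      (integrable_const (μ := volume.restrict Ω) _).2 (fun n => ae_of_all _ fun x => ?_)
      (ae_of_all _ fun x => hL k (nearIndex hh0 x)) |>.congr fun n => ?_
    · exact (abs_ballAverage_le (hφ _).isCc _).trans
        (mul_le_mul_of_nonneg_left (hB _) (by positivity))
    · exact lintegral_congr fun x => by rw [ofReal_norm]
  obtain ⟨n₀, hn₀⟩ := eventually_atTop.1 (hlim.eventually_le_const hε')
  refine ⟨n₀, fun a ha b hb => ?_⟩
  have hone : ∀ a ≥ n₀, ∫⁻ x in Ω, ‖φ (σ a) x - ℓ x‖ₑ ≤ ENNReal.ofReal ε / 4 + ENNReal.ofReal ε / 4 := by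
    intro a ha
    calc ∫⁻ x in Ω, ‖φ (σ a) x - ℓ x‖ₑ
        ≤ ∫⁻ x in Ω, (‖φ (σ a) x - P a x‖ₑ + ‖P a x - ℓ x‖ₑ) := by
          refine lintegral_mono fun x => ?_
          have := enorm_add_le (φ (σ a) x - P a x) (P a x - ℓ x)
          simpa using this
      _ = (∫⁻ x in Ω, ‖φ (σ a) x - P a x‖ₑ) + ∫⁻ x in Ω, ‖P a x - ℓ x‖ₑ :=
        lintegral_add_right _ ((hPm a).sub hℓm).enorm
      _ ≤ _ := by
        refine add_le_add ?_ (hn₀ a ha)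
        refine (setLIntegral_le_lintegral _ _).trans
          ((lintegral_sub_ballAverage_le (hφ (σ a)) hh0).trans (le_trans ?_ hk))
        exact mul_le_mul_right (hB' _) _
  have hsub : ∫⁻ x in Ω, ‖φ (σ a) x - φ (σ b) x‖ₑ ≤ ENNReal.ofReal ε := by
    calc ∫⁻ x in Ω, ‖φ (σ a) x - φ (σ b) x‖ₑ
        ≤ ∫⁻ x in Ω, (‖φ (σ a) x - ℓ x‖ₑ + ‖φ (σ b) x - ℓ x‖ₑ) := by
          refine lintegral_mono fun x => ?_
          have := enorm_sub_le (a := φ (σ a) x - ℓ x) (b := φ (σ b) x - ℓ x)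
          simpa using this
      _ = (∫⁻ x in Ω, ‖φ (σ a) x - ℓ x‖ₑ) + ∫⁻ x in Ω, ‖φ (σ b) x - ℓ x‖ₑ :=
        lintegral_add_right _ ((hφ _).1.continuous.measurable.sub hℓm).enorm
      _ ≤ _ := add_le_add (hone a ha) (hone b hb)
      _ = ENNReal.ofReal ε := by
        rw [← ENNReal.add_halves (ENNReal.ofReal ε)]
        have : ENNReal.ofReal ε / 4 + ENNReal.ofReal ε / 4 = ENNReal.ofReal ε / 2 := by
          rw [ENNReal.div_add_div_same, ← two_mul, show (4 : ℝ≥0∞) = 2 * 2 by norm_num,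
            ENNReal.mul_div_mul_left _ _ (by simp) (by simp)]
        rw [ENNReal.add_halves, this, ENNReal.add_halves]
  have hd : IsCc (fun x => φ (σ a) x - φ (σ b) x) := (hφ _).isCc.sub (hφ _).isCc
  have hΩint : ∫ x in Ω, |φ (σ a) x - φ (σ b) x| = ∫ x, |φ (σ a) x - φ (σ b) x| :=
    setIntegral_eq_integral_of_forall_compl_eq_zero fun x hx => by
      have h1 : φ (σ a) x = 0 := by by_contra h; exact hx ((hφ _).support_subset h)
      have h2 : φ (σ b) x = 0 := by by_contra h; exact hx ((hφ _).support_subset h)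
      simp [h1, h2]
  rw [← hΩint, ← ENNReal.ofReal_le_ofReal_iff hε.le,
    ofReal_integral_eq_lintegral_ofReal hd.abs.integrable.restrict
      (ae_of_all _ fun x => abs_nonneg _)]
  refine le_trans (le_of_eq (lintegral_congr fun x => ?_)) hsub
  rw [← ofReal_norm, Real.norm_eq_abs]

/-- According to whether `a^(p-s)` is above or below `1/δ`, one of the two terms alone dominates.
This upgrades `L¹` convergence to `L^s` when the `L^p` norms are bounded. -/
lemma rpow_le_interpolate {s p δ a : ℝ} (hs : 1 < s) (hsp : s < p) (hδ : 0 < δ) (ha : 0 ≤ a) :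
    a ^ s ≤ δ * a ^ p + (δ⁻¹) ^ ((s - 1) / (p - s)) * a := by
  rcases ha.eq_or_lt with rfl | ha
  · rw [Real.zero_rpow (by linarith), Real.zero_rpow (by linarith)]; simp
  have hps : 0 < p - s := by linarith
  rcases le_total (δ⁻¹) (a ^ (p - s)) with h | h
  · have h1 : a ^ s ≤ δ * a ^ p := by
      have : a ^ p = a ^ (p - s) * a ^ s := by rw [← Real.rpow_add ha]; congr 1; ring
      rw [this, ← mul_assoc]
      have h2 : 1 ≤ δ * a ^ (p - s) := by
        calc 1 = δ * δ⁻¹ := (mul_inv_cancel₀ hδ.ne').symm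
          _ ≤ _ := by gcongr
      exact le_mul_of_one_le_left (by positivity) h2
    have : 0 ≤ (δ⁻¹) ^ ((s - 1) / (p - s)) * a := by positivity
    linarith
  · have h1 : a ^ s ≤ (δ⁻¹) ^ ((s - 1) / (p - s)) * a := by
      have h2 : a ^ s = a ^ (s - 1) * a := by
        rw [← Real.rpow_add_one ha.ne', sub_add_cancel]
      have h3 : a ^ (s - 1) = (a ^ (p - s)) ^ ((s - 1) / (p - s)) := by
        rw [← Real.rpow_mul ha.le]; congr 1; field_simp
      rw [h2, h3]
      refine mul_le_mul_of_nonneg_right (Real.rpow_le_rpow (by positivity) h ?_) ha.le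
      exact div_nonneg (by linarith) hps.le
    have : 0 ≤ δ * a ^ p := by positivity
    linarith

lemma integral_abs_rpow_le_of_eLpNorm_le {f : Space N → ℝ} {p : ℝ} (hp : 0 < p) (hf : IsCc f)
    {B : NNReal} (h : eLpNorm f (ENNReal.ofReal p) volume ≤ B) : ∫ x, |f x| ^ p ≤ (B : ℝ) ^ p := by
  have hm : MemLp f (ENNReal.ofReal p) volume := hf.1.memLp_of_hasCompactSupport hf.2
  rw [hm.eLpNorm_eq_integral_rpow_norm (by simpa using hp) ENNReal.ofReal_ne_top,
    ENNReal.toReal_ofReal hp.le] at h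
  have h0 : 0 ≤ ∫ x, ‖f x‖ ^ p := integral_nonneg fun _ => by positivity
  rw [← ENNReal.ofReal_coe_nnreal] at h
  replace h := (ENNReal.ofReal_le_ofReal_iff B.coe_nonneg).1 h
  have h1 := Real.rpow_le_rpow (by positivity) h hp.le
  rwa [← Real.rpow_mul h0, inv_mul_cancel₀ hp.ne', Real.rpow_one] at h1

/-- Compactness of the embedding into the subcritical Lebesgue spaces, for test functions. -/
theorem exists_subseq_cauchy (hΩb : Bornology.IsBounded Ω) {r : ℕ}
    (hr : 1 ≤ r) {m : ℝ} (hm : 1 < m) (hN : r * m < N) {s : ℝ} (hs : 1 < s)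
    (hs' : s < criticalExponent N r m) {φ : ℕ → Space N → ℝ} (hφ : ∀ n, IsTestFunction Ω (φ n))
    {B : NNReal}
    (hB : ∀ n, eLpNorm (classicalDr r (φ n)) (ENNReal.ofReal m) (volume.restrict Ω) ≤ B) :
    ∃ σ : ℕ → ℕ, StrictMono σ ∧ ∀ ε : ℝ, 0 < ε → ∃ n₀, ∀ a ≥ n₀, ∀ b ≥ n₀,
      ∫ x, |φ (σ a) x - φ (σ b) x| ^ s ≤ ε := by
  have := isFiniteMeasure_restrict hΩb
  obtain ⟨C, hC⟩ := exists_apriori hΩb hr hm hN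
  set p := criticalExponent N r m
  have hp0 : 0 < p := by linarith
  have hL1 : ∀ (I : List (Fin N)), I.length ≤ r → ∀ n,
      eLpNorm (classicalDeriv I (φ n)) 1 volume ≤ C * B *
        (volume.restrict Ω) Set.univ ^ (1 / (1 : ℝ≥0∞).toReal - 1 / (ENNReal.ofReal m).toReal) := by
    intro I hI n
    rw [← eLpNorm_restrict_of_support ((hφ n).classicalDeriv I).support_subset]
    refine (eLpNorm_le_eLpNorm_mul_rpow_measure_univ (q := ENNReal.ofReal m) (by simpa using hm.le)
      ((hφ n).classicalDeriv I).1.continuous.aestronglyMeasurable).trans ?_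
    refine mul_le_mul_left (((hC _ (hφ n)).1 I hI).trans ?_) _
    exact mul_le_mul_right (hB n) _
  set D := C * B *
        (volume.restrict Ω) Set.univ ^ (1 / (1 : ℝ≥0∞).toReal - 1 / (ENNReal.ofReal m).toReal)
  have hD : D ≠ ⊤ := by
    refine ENNReal.mul_ne_top (by finiteness) (ENNReal.rpow_ne_top_of_nonneg ?_ (measure_ne_top _ _))
    rw [ENNReal.toReal_ofReal (by linarith)]
    have := one_div_le_one_div_of_le one_pos hm.le
    simp only [ENNReal.toReal_one]
    linarith
  lift D to NNReal using hD with D' hD'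
  have b1 : ∀ n, ∫ x, |φ n x| ≤ D' := by
    intro n
    have := integral_abs_rpow_le_of_eLpNorm_le one_pos (hφ n).isCc (B := D')
      (by simpa [classicalDeriv] using hL1 [] (by simp) n)
    simpa using this
  have b2 : ∀ n, ∫⁻ x, ‖fderiv ℝ (φ n) x‖ₑ ≤ N * (D' : ℝ≥0∞) := by
    intro n
    calc ∫⁻ x, ‖fderiv ℝ (φ n) x‖ₑ ≤ ∫⁻ x, ∑ i, ‖classicalDeriv [i] (φ n) x‖ₑ := by
          refine lintegral_mono fun x => ?_
          simp only [← ofReal_norm]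
          rw [← ENNReal.ofReal_sum_of_nonneg fun _ _ => norm_nonneg _]
          exact ENNReal.ofReal_le_ofReal (norm_fderiv_le_sum _ _)
      _ = ∑ i, ∫⁻ x, ‖classicalDeriv [i] (φ n) x‖ₑ := lintegral_finsetSum _ fun i _ =>
          ((hφ n).classicalDeriv [i]).1.continuous.measurable.enorm
      _ ≤ ∑ _i : Fin N, (D' : ℝ≥0∞) := Finset.sum_le_sum fun i _ => by
          rw [← eLpNorm_one_eq_lintegral_enorm]; exact hL1 [i] (by simpa using hr) n
      _ = _ := by simp
  obtain ⟨σ, hσ, hcau⟩ := exists_subseq_cauchy_integral hΩb hφ b1 (by finiteness) b2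
  refine ⟨σ, hσ, fun ε hε => ?_⟩
  set Q : ℝ := ((C * (B + B) : NNReal) : ℝ) ^ p with hQ
  have hQ0 : 0 ≤ Q := by positivity
  have hcrit : ∀ a b, ∫ x, |φ a x - φ b x| ^ p ≤ Q := by
    intro a b
    refine integral_abs_rpow_le_of_eLpNorm_le hp0 ((hφ a).isCc.sub (hφ b).isCc) ?_
    have ht : IsTestFunction Ω (φ a + (-1 : ℝ) • φ b) := (hφ a).add ((hφ b).const_smul _)
    have e : (fun x => φ a x - φ b x) = φ a + (-1 : ℝ) • φ b := by
      ext x; simp [sub_eq_add_neg]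
    rw [e, ← eLpNorm_restrict_of_support ht.support_subset]
    refine (hC _ ht).2.trans ?_
    rw [classicalDr_add r (hφ a) ((hφ b).const_smul _), classicalDr_const_smul r _ (hφ b)]
    push_cast
    refine mul_le_mul_right ((eLpNorm_add_le (memLp_classicalDr r (hφ a) (ENNReal.ofReal m) _).1
      ((memLp_classicalDr r (hφ b) (ENNReal.ofReal m) _).const_smul (-1 : ℝ)).1
      (by simpa using hm.le)).trans (add_le_add (hB a) ?_)) _
    rw [eLpNorm_const_smul]
    simpa using hB b
  -- `Q` bounds the critical-power integrals of all differences, so their contribution is at most `ε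
  -- / 2`; the `+ 1` covers `Q = 0`.
  set δ : ℝ := ε / (2 * (Q + 1)) with hδ
  have hδ0 : 0 < δ := by positivity
  set K : ℝ := (δ⁻¹) ^ ((s - 1) / (p - s)) with hK
  have hK0 : 0 < K := by positivity
  obtain ⟨n₀, hn₀⟩ := hcau (ε / (2 * K)) (by positivity)
  refine ⟨n₀, fun a ha b hb => ?_⟩
  have hd : IsCc (fun x => φ (σ a) x - φ (σ b) x) := (hφ _).isCc.sub (hφ _).isCc
  have h1 : ∫ x, |φ (σ a) x - φ (σ b) x| ^ s ≤
      δ * (∫ x, |φ (σ a) x - φ (σ b) x| ^ p) + K * ∫ x, |φ (σ a) x - φ (σ b) x| := by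
    rw [← integral_const_mul, ← integral_const_mul,
      ← integral_add ((hd.abs_rpow hp0).const_mul _).integrable (hd.abs.const_mul _).integrable]
    exact integral_mono (hd.abs_rpow (by linarith)).integrable
      (((hd.abs_rpow hp0).const_mul _).add (hd.abs.const_mul _)).integrable
      fun x => rpow_le_interpolate hs hs' hδ0 (abs_nonneg _)
  have h2 : δ * (∫ x, |φ (σ a) x - φ (σ b) x| ^ p) ≤ ε / 2 := by
    calc _ ≤ δ * Q := mul_le_mul_of_nonneg_left (hcrit _ _) hδ0.le
      _ ≤ δ * (Q + 1) := by gcongr; linarith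
      _ = ε / 2 := by rw [hδ]; field_simp
  have h3 : K * ∫ x, |φ (σ a) x - φ (σ b) x| ≤ ε / 2 := by
    calc _ ≤ K * (ε / (2 * K)) := mul_le_mul_of_nonneg_left (hn₀ a ha b hb) hK0.le
      _ = ε / 2 := by field_simp
  linarith

end

/-! ### Uniform convexity and differentiability of powers of the norm -/

section

variable {V : Type*} [NormedAddCommGroup V] [InnerProductSpace ℝ V]

/-- For equal norms the triangle inequality is strict, as equality would put `a` and `b` on one ray;
for different norms `t ↦ t^p` is strictly convex. -/
lemma norm_midpoint_rpow_lt {p : ℝ} (hp : 1 < p) {a b : V} (hab : a ≠ b) :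
    ‖(2 : ℝ)⁻¹ • (a + b)‖ ^ p < (‖a‖ ^ p + ‖b‖ ^ p) / 2 := by
  have hp0 : 0 < p := by linarith
  have h1 : ‖(2 : ℝ)⁻¹ • (a + b)‖ = 2⁻¹ * ‖a + b‖ := by
    rw [norm_smul]; norm_num
  rw [h1]
  by_cases h : ‖a‖ = ‖b‖
  · have h2 : ‖a + b‖ < ‖a‖ + ‖b‖ := by
      refine lt_of_le_of_ne (norm_add_le _ _) fun h' => hab ?_
      exact (sameRay_iff_norm_add.2 h').eq_of_norm_eq h
    rw [← h] at h2 ⊢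
    have h3 : 2⁻¹ * ‖a + b‖ < ‖a‖ := by linarith
    have := Real.rpow_lt_rpow (by positivity) h3 hp0
    linarith
  · have h2 := (strictConvexOn_rpow hp).2 (Set.mem_Ici.2 (norm_nonneg a))
      (Set.mem_Ici.2 (norm_nonneg b)) h (by norm_num : (0 : ℝ) < 2⁻¹) (by norm_num : (0 : ℝ) < 2⁻¹)
      (by norm_num)
    simp only [smul_eq_mul] at h2
    have h3 : (2⁻¹ * ‖a + b‖) ^ p ≤ (2⁻¹ * ‖a‖ + 2⁻¹ * ‖b‖) ^ p :=
      Real.rpow_le_rpow (by positivity) (by linarith [norm_add_le a b]) hp0.le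
    linarith

lemma norm_midpoint_rpow_le {p : ℝ} (hp : 1 < p) (a b : V) :
    ‖(2 : ℝ)⁻¹ • (a + b)‖ ^ p ≤ (‖a‖ ^ p + ‖b‖ ^ p) / 2 := by
  by_cases h : a = b
  · subst h
    rw [← two_smul ℝ a, smul_smul]
    norm_num
  · exact (norm_midpoint_rpow_lt hp h).le

/-- A substitute for Clarkson's inequalities, uniform in `p > 1`. On the compact set where the
`p`-th powers of the norms sum to one and `‖a - b‖^p ≥ ε`, the midpoint defect has a positive
minimum `δ`; off it the `ε` term suffices. Homogeneity gives the rest. -/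
lemma exists_uniform_convexity [FiniteDimensional ℝ V] {p : ℝ} (hp : 1 < p) {ε : ℝ} (hε : 0 < ε) :
    ∃ C : ℝ, 0 < C ∧ ∀ a b : V, ‖a - b‖ ^ p ≤ ε * (‖a‖ ^ p + ‖b‖ ^ p) +
      C * ((‖a‖ ^ p + ‖b‖ ^ p) / 2 - ‖(2 : ℝ)⁻¹ • (a + b)‖ ^ p) := by
  have hp0 : 0 < p := by linarith
  have hcont : ∀ {f : V × V → V}, Continuous f → Continuous fun z => ‖f z‖ ^ p := fun hf =>
    hf.norm.rpow_const fun _ => Or.inr hp0.le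
  set d : V × V → ℝ := fun z => (‖z.1‖ ^ p + ‖z.2‖ ^ p) / 2 - ‖(2 : ℝ)⁻¹ • (z.1 + z.2)‖ ^ p with hd
  have hdc : Continuous d :=
    (((hcont continuous_fst).add (hcont continuous_snd)).div_const 2).sub (hcont (by fun_prop))
  set S : Set (V × V) := {z | ‖z.1‖ ^ p + ‖z.2‖ ^ p = 1 ∧ ε ≤ ‖z.1 - z.2‖ ^ p} with hS
  have hbd : ∀ z : V × V, ‖z.1‖ ^ p + ‖z.2‖ ^ p = 1 → ‖z.1‖ ≤ 1 ∧ ‖z.2‖ ≤ 1 := by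
    intro z hz
    have key : ∀ t : ℝ, 0 ≤ t → t ^ p ≤ 1 → t ≤ 1 := fun t ht h => by
      by_contra hlt
      exact absurd (Real.one_lt_rpow (not_le.1 hlt) hp0) (not_lt.2 h)
    have h1 : 0 ≤ ‖z.1‖ ^ p := by positivity
    have h2 : 0 ≤ ‖z.2‖ ^ p := by positivity
    exact ⟨key _ (norm_nonneg _) (by linarith), key _ (norm_nonneg _) (by linarith)⟩
  have hScl : IsClosed S :=
    (isClosed_eq ((hcont continuous_fst).add (hcont continuous_snd)) continuous_const).inter
      (isClosed_le continuous_const (hcont (continuous_fst.sub continuous_snd)))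
  have hScomp : IsCompact S := by
    have : ProperSpace (V × V) := FiniteDimensional.proper ℝ _
    refine Metric.isCompact_of_isClosed_isBounded hScl
      ((Metric.isBounded_closedBall (x := (0 : V × V)) (r := 1)).subset fun z hz => ?_)
    rw [mem_closedBall_zero_iff, Prod.norm_def]
    exact max_le (hbd z hz.1).1 (hbd z hz.1).2
  obtain ⟨δ, hδ, hmin⟩ : ∃ δ : ℝ, 0 < δ ∧ ∀ z ∈ S, δ ≤ d z := by
    rcases S.eq_empty_or_nonempty with h | h
    · exact ⟨1, one_pos, by simp [h]⟩
    · obtain ⟨z₀, hz₀, hmin⟩ := hScomp.exists_isMinOn h hdc.continuousOn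
      refine ⟨d z₀, ?_, fun z hz => hmin hz⟩
      have hne : z₀.1 ≠ z₀.2 := fun h => by
        have := hz₀.2
        rw [h, sub_self, norm_zero, Real.zero_rpow hp0.ne'] at this
        linarith
      exact sub_pos.2 (norm_midpoint_rpow_lt hp hne)
  have hC : 0 < 2 ^ p / δ := by positivity
  refine ⟨2 ^ p / δ, hC, fun a b => ?_⟩
  have hd0 : ∀ z, 0 ≤ d z := fun z => sub_nonneg.2 (norm_midpoint_rpow_le hp _ _)
  have hunit : ∀ z : V × V, ‖z.1‖ ^ p + ‖z.2‖ ^ p = 1 → ‖z.1 - z.2‖ ^ p ≤ ε + 2 ^ p / δ * d z := by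
    intro z hz
    rcases le_total ε (‖z.1 - z.2‖ ^ p) with h | h
    · have h1 := hmin z ⟨hz, h⟩
      have h2 : ‖z.1 - z.2‖ ^ p ≤ 2 ^ p := by
        refine Real.rpow_le_rpow (norm_nonneg _) ?_ hp0.le
        have := norm_sub_le z.1 z.2
        have := hbd z hz
        linarith [this.1, this.2]
      have h3 : 2 ^ p ≤ 2 ^ p / δ * d z := by
        rw [div_mul_eq_mul_div, le_div_iff₀ hδ]
        exact mul_le_mul_of_nonneg_left h1 (by positivity)
      linarith
    · have := mul_nonneg hC.le (hd0 z)
      linarith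
  set T : ℝ := ‖a‖ ^ p + ‖b‖ ^ p with hT
  have hT0 : 0 ≤ T := by positivity
  rcases hT0.eq_or_lt with h | h
  · have h1 : 0 ≤ ‖a‖ ^ p := by positivity
    have h2 : 0 ≤ ‖b‖ ^ p := by positivity
    have h3 : ‖a‖ ^ p = 0 := by linarith
    have h4 : ‖b‖ ^ p = 0 := by linarith
    rw [Real.rpow_eq_zero (norm_nonneg _) hp0.ne', norm_eq_zero] at h3 h4
    have := mul_nonneg hC.le (hd0 (a, b))
    simp only [hd] at this
    rw [h3, h4, sub_self, norm_zero, Real.zero_rpow hp0.ne']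
    rw [h3, h4] at this
    simp only [norm_zero, Real.zero_rpow hp0.ne'] at this
    rw [← h]
    simp only [mul_zero, zero_add] at this ⊢
    simpa using this
  -- The scaling factor that normalises `‖a‖^p + ‖b‖^p` to one.
  · set t : ℝ := T ^ (-p⁻¹) with ht
    have ht0 : 0 < t := Real.rpow_pos_of_pos h _
    have htp : t ^ p = T⁻¹ := by
      rw [ht, ← Real.rpow_mul hT0, neg_mul, inv_mul_cancel₀ hp0.ne', Real.rpow_neg_one]
    have hsc : ∀ v : V, ‖t • v‖ ^ p = T⁻¹ * ‖v‖ ^ p := fun v => by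
      rw [norm_smul, Real.norm_of_nonneg ht0.le, Real.mul_rpow ht0.le (norm_nonneg _), htp]
    have h1 := hunit (t • a, t • b) (by
      simp only [hsc]; rw [← mul_add, ← hT, inv_mul_cancel₀ h.ne'])
    simp only [hd] at h1
    rw [← smul_sub, ← smul_add, smul_comm (2 : ℝ)⁻¹ t, hsc, hsc, hsc, hsc] at h1
    have h2 := mul_le_mul_of_nonneg_left h1 hT0
    rw [← mul_assoc, mul_inv_cancel₀ h.ne', one_mul] at h2
    refine h2.trans (le_of_eq ?_)
    have hne := h.ne'
    rw [← mul_add, ← hT]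
    field_simp

lemma integral_uniform_convexity {α : Type*} [MeasurableSpace α] {μ : Measure α} {p : ℝ}
    (hp : 0 < p) {ε C : ℝ}
    (hC : ∀ a b : V, ‖a - b‖ ^ p ≤ ε * (‖a‖ ^ p + ‖b‖ ^ p) +
      C * ((‖a‖ ^ p + ‖b‖ ^ p) / 2 - ‖(2 : ℝ)⁻¹ • (a + b)‖ ^ p)) {f g : α → V}
    (hf : MemLp f (ENNReal.ofReal p) μ) (hg : MemLp g (ENNReal.ofReal p) μ) :
    ∫ x, ‖f x - g x‖ ^ p ∂μ ≤ ε * ((∫ x, ‖f x‖ ^ p ∂μ) + ∫ x, ‖g x‖ ^ p ∂μ) +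
      C * (((∫ x, ‖f x‖ ^ p ∂μ) + ∫ x, ‖g x‖ ^ p ∂μ) / 2 -
        ∫ x, ‖(2 : ℝ)⁻¹ • (f x + g x)‖ ^ p ∂μ) := by
  have hInt : ∀ {f : α → V}, MemLp f (ENNReal.ofReal p) μ → Integrable (fun x => ‖f x‖ ^ p) μ :=
    fun hf => by
      have := hf.integrable_norm_rpow (by simpa using hp) ENNReal.ofReal_ne_top
      rwa [ENNReal.toReal_ofReal hp.le] at this
  have i1 := hInt hf
  have i2 := hInt hg
  have i3 : Integrable (fun x => ‖(2 : ℝ)⁻¹ • (f x + g x)‖ ^ p) μ :=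
    hInt ((hf.add hg).const_smul (2 : ℝ)⁻¹)
  have i4 : Integrable (fun x => ‖f x - g x‖ ^ p) μ := hInt (hf.sub hg)
  have i5 : Integrable (fun x => ‖f x‖ ^ p + ‖g x‖ ^ p) μ := i1.add i2
  have i6 : Integrable (fun x => (‖f x‖ ^ p + ‖g x‖ ^ p) / 2) μ := i5.div_const 2
  have i7 : Integrable (fun x => (‖f x‖ ^ p + ‖g x‖ ^ p) / 2 -
    ‖(2 : ℝ)⁻¹ • (f x + g x)‖ ^ p) μ := i6.sub i3
  rw [← integral_add i1 i2, ← integral_const_mul, ← integral_div, ← integral_sub i6 i3,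
    ← integral_const_mul, ← integral_add (i5.const_mul ε) (i7.const_mul C)]
  exact integral_mono i4 ((i5.const_mul ε).add (i7.const_mul C)) fun x => hC (f x) (g x)

/-- Differentiation under the integral; for `|t| < 1` the derivative is dominated by `p (‖X‖ +
‖Y‖)^p`. Used for both `D_r u` and `u` itself. -/
lemma hasDerivAt_integral_norm_rpow {α : Type*} [MeasurableSpace α] {μ : Measure α} {p : ℝ}
    (hp : 1 < p) {X Y : α → V} (hX : MemLp X (ENNReal.ofReal p) μ)
    (hY : MemLp Y (ENNReal.ofReal p) μ) :
    HasDerivAt (fun t : ℝ => ∫ x, ‖X x + t • Y x‖ ^ p ∂μ)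
      (p * ∫ x, ‖X x‖ ^ (p - 2) * inner ℝ (X x) (Y x) ∂μ) 0 := by
  have hp0 : 0 < p := by linarith
  have hInt : ∀ {f : α → V}, MemLp f (ENNReal.ofReal p) μ → Integrable (fun x => ‖f x‖ ^ p) μ :=
    fun hf => by
      have := hf.integrable_norm_rpow (by simpa using hp0) ENNReal.ofReal_ne_top
      rwa [ENNReal.toReal_ofReal hp0.le] at this
  have hXY : ∀ t : ℝ, MemLp (fun x => X x + t • Y x) (ENNReal.ofReal p) μ := fun t =>
    hX.add (hY.const_smul t)
  set F' : ℝ → α → ℝ := fun t x =>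
    p * ‖X x + t • Y x‖ ^ (p - 2) * inner ℝ (X x + t • Y x) (Y x) with hF'
  have hder : ∀ x t, HasDerivAt (fun t : ℝ => ‖X x + t • Y x‖ ^ p) (F' t x) t := by
    intro x t
    have hline : HasDerivAt (fun t : ℝ => X x + t • Y x) (Y x) t := by
      simpa using ((hasDerivAt_id t).smul_const (Y x)).const_add (X x)
    have := (hasFDerivAt_norm_rpow (X x + t • Y x) hp).comp_hasDerivAt t hline
    refine HasDerivAt.congr_deriv this ?_
    rw [_root_.smul_apply, innerSL_apply_apply, smul_eq_mul]
  have hbound : ∀ x, ∀ t ∈ Metric.ball (0 : ℝ) 1, ‖F' t x‖ ≤ p * (‖X x‖ + ‖Y x‖) ^ p := by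
    intro x t ht
    have ht' : |t| ≤ 1 := by simpa using (Metric.mem_ball.1 ht).le
    have h1 : ‖X x + t • Y x‖ ≤ ‖X x‖ + ‖Y x‖ := by
      refine (norm_add_le _ _).trans (add_le_add le_rfl ?_)
      rw [norm_smul]
      exact mul_le_of_le_one_left (norm_nonneg _) ht'
    have h2 : ‖F' t x‖ ≤ p * (‖X x + t • Y x‖ ^ (p - 1) * ‖Y x‖) := by
      rw [hF']; simp only
      rw [norm_mul, norm_mul, Real.norm_of_nonneg hp0.le,
        Real.norm_of_nonneg (by positivity : 0 ≤ ‖X x + t • Y x‖ ^ (p - 2)), mul_assoc]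
      refine mul_le_mul_of_nonneg_left ?_ hp0.le
      have h3 := norm_inner_le_norm (𝕜 := ℝ) (X x + t • Y x) (Y x)
      rcases (norm_nonneg (X x + t • Y x)).eq_or_lt with h0 | h0
      · rw [← h0, zero_mul] at h3
        have : ‖inner ℝ (X x + t • Y x) (Y x)‖ = 0 := le_antisymm h3 (norm_nonneg _)
        rw [this, mul_zero]; positivity
      · calc _ ≤ ‖X x + t • Y x‖ ^ (p - 2) * (‖X x + t • Y x‖ * ‖Y x‖) := by gcongr
          _ = _ := by
            rw [← mul_assoc, ← Real.rpow_add_one h0.ne', show p - 2 + 1 = p - 1 by ring]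
    refine h2.trans (mul_le_mul_of_nonneg_left ?_ hp0.le)
    have h4 : (‖X x‖ + ‖Y x‖) ^ p = (‖X x‖ + ‖Y x‖) ^ (p - 1) * (‖X x‖ + ‖Y x‖) := by
      rw [← Real.rpow_add_one' (by positivity) (by linarith), sub_add_cancel]
    rw [h4]
    refine mul_le_mul (Real.rpow_le_rpow (norm_nonneg _) h1 (by linarith)) ?_ (norm_nonneg _)
      (by positivity)
    linarith [norm_nonneg (X x)]
  have hbint : Integrable (fun x => p * (‖X x‖ + ‖Y x‖) ^ p) μ := by
    have h1 : MemLp (fun x => ‖X x‖ + ‖Y x‖) (ENNReal.ofReal p) μ := hX.norm.add hY.norm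
    have h2 := h1.integrable_norm_rpow (by simpa using hp0) ENNReal.ofReal_ne_top
    rw [ENNReal.toReal_ofReal hp0.le] at h2
    refine (h2.const_mul p).congr (ae_of_all _ fun x => ?_)
    simp only
    rw [Real.norm_of_nonneg (by positivity)]
  have hmeas : AEStronglyMeasurable (F' 0) μ := by
    have h0 := (hXY 0).1
    have hn : AEStronglyMeasurable (fun x => ‖X x + (0 : ℝ) • Y x‖ ^ (p - 2)) μ :=
      (h0.norm.aemeasurable.pow_const _).aestronglyMeasurable
    exact (hn.const_mul p).mul (h0.inner hY.1)
  have := (hasDerivAt_integral_of_dominated_loc_of_deriv_le (Metric.ball_mem_nhds (0 : ℝ) one_pos)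
    (Eventually.of_forall fun t => (hInt (hXY t)).1) (hInt (hXY 0)) hmeas
    (ae_of_all _ hbound) hbint (ae_of_all _ fun x t _ => hder x t)).2
  refine this.congr_deriv ?_
  rw [← integral_const_mul]
  refine integral_congr_ae (ae_of_all _ fun x => ?_)
  simp only [hF', zero_smul, add_zero]
  ring

end

/-! ### The optimal embedding constant -/

section

variable {α F : Type*} [MeasurableSpace α] {μ : Measure α} [NormedAddCommGroup F]

lemma toReal_eLpNorm_rpow {p : ℝ} (hp : 0 < p) {f : α → F} (hf : MemLp f (ENNReal.ofReal p) μ) :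
    (eLpNorm f (ENNReal.ofReal p) μ).toReal ^ p = ∫ x, ‖f x‖ ^ p ∂μ := by
  have h0 : 0 ≤ ∫ x, ‖f x‖ ^ p ∂μ := integral_nonneg fun _ => by positivity
  rw [hf.eLpNorm_eq_integral_rpow_norm (by simpa using hp) ENNReal.ofReal_ne_top,
    ENNReal.toReal_ofReal hp.le, ENNReal.toReal_ofReal (by positivity), ← Real.rpow_mul h0,
    inv_mul_cancel₀ hp.ne', Real.rpow_one]

lemma toReal_eLpNorm_add_le {p : ℝ≥0∞} (hp : 1 ≤ p) {f g : α → F} (hf : MemLp f p μ)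
    (hg : MemLp g p μ) :
    (eLpNorm (f + g) p μ).toReal ≤ (eLpNorm f p μ).toReal + (eLpNorm g p μ).toReal := by
  rw [← ENNReal.toReal_add hf.2.ne hg.2.ne]
  exact ENNReal.toReal_mono (ENNReal.add_ne_top.2 ⟨hf.2.ne, hg.2.ne⟩) (eLpNorm_add_le hf.1 hg.1 hp)

lemma toReal_eLpNorm_const_smul [NormedSpace ℝ F] {p : ℝ≥0∞} (c : ℝ) (f : α → F) :
    (eLpNorm (c • f) p μ).toReal = |c| * (eLpNorm f p μ).toReal := by
  rw [eLpNorm_const_smul, ENNReal.toReal_mul]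
  simp

lemma exists_tendsto_of_cauchy [CompleteSpace F] {p : ℝ≥0∞} (hp : 1 ≤ p) {f : ℕ → α → F}
    (hf : ∀ n, MemLp (f n) p μ)
    (h : Tendsto (fun z : ℕ × ℕ => eLpNorm (f z.1 - f z.2) p μ) atTop (𝓝 0)) :
    ∃ g : Lp F p μ, Tendsto (fun n => eLpNorm (fun x => g x - f n x) p μ) atTop (𝓝 0) := by
  have : Fact (1 ≤ p) := ⟨hp⟩
  have hc : CauchySeq fun n => (hf n).toLp (f n) := by
    rw [cauchySeq_iff_tendsto_dist_atTop_0]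
    refine ((ENNReal.tendsto_toReal ENNReal.zero_ne_top).comp h).congr fun z => ?_
    rw [Function.comp_apply, dist_edist, Lp.edist_toLp_toLp]
  obtain ⟨g, hg⟩ := cauchySeq_tendsto_of_complete hc
  refine ⟨g, ?_⟩
  rw [tendsto_iff_edist_tendsto_0] at hg
  refine hg.congr fun n => ?_
  rw [edist_comm, Lp.edist_def]
  refine eLpNorm_congr_ae ?_
  filter_upwards [(hf n).coeFn_toLp] with x hx
  simp [hx]

lemma tendsto_toReal_eLpNorm {p : ℝ≥0∞} (hp : 1 ≤ p) {f : ℕ → α → F} {g : α → F}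
    (hf : ∀ n, MemLp (f n) p μ) (hg : MemLp g p μ)
    (h : Tendsto (fun n => eLpNorm (fun x => g x - f n x) p μ) atTop (𝓝 0)) :
    Tendsto (fun n => (eLpNorm (f n) p μ).toReal) atTop (𝓝 (eLpNorm g p μ).toReal) := by
  have : Fact (1 ≤ p) := ⟨hp⟩
  have h1 : Tendsto (fun n => (hf n).toLp (f n)) atTop (𝓝 (hg.toLp g)) := by
    rw [tendsto_iff_edist_tendsto_0]
    refine h.congr fun n => ?_
    rw [edist_comm, Lp.edist_toLp_toLp]
    rfl
  have h2 := h1.norm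
  simpa only [Lp.norm_toLp] using h2

lemma tendsto_pair_of_tendsto {p : ℝ≥0∞} (hp : 1 ≤ p) {f : ℕ → α → F} {g : α → F}
    (hf : ∀ n, MemLp (f n) p μ) (hg : MemLp g p μ)
    (h : Tendsto (fun n => eLpNorm (fun x => g x - f n x) p μ) atTop (𝓝 0)) :
    Tendsto (fun z : ℕ × ℕ => eLpNorm (f z.1 - f z.2) p μ) atTop (𝓝 0) := by
  rw [← prod_atTop_atTop_eq]
  have h1 := (h.comp (tendsto_snd (f := (atTop : Filter ℕ)) (g := (atTop : Filter ℕ)))).add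
    (h.comp (tendsto_fst (f := (atTop : Filter ℕ)) (g := (atTop : Filter ℕ))))
  rw [add_zero] at h1
  refine tendsto_of_tendsto_of_tendsto_of_le_of_le tendsto_const_nhds h1 (fun _ => zero_le)
    fun z => ?_
  have e : f z.1 - f z.2 = (fun x => g x - f z.2 x) - fun x => g x - f z.1 x := by
    ext x; simp
  rw [e]
  exact eLpNorm_sub_le (hg.sub (hf _)).1 (hg.sub (hf _)).1 hp

end

section

variable {N : ℕ} {Ω : Set (Space N)} {φ ψ : Space N → ℝ}

lemma exists_embedding (hΩb : Bornology.IsBounded Ω) {r : ℕ} (hr : 1 ≤ r) {m : ℝ} (hm : 1 < m)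
    (hN : r * m < N) {s : ℝ} (hs : 1 < s) (hs' : s < criticalExponent N r m) :
    ∃ K : NNReal, 0 < K ∧ ∀ φ : Space N → ℝ, IsTestFunction Ω φ →
      eLpNorm φ (ENNReal.ofReal s) (volume.restrict Ω) ≤
        K * eLpNorm (classicalDr r φ) (ENNReal.ofReal m) (volume.restrict Ω) := by
  have := isFiniteMeasure_restrict hΩb
  obtain ⟨C, hC⟩ := exists_apriori hΩb hr hm hN
  have hexp : 0 ≤ 1 / (ENNReal.ofReal s).toReal -
      1 / (ENNReal.ofReal (criticalExponent N r m)).toReal := by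
    rw [ENNReal.toReal_ofReal (by linarith), ENNReal.toReal_ofReal (by linarith)]
    have := one_div_le_one_div_of_le (by linarith : 0 < s) hs'.le
    linarith
  have hfin := ENNReal.rpow_ne_top_of_nonneg hexp (measure_ne_top (volume.restrict Ω) Set.univ)
  lift (volume.restrict Ω) Set.univ ^ (1 / (ENNReal.ofReal s).toReal -
      1 / (ENNReal.ofReal (criticalExponent N r m)).toReal) to NNReal using hfin with D hD
  refine ⟨C * D + 1, by positivity, fun φ hφ => ?_⟩
  have h1 := eLpNorm_le_eLpNorm_mul_rpow_measure_univ (μ := volume.restrict Ω)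
    (ENNReal.ofReal_le_ofReal hs'.le) (hφ.1.continuous.aestronglyMeasurable)
  rw [← hD] at h1
  refine h1.trans ((mul_le_mul_left (hC φ hφ).2 _).trans ?_)
  push_cast
  rw [add_mul, mul_right_comm]
  exact le_self_add

/-- The approximants are Cauchy in `L^s` because their `D_r` are Cauchy in `L^m`. The `L^s` limit is
identified with `u` by comparing both in `L¹`. -/
lemma Approx.tendsto_embedding (hΩ : IsOpen Ω) (hΩb : Bornology.IsBounded Ω) {r : ℕ} {m : ℝ}
    (hm : 1 ≤ m) {s : ℝ} (hs : 1 ≤ s) {K : NNReal}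
    (hK : ∀ φ : Space N → ℝ, IsTestFunction Ω φ →
      eLpNorm φ (ENNReal.ofReal s) (volume.restrict Ω) ≤
        K * eLpNorm (classicalDr r φ) (ENNReal.ofReal m) (volume.restrict Ω))
    {φ : ℕ → Space N → ℝ} {u : Space N → ℝ} (hu : Approx Ω r m u φ) :
    MemLp u (ENNReal.ofReal s) (volume.restrict Ω) ∧
      Tendsto (fun n => eLpNorm (fun x => u x - φ n x) (ENNReal.ofReal s) (volume.restrict Ω))
        atTop (𝓝 0) := by
  have := isFiniteMeasure_restrict hΩb
  have hpm : 1 ≤ ENNReal.ofReal m := by simpa using hm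
  have hps : 1 ≤ ENNReal.ofReal s := by simpa using hs
  obtain ⟨h1, h2⟩ := hu.weakDr hΩ hΩb hm
  have h3 := tendsto_pair_of_tendsto hpm (fun n => memLp_classicalDr r (hu.test n) _ _) h1 h2
  have h4 : Tendsto (fun z : ℕ × ℕ => eLpNorm (φ z.1 - φ z.2) (ENNReal.ofReal s)
      (volume.restrict Ω)) atTop (𝓝 0) := by
    have h5 := ENNReal.Tendsto.const_mul (a := (K : ℝ≥0∞)) h3 (Or.inr ENNReal.coe_ne_top)
    rw [mul_zero] at h5
    refine tendsto_of_tendsto_of_tendsto_of_le_of_le tendsto_const_nhds h5 (fun _ => zero_le)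
      fun z => ?_
    have ht := (hu.test z.1).add ((hu.test z.2).const_smul (-1))
    have e1 : φ z.1 - φ z.2 = φ z.1 + (-1 : ℝ) • φ z.2 := by
      ext x; simp [sub_eq_add_neg]
    have e2 : classicalDr r (φ z.1) - classicalDr r (φ z.2) =
        classicalDr r (φ z.1 + (-1 : ℝ) • φ z.2) := by
      rw [classicalDr_add r (hu.test _) ((hu.test _).const_smul _),
        classicalDr_const_smul r _ (hu.test _)]
      ext1 x
      simp [sub_eq_add_neg]
    rw [e1]
    simp only [e2]
    exact hK _ ht
  obtain ⟨g, hg⟩ := exists_tendsto_of_cauchy hps (fun n => (hu.test n).memLp _ _) h4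
  have hg1 := tendsto_eLpNorm_of_le (fun n => ((Lp.memLp g).sub ((hu.test n).memLp _ _)).1)
    hps one_ne_zero hg
  have hu1 := tendsto_eLpNorm_of_le (fun n => (hu.memLp_self.sub ((hu.test n).memLp _ _)).1)
    hpm one_ne_zero (hu.tendsto_self hΩ hΩb hm)
  have hae : u =ᵐ[volume.restrict Ω] g := ae_eq_of_tendsto_eLpNorm le_rfl
    (fun n => (hu.test n).memLp 1 _) (hu.memLp_self.mono_exponent hpm)
    ((Lp.memLp g).mono_exponent hps) hu1 hg1
  refine ⟨(memLp_congr_ae hae).2 (Lp.memLp g), hg.congr fun n => eLpNorm_congr_ae ?_⟩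
  filter_upwards [hae] with x hx
  rw [hx]

/-! ### The variational problem and its extremal -/

/-- The `L^m` norm of the classical `D_r φ`. -/
def classicalNorm (Ω : Set (Space N)) (r : ℕ) (m : ℝ) (φ : Space N → ℝ) : ℝ :=
  (eLpNorm (classicalDr r φ) (ENNReal.ofReal m) (volume.restrict Ω)).toReal

/-- The `L^m` norm of the weak `D_r u`. -/
def weakNorm (Ω : Set (Space N)) (r : ℕ) (m : ℝ) (u : Space N → ℝ) : ℝ :=
  (eLpNorm (weakDr Ω r u) (ENNReal.ofReal m) (volume.restrict Ω)).toReal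

/-- The `L^s` norm. -/
def lebesgueNorm (Ω : Set (Space N)) (s : ℝ) (u : Space N → ℝ) : ℝ :=
  (eLpNorm u (ENNReal.ofReal s) (volume.restrict Ω)).toReal

lemma classicalNorm_nonneg (Ω : Set (Space N)) (r : ℕ) (m : ℝ) (φ : Space N → ℝ) :
    0 ≤ classicalNorm Ω r m φ := ENNReal.toReal_nonneg

lemma weakNorm_nonneg (Ω : Set (Space N)) (r : ℕ) (m : ℝ) (u : Space N → ℝ) :
    0 ≤ weakNorm Ω r m u := ENNReal.toReal_nonneg

lemma lebesgueNorm_nonneg (Ω : Set (Space N)) (s : ℝ) (u : Space N → ℝ) :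
    0 ≤ lebesgueNorm Ω s u := ENNReal.toReal_nonneg

lemma classicalNorm_const_smul (r : ℕ) (m c : ℝ) (hφ : IsTestFunction Ω φ) :
    classicalNorm Ω r m (c • φ) = |c| * classicalNorm Ω r m φ := by
  rw [classicalNorm, classicalDr_const_smul r c hφ, toReal_eLpNorm_const_smul]; rfl

lemma exists_test_lebesgueNorm_pos (hΩ : IsOpen Ω) (hΩne : Ω.Nonempty) {s : ℝ} (hs : 1 ≤ s) :
    ∃ φ, IsTestFunction Ω φ ∧ 0 < lebesgueNorm Ω s φ := by
  obtain ⟨x, hx⟩ := hΩne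
  obtain ⟨φ, h1, h2, h3, -, h5⟩ :=
    exists_contDiff_tsupport_subset (E := Space N) (n := (⊤ : ℕ∞)) (hΩ.mem_nhds hx)
  have hφ : IsTestFunction Ω φ := ⟨h3, h2, h1⟩
  refine ⟨φ, hφ, ?_⟩
  have hm : MemLp φ (ENNReal.ofReal s) volume := hφ.memLp _ _
  rw [lebesgueNorm, eLpNorm_restrict_of_support hφ.support_subset]
  refine ENNReal.toReal_pos (fun h0 => ?_) hm.2.ne
  rw [eLpNorm_eq_zero_iff hm.1 (by simp; linarith)] at h0
  have := (h3.continuous.ae_eq_iff_eq volume continuous_zero).1 h0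
  rw [this] at h5
  simp at h5

/-- The infimum is taken over test functions, where all derivatives are classical;
`exists_optimal_constant` passes to the limit. Positivity of `d` is the embedding, and the Cauchy
property in energy is the midpoint argument. -/
lemma exists_minimizing_sequence (hΩ : IsOpen Ω) (hΩb : Bornology.IsBounded Ω) (hΩne : Ω.Nonempty)
    {r : ℕ} (hr : 1 ≤ r) {m : ℝ} (hm : 1 < m) (hN : r * m < N) {s : ℝ} (hs : 1 < s)
    (hs' : s < criticalExponent N r m) :
    ∃ d : ℝ, 0 < d ∧ (∀ φ, IsTestFunction Ω φ → d * lebesgueNorm Ω s φ ≤ classicalNorm Ω r m φ) ∧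
      ∃ φ : ℕ → Space N → ℝ, (∀ n, IsTestFunction Ω (φ n)) ∧ (∀ n, lebesgueNorm Ω s (φ n) = 1) ∧
        Tendsto (fun n => classicalNorm Ω r m (φ n)) atTop (𝓝 d) ∧
        Tendsto (fun z : ℕ × ℕ => classicalNorm Ω r m (φ z.1 - φ z.2)) atTop (𝓝 0) := by
  have := isFiniteMeasure_restrict hΩb
  have hm0 : 0 < m := by linarith
  have hs0 : 0 < s := by linarith
  have hpm : 1 ≤ ENNReal.ofReal m := by simpa using hm.le
  have hps : 1 ≤ ENNReal.ofReal s := by simpa using hs.le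
  obtain ⟨K, hK0, hK⟩ := exists_embedding hΩb hr hm hN hs hs'
  have hKr : ∀ φ, IsTestFunction Ω φ → lebesgueNorm Ω s φ ≤ K * classicalNorm Ω r m φ := by
    intro φ hφ
    have h1 := ENNReal.toReal_mono (ENNReal.mul_ne_top ENNReal.coe_ne_top
      (memLp_classicalDr r hφ (ENNReal.ofReal m) _).2.ne) (hK φ hφ)
    rwa [ENNReal.toReal_mul] at h1
  set S : Set ℝ := {t | ∃ φ, IsTestFunction Ω φ ∧ lebesgueNorm Ω s φ = 1 ∧
    classicalNorm Ω r m φ = t} with hS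
  have hscale : ∀ φ, IsTestFunction Ω φ → 0 < lebesgueNorm Ω s φ →
      (lebesgueNorm Ω s φ)⁻¹ * classicalNorm Ω r m φ ∈ S := by
    intro φ hφ h0
    refine ⟨(lebesgueNorm Ω s φ)⁻¹ • φ, hφ.const_smul _, ?_, ?_⟩
    · rw [lebesgueNorm, toReal_eLpNorm_const_smul, abs_of_pos (inv_pos.2 h0)]
      exact inv_mul_cancel₀ h0.ne'
    · rw [classicalNorm_const_smul r m _ hφ, abs_of_pos (inv_pos.2 h0)]
  obtain ⟨φ₀, hφ₀, hφ₀'⟩ := exists_test_lebesgueNorm_pos hΩ hΩne hs.le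
  have hSne : S.Nonempty := ⟨_, hscale φ₀ hφ₀ hφ₀'⟩
  have hSlb : ∀ t ∈ S, (K : ℝ)⁻¹ ≤ t := by
    rintro t ⟨φ, hφ, h1, rfl⟩
    have := hKr φ hφ
    rw [h1] at this
    rw [inv_le_iff_one_le_mul₀ (by exact_mod_cast hK0)]
    linarith
  have hSbdd : BddBelow S := ⟨_, fun t ht => hSlb t ht⟩
  set d := sInf S with hd
  have hd0 : 0 < d := lt_of_lt_of_le (inv_pos.2 (by exact_mod_cast hK0)) (le_csInf hSne hSlb)
  have hineq : ∀ φ, IsTestFunction Ω φ → d * lebesgueNorm Ω s φ ≤ classicalNorm Ω r m φ := by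
    intro φ hφ
    rcases (lebesgueNorm_nonneg Ω s φ).eq_or_lt with h | h
    · rw [← h, mul_zero]; exact classicalNorm_nonneg _ _ _ _
    · have := csInf_le hSbdd (hscale φ hφ h)
      rwa [inv_mul_eq_div, le_div_iff₀ h] at this
  obtain ⟨t, -, ht, htS⟩ := exists_seq_tendsto_sInf hSne hSbdd
  choose φ' hφ' hφ1' hφt using htS
  have htend' : Tendsto (fun n => classicalNorm Ω r m (φ' n)) atTop (𝓝 d) := by
    simpa only [hφt] using ht
  obtain ⟨B, hB⟩ := htend'.bddAbove_range
  have hB' : ∀ n, eLpNorm (classicalDr r (φ' n)) (ENNReal.ofReal m) (volume.restrict Ω) ≤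
      (Real.toNNReal B : NNReal) := by
    intro n
    rw [← ENNReal.ofReal_toReal (memLp_classicalDr r (hφ' n) (ENNReal.ofReal m) _).2.ne]
    exact ENNReal.ofReal_le_ofReal (hB ⟨n, rfl⟩)
  obtain ⟨σ, hσ, hcau⟩ := exists_subseq_cauchy hΩb hr hm hN hs hs' hφ' hB'
  set φ : ℕ → Space N → ℝ := fun n => φ' (σ n) with hφdef
  have hφ : ∀ n, IsTestFunction Ω (φ n) := fun n => hφ' _
  have htend : Tendsto (fun n => classicalNorm Ω r m (φ n)) atTop (𝓝 d) :=
    htend'.comp hσ.tendsto_atTop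
  refine ⟨d, hd0, hineq, φ, hφ, fun n => hφ1' _, htend, ?_⟩
  have e1 : ∀ a b, φ a - φ b = φ a + (-1 : ℝ) • φ b := fun a b => by
    ext x; simp [sub_eq_add_neg]
  have hsubt : ∀ a b, IsTestFunction Ω (φ a - φ b) := fun a b => by
    rw [e1]; exact (hφ a).add ((hφ b).const_smul _)
  have hLs : Tendsto (fun z : ℕ × ℕ => lebesgueNorm Ω s (φ z.1 - φ z.2)) atTop (𝓝 0) := by
    have h1 : Tendsto (fun z : ℕ × ℕ => ∫ x, |φ z.1 x - φ z.2 x| ^ s) atTop (𝓝 0) := by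
      rw [Metric.tendsto_atTop]
      intro ε hε
      obtain ⟨n₀, hn₀⟩ := hcau (ε / 2) (by positivity)
      refine ⟨(n₀, n₀), fun z hz => ?_⟩
      have h2 := hn₀ z.1 hz.1 z.2 hz.2
      have h3 : 0 ≤ ∫ x, |φ z.1 x - φ z.2 x| ^ s := integral_nonneg fun x => by positivity
      rw [dist_zero_right, Real.norm_of_nonneg h3]
      linarith
    have h2 := h1.rpow_const (p := s⁻¹) (Or.inr (by positivity))
    rw [Real.zero_rpow (by positivity)] at h2
    refine h2.congr fun z => ?_
    have hmem := (hsubt z.1 z.2).memLp (ENNReal.ofReal s) volume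
    rw [lebesgueNorm, eLpNorm_restrict_of_support (hsubt _ _).support_subset]
    have h3 := toReal_eLpNorm_rpow hs0 hmem
    simp only [Real.norm_eq_abs, Pi.sub_apply] at h3
    rw [← h3, ← Real.rpow_mul ENNReal.toReal_nonneg, mul_inv_cancel₀ hs0.ne', Real.rpow_one]
  -- The midpoint differs from the normalised `φ a` by half the difference, so its `L^s` norm is
  -- nearly one and its energy norm nearly at least `d`.
  have hmid : ∀ a b, d * (1 - lebesgueNorm Ω s (φ a - φ b) / 2) ≤
      classicalNorm Ω r m ((2 : ℝ)⁻¹ • (φ a + φ b)) := by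
    intro a b
    refine le_trans ?_ (hineq _ (((hφ a).add (hφ b)).const_smul _))
    refine mul_le_mul_of_nonneg_left ?_ hd0.le
    have e : φ a = (2 : ℝ)⁻¹ • (φ a + φ b) + (2 : ℝ)⁻¹ • (φ a - φ b) := by
      ext x; simp only [Pi.add_apply, Pi.smul_apply, Pi.sub_apply, smul_eq_mul]; ring
    have h1 : lebesgueNorm Ω s (φ a) ≤ lebesgueNorm Ω s ((2 : ℝ)⁻¹ • (φ a + φ b)) +
        lebesgueNorm Ω s ((2 : ℝ)⁻¹ • (φ a - φ b)) := by
      conv_lhs => rw [e]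
      exact toReal_eLpNorm_add_le hps ((((hφ a).add (hφ b)).const_smul _).memLp _ _)
        (((hsubt a b).const_smul _).memLp _ _)
    have h2 : lebesgueNorm Ω s ((2 : ℝ)⁻¹ • (φ a - φ b)) = 2⁻¹ * lebesgueNorm Ω s (φ a - φ b) := by
      rw [lebesgueNorm, toReal_eLpNorm_const_smul, abs_of_pos (by norm_num : (0 : ℝ) < 2⁻¹)]
      rfl
    have h3 : lebesgueNorm Ω s (φ a) = 1 := hφ1' _
    linarith
  have hpow : ∀ {ψ : Space N → ℝ}, IsTestFunction Ω ψ → classicalNorm Ω r m ψ ^ m =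
      ∫ x in Ω, ‖classicalDr r ψ x‖ ^ m := fun hψ =>
    toReal_eLpNorm_rpow hm0 (memLp_classicalDr r hψ _ _)
  have hfst : Tendsto (fun z : ℕ × ℕ => classicalNorm Ω r m (φ z.1) ^ m) atTop (𝓝 (d ^ m)) := by
    rw [← prod_atTop_atTop_eq]
    exact (htend.comp tendsto_fst).rpow_const (Or.inr hm0.le)
  have hsnd : Tendsto (fun z : ℕ × ℕ => classicalNorm Ω r m (φ z.2) ^ m) atTop (𝓝 (d ^ m)) := by
    rw [← prod_atTop_atTop_eq]
    exact (htend.comp tendsto_snd).rpow_const (Or.inr hm0.le)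
  -- The maximum with zero keeps the base nonnegative, so that the lower bound may be raised to the
  -- power `m`.
  have hlow : Tendsto (fun z : ℕ × ℕ =>
      (d * max (1 - lebesgueNorm Ω s (φ z.1 - φ z.2) / 2) 0) ^ m) atTop (𝓝 (d ^ m)) := by
    have h1 := (((hLs.div_const 2).const_sub 1).max (tendsto_const_nhds (x := (0 : ℝ)))).const_mul d
    have h2 := h1.rpow_const (p := m) (Or.inr hm0.le)
    simpa using h2
  have hpowlim : Tendsto (fun z : ℕ × ℕ => classicalNorm Ω r m (φ z.1 - φ z.2) ^ m)
      atTop (𝓝 0) := by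
    rw [Metric.tendsto_nhds]
    intro η hη
    -- In the limit the midpoint defect vanishes and only `2 ε d^m`, which is below `η / 2`, is
    -- left.
    set ε : ℝ := η / (2 * (2 * d ^ m + 1)) with hε
    have hε0 : 0 < ε := by positivity
    obtain ⟨C, hC0, hC⟩ := exists_uniform_convexity (V := DrSpace N) hm hε0
    have hub := ((hfst.add hsnd).const_mul ε).add
      ((((hfst.add hsnd).div_const 2).sub hlow).const_mul C)
    have hval : ε * (d ^ m + d ^ m) + C * ((d ^ m + d ^ m) / 2 - d ^ m) < η := by
      have h1 : ε * (2 * d ^ m + 1) = η / 2 := by rw [hε]; field_simp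
      have h2 : C * ((d ^ m + d ^ m) / 2 - d ^ m) = 0 := by ring
      rw [h2]
      nlinarith
    filter_upwards [hub.eventually_lt_const hval] with z hz
    rw [dist_zero_right, Real.norm_of_nonneg (Real.rpow_nonneg (classicalNorm_nonneg _ _ _ _) _)]
    refine lt_of_le_of_lt ?_ hz
    have h1 := integral_uniform_convexity hm0 hC
      (memLp_classicalDr r (hφ z.1) (ENNReal.ofReal m) (volume.restrict Ω))
      (memLp_classicalDr r (hφ z.2) (ENNReal.ofReal m) (volume.restrict Ω))
    have e2 : ∀ x, classicalDr r (φ z.1) x - classicalDr r (φ z.2) x =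
        classicalDr r (φ z.1 - φ z.2) x := fun x => by
      rw [e1, classicalDr_add r (hφ _) ((hφ _).const_smul _), classicalDr_const_smul r _ (hφ _)]
      simp [sub_eq_add_neg]
    have e3 : ∀ x, (2 : ℝ)⁻¹ • (classicalDr r (φ z.1) x + classicalDr r (φ z.2) x) =
        classicalDr r ((2 : ℝ)⁻¹ • (φ z.1 + φ z.2)) x := fun x => by
      rw [classicalDr_const_smul r _ ((hφ _).add (hφ _)), classicalDr_add r (hφ _) (hφ _)]
      rfl
    simp only [e2, e3] at h1
    rw [← hpow (hφ _), ← hpow (hφ _), ← hpow (hsubt _ _),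
      ← hpow (((hφ _).add (hφ _)).const_smul _)] at h1
    refine h1.trans (add_le_add le_rfl (mul_le_mul_of_nonneg_left (sub_le_sub_left ?_ _) hC0.le))
    refine Real.rpow_le_rpow (mul_nonneg hd0.le (le_max_right _ _)) ?_ hm0.le
    rcases le_total (1 - lebesgueNorm Ω s (φ z.1 - φ z.2) / 2) 0 with h | h
    · rw [max_eq_right h, mul_zero]; exact classicalNorm_nonneg _ _ _ _
    · rw [max_eq_left h]; exact hmid _ _
  have h2 := hpowlim.rpow_const (p := m⁻¹) (Or.inr (by positivity))
  rw [Real.zero_rpow (by positivity)] at h2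
  refine h2.congr fun z => ?_
  rw [← Real.rpow_mul (classicalNorm_nonneg _ _ _ _), mul_inv_cancel₀ hm0.ne', Real.rpow_one]

/-- The optimal constant in the embedding inequality is positive and attained. -/
theorem exists_optimal_constant (hΩ : IsOpen Ω) (hΩb : Bornology.IsBounded Ω) (hΩne : Ω.Nonempty)
    {r : ℕ} (hr : 1 ≤ r) {m : ℝ} (hm : 1 < m) (hN : r * m < N) {s : ℝ} (hs : 1 < s)
    (hs' : s < criticalExponent N r m) :
    ∃ d : ℝ, 0 < d ∧
      (∀ u : LmSpace Ω m, u ∈ sobolevZero Ω r m →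
        MemLp u (ENNReal.ofReal s) (volume.restrict Ω) ∧
        d * lebesgueNorm Ω s u ≤ weakNorm Ω r m u) ∧
      ∃ u : LmSpace Ω m, u ∈ sobolevZero Ω r m ∧ u ≠ 0 ∧
        weakNorm Ω r m u = d * lebesgueNorm Ω s u := by
  have := isFiniteMeasure_restrict hΩb
  have hpm : 1 ≤ ENNReal.ofReal m := by simpa using hm.le
  have hps : 1 ≤ ENNReal.ofReal s := by simpa using hs.le
  obtain ⟨K, hK0, hK⟩ := exists_embedding hΩb hr hm hN hs hs'
  obtain ⟨d, hd0, hineq, φ, hφ, hφ1, htend, hcau⟩ :=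
    exists_minimizing_sequence hΩ hΩb hΩne hr hm hN hs hs'
  have hlim : ∀ {u : Space N → ℝ} {φ : ℕ → Space N → ℝ}, Approx Ω r m u φ →
      Tendsto (fun n => lebesgueNorm Ω s (φ n)) atTop (𝓝 (lebesgueNorm Ω s u)) ∧
      Tendsto (fun n => classicalNorm Ω r m (φ n)) atTop (𝓝 (weakNorm Ω r m u)) := by
    intro u φ hu
    obtain ⟨h1, h2⟩ := hu.tendsto_embedding hΩ hΩb hm.le hs.le hK
    obtain ⟨h3, h4⟩ := hu.weakDr hΩ hΩb hm.le
    exact ⟨tendsto_toReal_eLpNorm hps (fun n => (hu.test n).memLp _ _) h1 h2,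
      tendsto_toReal_eLpNorm hpm (fun n => memLp_classicalDr r (hu.test n) _ _) h3 h4⟩
  refine ⟨d, hd0, fun u hu => ?_, ?_⟩
  · obtain ⟨ψ, hψ⟩ := (mem_sobolevZero_iff hΩ).1 hu
    refine ⟨(hψ.tendsto_embedding hΩ hΩb hm.le hs.le hK).1, ?_⟩
    obtain ⟨h1, h2⟩ := hlim hψ
    exact le_of_tendsto_of_tendsto' (h1.const_mul d) h2 fun n => hineq _ (hψ.test n)
  · obtain ⟨C, hC⟩ := exists_apriori hΩb hr hm hN
    have e1 : ∀ a b, φ a - φ b = φ a + (-1 : ℝ) • φ b := fun a b => by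
      ext x; simp [sub_eq_add_neg]
    have hsubt : ∀ a b, IsTestFunction Ω (φ a - φ b) := fun a b => by
      rw [e1]; exact (hφ a).add ((hφ b).const_smul _)
    have hcauE : Tendsto (fun z : ℕ × ℕ => eLpNorm (classicalDr r (φ z.1 - φ z.2))
        (ENNReal.ofReal m) (volume.restrict Ω)) atTop (𝓝 0) := by
      have := ENNReal.tendsto_ofReal hcau
      rw [ENNReal.ofReal_zero] at this
      exact this.congr fun z => ENNReal.ofReal_toReal (memLp_classicalDr r (hsubt _ _) _ _).2.ne
    -- By the a priori estimate every derivative of order at most `r` is Cauchy in `L^m`. The limit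
    -- `g []` will be the extremal; orders above `r` get the value zero.
    have hder : ∀ I : List (Fin N), ∃ g : LmSpace Ω m, I.length ≤ r →
        Tendsto (fun n => eLpNorm (fun x => g x - classicalDeriv I (φ n) x)
          (ENNReal.ofReal m) (volume.restrict Ω)) atTop (𝓝 0) := by
      intro I
      by_cases hI : I.length ≤ r
      · have h1 := ENNReal.Tendsto.const_mul (a := (C : ℝ≥0∞)) hcauE (Or.inr ENNReal.coe_ne_top)
        rw [mul_zero] at h1
        have h2 : Tendsto (fun z : ℕ × ℕ => eLpNorm (classicalDeriv I (φ z.1) -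
            classicalDeriv I (φ z.2)) (ENNReal.ofReal m) (volume.restrict Ω)) atTop (𝓝 0) := by
          refine tendsto_of_tendsto_of_tendsto_of_le_of_le tendsto_const_nhds h1
            (fun _ => zero_le) fun z => ?_
          have e2 : classicalDeriv I (φ z.1) - classicalDeriv I (φ z.2) =
              classicalDeriv I (φ z.1 - φ z.2) := by
            rw [e1, classicalDeriv_add (hφ _).1 ((hφ _).const_smul _).1,
              classicalDeriv_const_smul _ (hφ _).1]
            ext x; simp [sub_eq_add_neg]
          simp only [e2]
          exact (hC _ (hsubt _ _)).1 I hI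
        obtain ⟨g, hg⟩ := exists_tendsto_of_cauchy hpm
          (fun n => ((hφ n).classicalDeriv I).memLp _ _) h2
        exact ⟨g, fun _ => hg⟩
      · exact ⟨0, fun h => absurd h hI⟩
    choose g hg using hder
    have happ : Approx Ω r m (g []) φ := (approx_of_tendsto hΩ hΩb hm.le hφ
      (g := fun I => g I) (ae_eq_refl _) fun I hI => ⟨Lp.memLp _, hg I hI⟩).1
    obtain ⟨h1, h2⟩ := hlim happ
    have h3 : lebesgueNorm Ω s (g []) = 1 :=
      tendsto_nhds_unique h1 (by simp only [hφ1]; exact tendsto_const_nhds)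
    have h4 : weakNorm Ω r m (g []) = d := tendsto_nhds_unique h2 htend
    refine ⟨g [], (mem_sobolevZero_iff hΩ).2 ⟨φ, happ⟩, fun h0 => ?_, by rw [h3, h4, mul_one]⟩
    have h5 : lebesgueNorm Ω s (g []) = 0 := by
      rw [lebesgueNorm, h0, eLpNorm_congr_ae (Lp.coeFn_zero _ _ _)]
      simp
    rw [h3] at h5
    exact one_ne_zero h5

end

/-! ### The quotient and its minimizers -/

section

variable {N : ℕ} {Ω : Set (Space N)} {r : ℕ} {m : ℝ}

lemma memLp_weakDr (hΩ : IsOpen Ω) (hΩb : Bornology.IsBounded Ω) (hm : 1 ≤ m) {u : LmSpace Ω m}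
    (hu : u ∈ sobolevZero Ω r m) : MemLp (weakDr Ω r u) (ENNReal.ofReal m) (volume.restrict Ω) := by
  obtain ⟨φ, hφ⟩ := (mem_sobolevZero_iff hΩ).1 hu
  exact (hφ.weakDr hΩ hΩb hm).1

lemma coeFn_add_smul (u v : LmSpace Ω m) (c : ℝ) :
    ((u + c • v : LmSpace Ω m) : Space N → ℝ) =ᵐ[volume.restrict Ω]
      (u : Space N → ℝ) + c • (v : Space N → ℝ) := by
  filter_upwards [Lp.coeFn_add u (c • v), Lp.coeFn_smul c v] with x h1 h2
  rw [h1, Pi.add_apply, Pi.add_apply, h2]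

lemma sobolevZero_add_smul (hΩ : IsOpen Ω) (hΩb : Bornology.IsBounded Ω) (hm : 1 ≤ m)
    {u v : LmSpace Ω m} (hu : u ∈ sobolevZero Ω r m) (hv : v ∈ sobolevZero Ω r m) (c : ℝ) :
    u + c • v ∈ sobolevZero Ω r m ∧ weakDr Ω r (u + c • v : LmSpace Ω m) =ᵐ[volume.restrict Ω]
      fun x => weakDr Ω r u x + c • weakDr Ω r v x := by
  obtain ⟨φ, hφ⟩ := (mem_sobolevZero_iff hΩ).1 hu
  obtain ⟨ψ, hψ⟩ := (mem_sobolevZero_iff hΩ).1 hv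
  have h := coeFn_add_smul u v c
  exact ⟨(mem_sobolevZero_iff hΩ).2 ⟨_, hφ.add_smul hΩ hΩb hm hψ c h⟩,
    weakDr_add_smul_ae hΩ hΩb hm hφ hψ c h⟩

lemma sobolevZero_smul (hΩ : IsOpen Ω) (hΩb : Bornology.IsBounded Ω) (hm : 1 ≤ m)
    {u : LmSpace Ω m} (hu : u ∈ sobolevZero Ω r m) (c : ℝ) :
    c • u ∈ sobolevZero Ω r m ∧
      weakNorm Ω r m (c • u : LmSpace Ω m) = |c| * weakNorm Ω r m u := by
  have e : c • u = u + (c - 1) • u := by rw [sub_smul, one_smul]; abel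
  obtain ⟨h1, h2⟩ := sobolevZero_add_smul hΩ hΩb hm hu hu (c - 1)
  rw [← e] at h1 h2
  refine ⟨h1, ?_⟩
  rw [weakNorm, weakNorm, ← toReal_eLpNorm_const_smul]
  congr 1
  refine eLpNorm_congr_ae (h2.trans (Eventually.of_forall fun x => ?_))
  simp only [Pi.smul_apply]
  rw [sub_smul, one_smul]
  abel

lemma lebesgueNorm_smul (s c : ℝ) (u : LmSpace Ω m) :
    lebesgueNorm Ω s (c • u : LmSpace Ω m) = |c| * lebesgueNorm Ω s u := by
  rw [lebesgueNorm, lebesgueNorm, ← toReal_eLpNorm_const_smul, eLpNorm_congr_ae (Lp.coeFn_smul c u)]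

lemma lebesgueNorm_pos {s : ℝ} (hs : 0 < s) {u : LmSpace Ω m}
    (hu : MemLp u (ENNReal.ofReal s) (volume.restrict Ω)) (h0 : u ≠ 0) :
    0 < lebesgueNorm Ω s u := by
  refine ENNReal.toReal_pos (fun h => h0 ?_) hu.2.ne
  rw [eLpNorm_eq_zero_iff hu.1 (by simpa using hs)] at h
  exact (Lp.eq_zero_iff_ae_eq_zero).2 h

lemma energy_eq_weakNorm (hm : 0 < m) {u : Space N → ℝ}
    (hu : MemLp (weakDr Ω r u) (ENNReal.ofReal m) (volume.restrict Ω)) :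
    energy Ω r m u = weakNorm Ω r m u ^ m := by
  rw [weakNorm, toReal_eLpNorm_rpow hm hu, energy]
  simp only [norm_weakDr]

lemma integral_eq_lebesgueNorm {s : ℝ} (hs : 0 < s) {u : Space N → ℝ}
    (hu : MemLp u (ENNReal.ofReal s) (volume.restrict Ω)) :
    ∫ x in Ω, |u x| ^ s = lebesgueNorm Ω s u ^ s := by
  rw [lebesgueNorm, toReal_eLpNorm_rpow hs hu]
  simp only [Real.norm_eq_abs]

/-- The sharp inequality `κ ∫ |u|^{mγ} ≤ ‖u‖^{mγ}`, with equality for some `u ≠ 0`. -/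
lemma exists_sharp_energy_inequality (hΩ : IsOpen Ω) (hΩb : Bornology.IsBounded Ω)
    (hΩne : Ω.Nonempty) (hr : 1 ≤ r) (hm : 1 < m) (hN : r * m < N) {γ : ℝ} (hγ : 1 < m * γ)
    (hγ' : m * γ < criticalExponent N r m) :
    ∃ κ : ℝ, 0 < κ ∧
      (∀ u : LmSpace Ω m, u ∈ sobolevZero Ω r m →
        MemLp u (ENNReal.ofReal (m * γ)) (volume.restrict Ω) ∧
        κ * (∫ x in Ω, |u x| ^ (m * γ)) ≤ energy Ω r m u ^ γ ∧
        (u ≠ 0 → 0 < ∫ x in Ω, |u x| ^ (m * γ))) ∧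
      ∃ u : LmSpace Ω m, u ∈ sobolevZero Ω r m ∧ u ≠ 0 ∧
        energy Ω r m u ^ γ = κ * ∫ x in Ω, |u x| ^ (m * γ) := by
  obtain ⟨d, hd0, hd, u₀, hu₀, hne, heq⟩ :=
    exists_optimal_constant hΩ hΩb hΩne hr hm hN hγ hγ'
  have hs0 : 0 < m * γ := by linarith
  have hpow : ∀ u : LmSpace Ω m, u ∈ sobolevZero Ω r m →
      energy Ω r m u ^ γ = weakNorm Ω r m u ^ (m * γ) := fun u hu => by
    rw [energy_eq_weakNorm (by linarith) (memLp_weakDr hΩ hΩb hm.le hu),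
      ← Real.rpow_mul (weakNorm_nonneg _ _ _ _)]
  refine ⟨d ^ (m * γ), by positivity, fun u hu => ?_, u₀, hu₀, hne, ?_⟩
  · obtain ⟨h1, h2⟩ := hd u hu
    have hb := lebesgueNorm_nonneg Ω (m * γ) u
    refine ⟨h1, ?_, fun h0 => ?_⟩
    · rw [integral_eq_lebesgueNorm hs0 h1, hpow u hu, ← Real.mul_rpow hd0.le hb]
      exact Real.rpow_le_rpow (mul_nonneg hd0.le hb) h2 hs0.le
    · rw [integral_eq_lebesgueNorm hs0 h1]
      exact Real.rpow_pos_of_pos (lebesgueNorm_pos hs0 h1 h0) _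
  · rw [integral_eq_lebesgueNorm hs0 (hd _ hu₀).1, hpow _ hu₀, heq,
      Real.mul_rpow hd0.le (lebesgueNorm_nonneg _ _ _)]

lemma energy_nonneg (Ω : Set (Space N)) (r : ℕ) (m : ℝ) (u : Space N → ℝ) :
    0 ≤ energy Ω r m u := by
  refine integral_nonneg fun x => Real.rpow_nonneg ?_ _
  rw [← norm_weakDr]
  exact norm_nonneg _

/-- Scaling: the energy is homogeneous of degree `m` and the integral of degree `mγ`, so the
multiple of `u` by `(τ / E(u))^(1/m)` serves. -/
lemma exists_energy_eq (hΩ : IsOpen Ω) (hΩb : Bornology.IsBounded Ω) (hm : 1 < m) {γ : ℝ}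
    (hγ : 0 < m * γ) {u : LmSpace Ω m} (hu : u ∈ sobolevZero Ω r m) (hu0 : u ≠ 0)
    (hul : MemLp u (ENNReal.ofReal (m * γ)) (volume.restrict Ω))
    (hpos : 0 < energy Ω r m u) {τ : ℝ} (hτ : 0 < τ) :
    ∃ w : LmSpace Ω m, w ∈ sobolevZero Ω r m ∧ w ≠ 0 ∧ energy Ω r m w = τ ∧
      (∫ x in Ω, |w x| ^ (m * γ)) =
        (τ / energy Ω r m u) ^ γ * ∫ x in Ω, |u x| ^ (m * γ) := by
  have hm0 : 0 < m := by linarith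
  have hq : 0 < τ / energy Ω r m u := div_pos hτ hpos
  set c : ℝ := (τ / energy Ω r m u) ^ m⁻¹ with hc
  have hc0 : 0 < c := by positivity
  have hcm : c ^ m = τ / energy Ω r m u := by
    rw [hc, ← Real.rpow_mul hq.le, inv_mul_cancel₀ hm0.ne', Real.rpow_one]
  obtain ⟨h1, h2⟩ := sobolevZero_smul hΩ hΩb hm.le hu c
  refine ⟨c • u, h1, smul_ne_zero hc0.ne' hu0, ?_, ?_⟩
  · rw [energy_eq_weakNorm hm0 (memLp_weakDr hΩ hΩb hm.le h1), h2, abs_of_pos hc0,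
      Real.mul_rpow hc0.le (weakNorm_nonneg _ _ _ _), hcm,
      ← energy_eq_weakNorm hm0 (memLp_weakDr hΩ hΩb hm.le hu), div_mul_cancel₀ _ hpos.ne']
  · have hw : MemLp (c • u : LmSpace Ω m) (ENNReal.ofReal (m * γ)) (volume.restrict Ω) :=
      (memLp_congr_ae (Lp.coeFn_smul c u)).2 (hul.const_smul c)
    rw [integral_eq_lebesgueNorm hγ hw, lebesgueNorm_smul, abs_of_pos hc0,
      Real.mul_rpow hc0.le (lebesgueNorm_nonneg _ _ _), Real.rpow_mul hc0.le, hcm,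
      ← integral_eq_lebesgueNorm hγ hul]

/-- The value of `M` at zero does not matter, and `γ - 1 > -1` makes the power integrable even when
it is singular there. -/
lemma primitive_eq_of_power {M : ℝ → ℝ} {C γ : ℝ} (hγ : 0 < γ)
    (hM : ∀ τ : ℝ, 0 < τ → M τ = C * τ ^ (γ - 1)) {τ : ℝ} (hτ : 0 ≤ τ) :
    primitive M τ = C / γ * τ ^ γ := by
  have h : primitive M τ = ∫ z in (0 : ℝ)..τ, C * z ^ (γ - 1) := by
    refine intervalIntegral.integral_congr_ae (Eventually.of_forall fun z hz => ?_)
    rw [Set.uIoc_of_le hτ] at hz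
    exact hM z hz.1
  rw [h, intervalIntegral.integral_const_mul, integral_rpow (Or.inl (by linarith)),
    sub_add_cancel, Real.zero_rpow hγ.ne', sub_zero]
  ring

/-- The Euler–Lagrange equation at an equality case of the sharp energy inequality. -/
lemma euler_lagrange (hΩ : IsOpen Ω) (hΩb : Bornology.IsBounded Ω) (hm : 1 < m) {γ : ℝ}
    (hγ : 1 < m * γ) {κ : ℝ}
    (hκ : ∀ u : LmSpace Ω m, u ∈ sobolevZero Ω r m →
      MemLp u (ENNReal.ofReal (m * γ)) (volume.restrict Ω) ∧
      κ * (∫ x in Ω, |u x| ^ (m * γ)) ≤ energy Ω r m u ^ γ)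
    {u v : LmSpace Ω m} (hu : u ∈ sobolevZero Ω r m) (hv : v ∈ sobolevZero Ω r m)
    (hpos : 0 < energy Ω r m u)
    (heq : energy Ω r m u ^ γ = κ * ∫ x in Ω, |u x| ^ (m * γ)) :
    energy Ω r m u ^ (γ - 1) * ∫ x in Ω, DrAbs Ω r u x ^ (m - 2) * DrInner Ω r u v x =
      κ * ∫ x in Ω, |u x| ^ (m * γ - 2) * u x * v x := by
  have hF := hasDerivAt_integral_norm_rpow hm (memLp_weakDr hΩ hΩb hm.le hu)
    (memLp_weakDr hΩ hΩb hm.le hv)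
  have hG := hasDerivAt_integral_norm_rpow hγ (hκ u hu).1 (hκ v hv).1
  set F : ℝ → ℝ := fun t => ∫ x in Ω, ‖weakDr Ω r u x + t • weakDr Ω r v x‖ ^ m with hFdef
  set G : ℝ → ℝ := fun t => ∫ x in Ω, ‖u x + t • v x‖ ^ (m * γ) with hGdef
  have hFe : ∀ t, F t = energy Ω r m (u + t • v : LmSpace Ω m) := fun t => by
    rw [energy, hFdef]
    refine integral_congr_ae ?_
    filter_upwards [(sobolevZero_add_smul hΩ hΩb hm.le hu hv t).2] with x hx
    rw [← norm_weakDr, hx]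
  have hGe : ∀ t, G t = ∫ x in Ω, |(u + t • v : LmSpace Ω m) x| ^ (m * γ) := fun t => by
    rw [hGdef]
    refine integral_congr_ae ?_
    filter_upwards [coeFn_add_smul u v t] with x hx
    rw [hx]
    rfl
  have hF0 : F 0 = energy Ω r m u := by rw [hFe]; simp
  have hG0 : G 0 = ∫ x in Ω, |u x| ^ (m * γ) := by rw [hGe]; simp
  -- Positive energy is needed here: `γ` may be smaller than one, and then the power is not
  -- differentiable at zero.
  have hH := (hF.rpow_const (p := γ) (Or.inl (by rw [← hF0] at hpos; exact hpos.ne'))).sub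
    (hG.const_mul κ)
  -- The function is nonnegative by the sharp inequality and vanishes at `0`. Using the difference
  -- instead of the quotient avoids differentiating a fraction.
  have hmin : IsLocalMin (fun t => F t ^ γ - κ * G t) 0 := by
    refine Eventually.of_forall fun t => ?_
    have h1 := (hκ _ (sobolevZero_add_smul hΩ hΩb hm.le hu hv t).1).2
    rw [← hFe, ← hGe] at h1
    show F 0 ^ γ - κ * G 0 ≤ F t ^ γ - κ * G t
    rw [hF0, hG0, heq, sub_self]
    linarith
  have h0 := hmin.hasDerivAt_eq_zero hH
  have hI : ∫ x in Ω, ‖weakDr Ω r u x‖ ^ (m - 2) * inner ℝ (weakDr Ω r u x) (weakDr Ω r v x) =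
      ∫ x in Ω, DrAbs Ω r u x ^ (m - 2) * DrInner Ω r u v x := by
    simp only [norm_weakDr, inner_weakDr]
  have hJ : ∫ x in Ω, ‖u x‖ ^ (m * γ - 2) * inner ℝ (u x) (v x) =
      ∫ x in Ω, |u x| ^ (m * γ - 2) * u x * v x := by
    refine integral_congr_ae (Eventually.of_forall fun x => ?_)
    simp only [Real.norm_eq_abs, RCLike.inner_apply, conj_trivial]
    ring
  rw [hI, hJ] at h0
  rw [hF0] at h0
  refine mul_left_cancel₀ (by linarith : m * γ ≠ 0) ?_
  linear_combination h0

end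

end Kirchhoff

end

/-! ### The main theorem -/

theorem mainTheorem5 {N r : ℕ} (hr : 1 ≤ r) {m γ : ℝ} (hm : 1 < m)
    (hN : (r : ℝ) * m + 1 ≤ N) (hγ : 1 < m * γ)
    (hγ' : m * γ < Kirchhoff.criticalExponent N r m)
    {Ω : Set (Kirchhoff.Space N)} (hΩ : IsOpen Ω) (hΩb : Bornology.IsBounded Ω)
    (hΩne : Ω.Nonempty) :
    (∀ M : ℝ → ℝ, ContinuousOn M (Set.Ici 0) →
      (0 < Kirchhoff.lambdaM Ω r m γ M ↔ Kirchhoff.Coercive γ M)) ∧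
    (∀ (M : ℝ → ℝ) (C : ℝ), 0 < C → (∀ τ : ℝ, 0 < τ → M τ = C * τ ^ (γ - 1)) →
      ∃ lam : ℝ, Kirchhoff.lambdaM Ω r m γ M = (lam : EReal) ∧
        (∃ u, Kirchhoff.IsMinimizer Ω r m γ M u) ∧
        ∀ u, Kirchhoff.IsMinimizer Ω r m γ M u →
          Kirchhoff.IsWeakSolution Ω r m γ M (γ * lam) u) := by
  have hγ0 : 0 < γ := by
    by_contra h
    nlinarith
  obtain ⟨κ, hκ0, hκ, u₀, hu₀, hne, heq⟩ := Kirchhoff.exists_sharp_energy_inequality hΩ hΩb hΩne hr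
    hm (by linarith) hγ hγ'
  have hpos : ∀ u : Kirchhoff.LmSpace Ω m, u ∈ Kirchhoff.sobolevZero Ω r m → u ≠ 0 →
      0 < Kirchhoff.energy Ω r m u := fun u hu h0 => by
    refine (Kirchhoff.energy_nonneg Ω r m u).lt_of_ne fun h => ?_
    have h1 := (hκ u hu).2.1
    rw [← h, Real.zero_rpow hγ0.ne'] at h1
    exact absurd h1 (not_le.2 (mul_pos hκ0 ((hκ u hu).2.2 h0)))
  refine ⟨fun M _ => ⟨fun h => ?_, ?_⟩, fun M C hC hM => ?_⟩
  · obtain ⟨c, hc0, hc⟩ := EReal.lt_iff_exists_real_btwn.1 h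
    have hc0' : 0 < c := by exact_mod_cast hc0
    -- The extremal rescaled to energy `τ` has `∫ |w|^{mγ} = τ^γ / κ`, so a quotient of at least `c`
    -- reads `M̂(τ) ≥ (c / κ) τ^γ`.
    refine ⟨c / κ, div_pos hc0' hκ0, fun τ hτ => ?_⟩
    rcases hτ.eq_or_lt with rfl | hτ
    · simp [Kirchhoff.primitive, Real.zero_rpow hγ0.ne']
    obtain ⟨w, hw, hw0, hwE, hwI⟩ := Kirchhoff.exists_energy_eq hΩ hΩb hm (by linarith) hu₀ hne
      (hκ _ hu₀).1 (hpos _ hu₀ hne) hτ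
    have h1 : (c : EReal) ≤ (Kirchhoff.quotient Ω r m γ M w : ℝ) :=
      hc.le.trans (iInf₂_le w ⟨hw, hw0⟩)
    have h2 : c ≤ Kirchhoff.quotient Ω r m γ M w := by exact_mod_cast h1
    rw [Kirchhoff.quotient, le_div_iff₀ ((hκ w hw).2.2 hw0), hwE, hwI,
      Real.div_rpow hτ.le (hpos _ hu₀ hne).le, heq] at h2
    have h3 := (hκ _ hu₀).2.2 hne
    refine le_trans (le_of_eq ?_) h2
    field_simp
  · rintro ⟨C, hC, hcoer⟩
    have h1 : ((C * κ : ℝ) : EReal) ≤ Kirchhoff.lambdaM Ω r m γ M := by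
      refine le_iInf₂ fun u hu => EReal.coe_le_coe_iff.2 ?_
      rw [Kirchhoff.quotient, le_div_iff₀ ((hκ u hu.1).2.2 hu.2)]
      refine le_trans ?_ (hcoer _ (Kirchhoff.energy_nonneg _ _ _ _))
      rw [mul_assoc]
      exact mul_le_mul_of_nonneg_left (hκ u hu.1).2.1 hC.le
    exact lt_of_lt_of_le (by exact_mod_cast mul_pos hC hκ0) h1
  · have hprim : ∀ u : Kirchhoff.LmSpace Ω m, Kirchhoff.quotient Ω r m γ M u =
        C / γ * Kirchhoff.energy Ω r m u ^ γ / ∫ x in Ω, |u x| ^ (m * γ) := fun u => by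
      rw [Kirchhoff.quotient,
        Kirchhoff.primitive_eq_of_power hγ0 hM (Kirchhoff.energy_nonneg _ _ _ _)]
    have hiff : ∀ u : Kirchhoff.LmSpace Ω m, u ∈ Kirchhoff.sobolevZero Ω r m → u ≠ 0 →
        Kirchhoff.energy Ω r m u ^ γ = (∫ x in Ω, |u x| ^ (m * γ)) *
          (Kirchhoff.quotient Ω r m γ M u / (C / γ)) := fun u hu h0 => by
      have := (hκ u hu).2.2 h0
      rw [hprim]
      field_simp
    have hq₀ : Kirchhoff.quotient Ω r m γ M u₀ = C / γ * κ := by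
      have := (hκ _ hu₀).2.2 hne
      rw [hprim, heq, ← mul_assoc, mul_div_cancel_right₀ _ this.ne']
    have hlam : Kirchhoff.lambdaM Ω r m γ M = ((C / γ * κ : ℝ) : EReal) := by
      refine le_antisymm ?_ (le_iInf₂ fun u hu => EReal.coe_le_coe_iff.2 ?_)
      · rw [← hq₀]
        exact iInf₂_le u₀ ⟨hu₀, hne⟩
      · rw [hprim, le_div_iff₀ ((hκ u hu.1).2.2 hu.2), mul_assoc]
        exact mul_le_mul_of_nonneg_left (hκ u hu.1).2.1 (by positivity)
    refine ⟨C / γ * κ, hlam, ⟨u₀, hu₀, hne, by rw [hlam, hq₀]⟩, fun u hu => ⟨hu.1, fun v hv => ?_⟩⟩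
    obtain ⟨hu, hu0, hmin⟩ := hu
    rw [hlam, EReal.coe_eq_coe_iff] at hmin
    have hE : Kirchhoff.energy Ω r m u ^ γ = κ * ∫ x in Ω, |u x| ^ (m * γ) := by
      rw [hiff u hu hu0, hmin]
      field_simp
    -- A minimizer is an equality case of the sharp inequality. Multiplying its Euler–Lagrange
    -- equation by `C` gives the claim, because `γ λ_M = C κ`.
    have h1 := Kirchhoff.euler_lagrange hΩ hΩb hm hγ (fun w hw => ⟨(hκ w hw).1, (hκ w hw).2.1⟩)
      hu hv (hpos u hu hu0) hE
    rw [hM _ (hpos u hu hu0), mul_assoc, h1]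
    field_simp
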